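/- \textbf{Conventions.} Let $M$ be a smooth manifold (Hausdorff, second countable, without boundary) of dimension $2n$ with an almost symplectic form $\omega$, i.e. a smooth $2$-form which is nondegenerate at every point, not necessarily closed. Let $(\mathcal A,\wedge,d)$ be the algebra of smooth real differential forms, $\mathcal A=\bigoplus_k\mathcal A^k$. All brackets are graded commutators, $[f,g]=fg-(-1)^{|f||g|}gf$. For covectors $a,b$ at a point put $\omega^{-1}(a,b)=b(v)$, where $v$ is the vector with $\omega(v,\cdot)=a$ (so the matrix of $\omega^{-1}$ is the inverse of the matrix of $\omega$), and let $\langle\cdot,\cdot\rangle_\omega$ be the pointwise pairing on forms with $\langle a_1\wedge\dots\wedge a_k,\,b_1\wedge\dots\wedge b_k\rangle_\omega=\det(\omega^{-1}(a_i,b_j))$, forms of different degrees being orthogonal. The symplectic Hodge star $\star_\omega:\mathcal A^k\to\mathcal A^{2n-k}$ is defined by $\alpha\wedge\star_\omega\beta=\langle\alpha,\beta\rangle_\omega\,\omega^n/n!$ for $\alpha,\beta\in\mathcal A^k$. The symplectic adjoint $\varphi^\omega$ of an operator $\varphi$ on $\mathcal A$ that is linear over functions is defined by $\langle\varphi\alpha,\beta\rangle_\omega=\langle\alpha,\varphi^\omega\beta\rangle_\omega$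 for all $\alpha,\beta\in\mathcal A$. Put $L\alpha=\omega\wedge\alpha$, $\Lambda=L^\omega$, and $d^\omega=(-1)^k\star_\omega d\,\star_\omega$ on $\mathcal A^k$. A graded endomorphism of $\mathcal A$ has order $\le 0$ if it is left multiplication by a homogeneous form, and order $\le r+1$ if its graded commutators with all left multiplications by homogeneous forms have order $\le r$. A commutative $\mathrm{BV}_\infty$-algebra $(A,\wedge,d=\Delta_0,\Delta_1,\Delta_2,\dots)$ is a commutative dg-algebra $(A,\wedge,d)$ with operators $\Delta_i$ of degree $1-2i$ and order $\le i+1$ such that $\sum_{i=0}^{m}\Delta_i\Delta_{m-i}=0$ for all $m\ge 0$; it is a BV-algebra if $\Delta_i=0$ for $i\ge 2$. \textbf{Theorem.} The operator $\star_\omega$ and the symplectic adjoints of $L$, $[d,L]$ and $[\Lambda,[d,L]]$ exist and are unique. Moreover $\langle\Lambda\alpha,\beta\rangle_\omega=\langle\alpha,L\beta\rangle_\omega$ for all $\alpha,\beta$, $\Lambda=\star_\omega L\star_\omega$, and $[d,L]^\omega=(-1)^{k+1}\star_\omega[d,L]\star_\omega$ on $\mathcal A^k$. The tuple $$\bigl(\mathcal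 A,\ \wedge,\ d,\ \Delta_1=d^\omega+[\Lambda,[d,L]]^\omega,\ \Delta_2=-[d,L]^\omega\bigr)$$ (with $\Delta_i=0$ for $i\ge 3$) is a commutative $\mathrm{BV}_\infty$-algebra, and in $\mathrm{End}(\mathcal A)[[\xi]]$ $$d+\Delta_1\xi+\Delta_2\xi^2=e^{\Lambda\xi}\,d\,e^{-\Lambda\xi}.$$ If $d\omega=0$, then $\Delta_1=d^\omega$ and $\Delta_2=0$, and $(\mathcal A,\wedge,d,d^\omega)$ is Koszul's BV-algebra of the symplectic manifold: it is a BV-algebra and $d^\omega=[i_\pi,d]$, where $\pi$ is the bivector field $\pi(a,b)=\omega(\sharp a,\sharp b)$, $\omega(\sharp a,\cdot)=a$, and $i_\pi\alpha=\tfrac12\sum_{i,j}\pi(\varepsilon^i,\varepsilon^j)\,\alpha(e_i,e_j,\cdot,\dots,\cdot)$ for a local frame $(e_i)$ with dual coframe $(\varepsilon^i)$. -/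

import Mathlib

open scoped Manifold ContDiff ExteriorAlgebra

set_option linter.unusedSectionVars false

noncomputable section

namespace SymplForms

open Module

/-! ### Graded algebra: order of operators, multicomplexes, commutative BV-infinity algebras -/

section GradedAlgebra

variable {𝕜 A : Type*} [Field 𝕜] [Ring A] [Algebra 𝕜 A]

/-- The sign `(-1) ^ k` of an integer `k`, as a scalar. -/
def sgn (𝕜 : Type*) [Field 𝕜] (k : ℤ) : 𝕜 := ((k.negOnePow : ℤˣ) : ℤ)

/-- The graded commutator `f g - (-1)^{p q} g f` of an operator `f` of degree `p`
and an operator `g` of degree `q`. -/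
def gradedBracket (p q : ℤ) (f g : End 𝕜 A) : End 𝕜 A :=
  f * g - sgn 𝕜 (p * q) • (g * f)

/-- `f` is homogeneous of degree `k` for the grading `𝒜`. -/
def IsOfDegree (𝒜 : ℤ → Submodule 𝕜 A) (k : ℤ) (f : End 𝕜 A) : Prop :=
  ∀ p : ℤ, ∀ a ∈ 𝒜 p, f a ∈ 𝒜 (p + k)

/-- `HasOrderLE 𝒜 r k f`: the operator `f` has degree `k` and algebraic order `≤ r`
(in the sense of Grothendieck). Order `≤ 0` means left multiplication by an element of degree `k`;
order `≤ r + 1` means that all graded commutators `[L_a, f]` with left multiplications `L_a` by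
homogeneous elements have order `≤ r`. -/
def HasOrderLE (𝒜 : ℤ → Submodule 𝕜 A) : ℕ → ℤ → End 𝕜 A → Prop
  | 0, k, f => ∃ a ∈ 𝒜 k, f = LinearMap.mulLeft 𝕜 a
  | r + 1, k, f => IsOfDegree 𝒜 k f ∧
      ∀ j : ℤ, ∀ a ∈ 𝒜 j, HasOrderLE 𝒜 r (j + k) (gradedBracket j k (LinearMap.mulLeft 𝕜 a) f)

/-- `(A, ∧, d)` is a commutative dg-algebra (unital, `ℤ`-graded, `d` of degree `1`). -/
structure IsCommDGAlgebra (𝒜 : ℤ → Submodule 𝕜 A) (d : End 𝕜 A) : Prop where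
  isInternal : DirectSum.IsInternal 𝒜
  one_mem : (1 : A) ∈ 𝒜 0
  mul_mem : ∀ p q : ℤ, ∀ a ∈ 𝒜 p, ∀ b ∈ 𝒜 q, a * b ∈ 𝒜 (p + q)
  graded_comm : ∀ p q : ℤ, ∀ a ∈ 𝒜 p, ∀ b ∈ 𝒜 q, a * b = sgn 𝕜 (p * q) • (b * a)
  degree : IsOfDegree 𝒜 1 d
  leibniz : ∀ p : ℤ, ∀ a ∈ 𝒜 p, ∀ b : A, d (a * b) = d a * b + sgn 𝕜 p • (a * d b)
  sq_zero : d * d = 0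

/-- `(A, Δ₀, Δ₁, …)` is a multicomplex: `Δᵢ` has degree `1 - 2i` and
`∑_{i + j = n} Δᵢ Δⱼ = 0` for all `n`. -/
structure IsMulticomplex (𝒜 : ℤ → Submodule 𝕜 A) (Δ : ℕ → End 𝕜 A) : Prop where
  degree : ∀ i : ℕ, IsOfDegree 𝒜 (1 - 2 * (i : ℤ)) (Δ i)
  sum_eq_zero : ∀ n : ℕ, ∑ i ∈ Finset.range (n + 1), Δ i * Δ (n - i) = 0

/-- `(A, ∧, d = Δ₀, Δ₁, Δ₂, …)` is a commutative BV-infinity algebra. -/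
structure IsCommBVInfinityAlgebra (𝒜 : ℤ → Submodule 𝕜 A) (Δ : ℕ → End 𝕜 A) : Prop where
  commDGAlgebra : IsCommDGAlgebra 𝒜 (Δ 0)
  multicomplex : IsMulticomplex 𝒜 Δ
  order : ∀ n : ℕ, HasOrderLE 𝒜 (n + 1) (1 - 2 * (n : ℤ)) (Δ n)

/-- The sequence `d, Δ₁, Δ₂, 0, 0, …`. -/
def opSeq (d Δ₁ Δ₂ : End 𝕜 A) : ℕ → End 𝕜 A
  | 0 => d
  | 1 => Δ₁
  | 2 => Δ₂
  | _ => 0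

/-- `(A, ∧, d, Δ)` is a (differential graded) BV-algebra, that is, a commutative BV-infinity
algebra with `Δₙ = 0` for `n ≥ 2`. -/
def IsBVAlgebra (𝒜 : ℤ → Submodule 𝕜 A) (d Δ : End 𝕜 A) : Prop :=
  IsCommBVInfinityAlgebra 𝒜 (opSeq d Δ 0)

/-- The formal exponential `e^{f ξ} = ∑ₙ fⁿ ξⁿ / n!` in `End(A)[[ξ]]`. -/
def expSeries (f : End 𝕜 A) : PowerSeries (End 𝕜 A) :=
  PowerSeries.mk fun n => ((n.factorial : 𝕜)⁻¹) • f ^ n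

end GradedAlgebra

/-! ### Exterior algebra of a cotangent space -/

section Fibre

variable {V : Type*} [AddCommGroup V] [Module ℝ V]

/-- `ℤ`-indexed exterior powers, zero in negative degrees. -/
def extDeg (W : Type*) [AddCommGroup W] [Module ℝ W] : ℤ → Submodule ℝ (ExteriorAlgebra ℝ W)
  | Int.ofNat k => ⋀[ℝ]^k W
  | Int.negSucc _ => ⊥

/-- Contraction `i_v` (interior product) of an exterior form on `V` by a vector `v`; it is the
antiderivation with `i_v θ = θ(v)` for covectors `θ`. -/
def contract : V →ₗ[ℝ] End ℝ (ExteriorAlgebra ℝ (Dual ℝ V)) :=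
  CliffordAlgebra.contractLeft ∘ₗ Dual.eval ℝ V

theorem contract_ι_mul (v : V) (θ : Dual ℝ V) (u : ExteriorAlgebra ℝ (Dual ℝ V)) :
    contract v (ExteriorAlgebra.ι ℝ θ * u) = θ v • u - ExteriorAlgebra.ι ℝ θ * contract v u :=
  CliffordAlgebra.contractLeft_ι_mul ..

theorem contract_one (v : V) : contract v (1 : ExteriorAlgebra ℝ (Dual ℝ V)) = 0 :=
  CliffordAlgebra.contractLeft_one ..

theorem contract_contract (v : V) (u : ExteriorAlgebra ℝ (Dual ℝ V)) :
    contract v (contract v u) = 0 :=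
  CliffordAlgebra.contractLeft_contractLeft ..

/-- The bilinear form `(v, w) ↦ ω(v, w)` of an exterior `2`-form `ω`. -/
def formBilin (u : ExteriorAlgebra ℝ (Dual ℝ V)) : LinearMap.BilinForm ℝ V :=
  LinearMap.mk₂ ℝ (fun v w => ExteriorAlgebra.algebraMapInv (contract w (contract v u)))
    (by intros; simp) (by intros; simp) (by intros; simp) (by intros; simp)

theorem formBilin_ι_mul_ι (θ η : Dual ℝ V) (v w : V) :
    formBilin (ExteriorAlgebra.ι ℝ θ * ExteriorAlgebra.ι ℝ η) v w = θ v * η w - θ w * η v := by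
  have h : ∀ (ζ : Dual ℝ V) (z : V), contract z (ExteriorAlgebra.ι ℝ ζ) =
      algebraMap ℝ _ (ζ z) := fun ζ z => CliffordAlgebra.contractLeft_ι ..
  have h' : ∀ (r : ℝ) (z : V), contract z (algebraMap ℝ (ExteriorAlgebra ℝ (Dual ℝ V)) r) = 0 :=
    fun r z => CliffordAlgebra.contractLeft_algebraMap ..
  simp only [formBilin, LinearMap.mk₂_apply, contract_ι_mul, map_sub, map_smul, h, h', mul_zero,
    sub_zero]
  rw [ExteriorAlgebra.algebraMap_leftInverse, ExteriorAlgebra.algebraMap_leftInverse]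
  simp

theorem contract_ιMulti (v : V) (n : ℕ) (b : Fin (n + 1) → Dual ℝ V) :
    contract v (ExteriorAlgebra.ιMulti ℝ (n + 1) b) =
      ∑ j : Fin (n + 1), ((-1 : ℝ) ^ (j : ℕ) * b j v) •
        ExteriorAlgebra.ιMulti ℝ n (fun i => b (j.succAbove i)) := by
  induction n with
  | zero =>
    rw [ExteriorAlgebra.ιMulti_succ_apply, contract_ι_mul, ExteriorAlgebra.ιMulti_zero_apply,
      contract_one]
    simp
  | succ n ih =>
    rw [ExteriorAlgebra.ιMulti_succ_apply, contract_ι_mul, ih, Fin.sum_univ_succ (n := n + 1)]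
    have key : ∀ j : Fin (n + 1), ExteriorAlgebra.ιMulti ℝ (n + 1)
        (fun i => b (j.succ.succAbove i)) = ExteriorAlgebra.ι ℝ (b 0) *
          ExteriorAlgebra.ιMulti ℝ n (fun i => Matrix.vecTail b (j.succAbove i)) := by
      intro j
      rw [ExteriorAlgebra.ιMulti_succ_apply]
      simp [Matrix.vecTail, Function.comp_def, Fin.succ_succAbove_succ]
    simp only [key, Finset.mul_sum, mul_smul_comm]
    simp [Matrix.vecTail, pow_succ, sub_eq_add_neg, Function.comp_def, ← Finset.sum_neg_distrib]

variable [FiniteDimensional ℝ V]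

/-- The inverse `Dual V → V` of the isomorphism `V → Dual V`, `v ↦ B(v, ·)`. -/
def sharp (B : LinearMap.BilinForm ℝ V) (hB : B.Nondegenerate) : Dual ℝ V →ₗ[ℝ] V :=
  (B.toDual hB).symm.toLinearMap

/-- The bilinear form `B⁻¹` on the dual space: `B⁻¹(a, b) = b(v)` where `v` is the vector with
`B(v, ·) = a`. Its matrix in a dual basis is the inverse of the matrix of `B`. -/
def invBilin (B : LinearMap.BilinForm ℝ V) (hB : B.Nondegenerate) :
    LinearMap.BilinForm ℝ (Dual ℝ V) :=
  (Dual.eval ℝ V) ∘ₗ (sharp B hB)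

/-- The action of exterior forms by iterated contraction, `a₁ ∧ ⋯ ∧ a_k ↦ i_{♯a₁} ∘ ⋯ ∘ i_{♯a_k}`. -/
def contractForm (B : LinearMap.BilinForm ℝ V) (hB : B.Nondegenerate) :
    ExteriorAlgebra ℝ (Dual ℝ V) →ₐ[ℝ] End ℝ (ExteriorAlgebra ℝ (Dual ℝ V)) :=
  ExteriorAlgebra.lift ℝ ⟨(contract (V := V)) ∘ₗ sharp B hB, fun a => by
    refine LinearMap.ext fun u => ?_
    exact contract_contract (sharp B hB a) u⟩

/-- The pairing on the exterior algebra of `Dual V` induced by a nondegenerate form `B` on `V`: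
`⟨a₁ ∧ ⋯ ∧ a_k, b₁ ∧ ⋯ ∧ b_k⟩ = det (B⁻¹(aᵢ, bⱼ))`, and `⟨α, β⟩ = 0` for `α`, `β` of different
degrees; see `extPairing_ιMulti` and `extPairing_ιMulti_of_ne`. -/
def extPairing (B : LinearMap.BilinForm ℝ V) (hB : B.Nondegenerate) :
    LinearMap.BilinForm ℝ (ExteriorAlgebra ℝ (Dual ℝ V)) :=
  LinearMap.mk₂ ℝ (fun α β => ExteriorAlgebra.algebraMapInv
      (contractForm B hB (CliffordAlgebra.reverse α) β))
    (by intros; simp) (by intros; simp) (by intros; simp) (by intros; simp)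

theorem extPairing_one (B : LinearMap.BilinForm ℝ V) (hB : B.Nondegenerate)
    (β : ExteriorAlgebra ℝ (Dual ℝ V)) :
    extPairing B hB 1 β = ExteriorAlgebra.algebraMapInv β := by
  simp [extPairing]

theorem extPairing_ι_mul (B : LinearMap.BilinForm ℝ V) (hB : B.Nondegenerate) (a : Dual ℝ V)
    (α β : ExteriorAlgebra ℝ (Dual ℝ V)) :
    extPairing B hB (ExteriorAlgebra.ι ℝ a * α) β =
      extPairing B hB α (contract (sharp B hB a) β) := by
  have h : contractForm B hB (ExteriorAlgebra.ι ℝ a) = contract (sharp B hB a) := by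
    simp [contractForm]
  have h2 : CliffordAlgebra.reverse (ExteriorAlgebra.ι ℝ a * α) =
      CliffordAlgebra.reverse α * ExteriorAlgebra.ι ℝ a := by
    rw [CliffordAlgebra.reverse.map_mul]
    congr 1
    exact CliffordAlgebra.reverse_ι a
  simp only [extPairing, LinearMap.mk₂_apply, h2, map_mul, h]
  rfl

theorem extPairing_ιMulti (B : LinearMap.BilinForm ℝ V) (hB : B.Nondegenerate) (n : ℕ)
    (a b : Fin n → Dual ℝ V) :
    extPairing B hB (ExteriorAlgebra.ιMulti ℝ n a) (ExteriorAlgebra.ιMulti ℝ n b) =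
      (Matrix.of fun i j => invBilin B hB (a i) (b j)).det := by
  induction n with
  | zero => simp [extPairing_one]
  | succ n ih =>
    rw [ExteriorAlgebra.ιMulti_succ_apply, extPairing_ι_mul, contract_ιMulti, map_sum,
      Matrix.det_succ_row_zero]
    refine Finset.sum_congr rfl fun j _ => ?_
    rw [map_smul, ih]
    rfl

theorem extPairing_ιMulti_of_ne (B : LinearMap.BilinForm ℝ V) (hB : B.Nondegenerate) (k l : ℕ)
    (h : k ≠ l) (a : Fin k → Dual ℝ V) (b : Fin l → Dual ℝ V) :
    extPairing B hB (ExteriorAlgebra.ιMulti ℝ k a) (ExteriorAlgebra.ιMulti ℝ l b) = 0 := by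
  induction k generalizing l with
  | zero =>
    obtain ⟨m, rfl⟩ := Nat.exists_eq_succ_of_ne_zero h.symm
    rw [ExteriorAlgebra.ιMulti_zero_apply, extPairing_one, ExteriorAlgebra.ιMulti_succ_apply]
    simp [ExteriorAlgebra.algebraMapInv]
  | succ k ih =>
    rw [ExteriorAlgebra.ιMulti_succ_apply, extPairing_ι_mul]
    cases l with
    | zero => rw [ExteriorAlgebra.ιMulti_zero_apply, contract_one, map_zero]
    | succ l =>
      rw [contract_ιMulti, map_sum]
      refine Finset.sum_eq_zero fun j _ => ?_
      rw [map_smul, ih l (by omega), smul_zero]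

/-- Contraction by the bivector `π` with `π(a, b) = B(♯a, ♯b)`, where `B(♯a, ·) = a`; that is
`i_π = ½ ∑ π(εⁱ, εʲ) i_{eⱼ} i_{eᵢ}` for a basis `e` with dual basis `ε`, so that
`(i_π α)(…) = ½ ∑ π(εⁱ, εʲ) α(eᵢ, eⱼ, …)`. -/
def contractPoisson (B : LinearMap.BilinForm ℝ V) (hB : B.Nondegenerate) :
    End ℝ (ExteriorAlgebra ℝ (Dual ℝ V)) :=
  (1 / 2 : ℝ) • ∑ i, ∑ j,
    B (sharp B hB ((finBasis ℝ V).coord i)) (sharp B hB ((finBasis ℝ V).coord j)) •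
      (contract (finBasis ℝ V j) * contract (finBasis ℝ V i))

end Fibre

/-! ### Differential forms on a smooth manifold -/

section Manifold

variable (E : Type*) [NormedAddCommGroup E] [NormedSpace ℝ E]
  (M : Type*) [TopologicalSpace M] [ChartedSpace E M]

/-- The exterior algebra of the cotangent space of `M` at `x`. -/
abbrev CotangentExt (x : M) : Type _ :=
  ExteriorAlgebra ℝ (Dual ℝ (TangentSpace 𝓘(ℝ, E) x))

variable {M}

/-- The differential at `x` of a real function, as a covector. -/
def differentialAt (g : M → ℝ) (x : M) : Dual ℝ (TangentSpace 𝓘(ℝ, E) x) :=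
  ((mfderiv 𝓘(ℝ, E) 𝓘(ℝ, ℝ) g x : TangentSpace 𝓘(ℝ, E) x →L[ℝ] ℝ)).toLinearMap

/-- The fields `a` of exterior forms which are finite sums of terms `f dg₁ ∧ ⋯ ∧ dg_k` with
`f, g₁, …, g_k` smooth on `U`: the subalgebra generated by such `f` and `dg`. -/
def localForms (U : Set M) : Subalgebra ℝ (Π x : M, CotangentExt E M x) :=
  Algebra.adjoin ℝ
    ({a | ∃ f : M → ℝ, ContMDiffOn 𝓘(ℝ, E) 𝓘(ℝ, ℝ) ∞ f U ∧ a = fun x => algebraMap ℝ _ (f x)} ∪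
      {a | ∃ g : M → ℝ, ContMDiffOn 𝓘(ℝ, E) 𝓘(ℝ, ℝ) ∞ g U ∧
        a = fun x => ExteriorAlgebra.ι ℝ (differentialAt E g x)})

theorem localForms_mono {U V : Set M} (h : V ⊆ U) : localForms E U ≤ localForms E V := by
  refine Algebra.adjoin_mono (Set.union_subset_union ?_ ?_)
  · rintro a ⟨f, hf, rfl⟩; exact ⟨f, hf.mono h, rfl⟩
  · rintro a ⟨f, hf, rfl⟩; exact ⟨f, hf.mono h, rfl⟩

variable (M)

/-- The algebra `A` of smooth differential forms on `M`, with the wedge product as multiplication: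
sections of the exterior algebra of the cotangent bundle which, in a neighbourhood of every point,
are finite sums of terms `f dg₁ ∧ ⋯ ∧ dg_k` with `f, g₁, …, g_k` smooth. -/
def smoothForms : Subalgebra ℝ (Π x : M, CotangentExt E M x) where
  carrier := {a | ∀ x : M, ∃ U : Set M, IsOpen U ∧ x ∈ U ∧ ∃ b ∈ localForms E U,
    ∀ y ∈ U, a y = b y}
  mul_mem' := by
    intro a b ha hb x
    obtain ⟨U, hU, hx, a', ha', haa⟩ := ha x
    obtain ⟨V, hV, hxV, b', hb', hbb⟩ := hb x
    refine ⟨U ∩ V, hU.inter hV, ⟨hx, hxV⟩, a' * b', mul_mem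
      (localForms_mono E Set.inter_subset_left ha')
      (localForms_mono E Set.inter_subset_right hb'), fun y hy => ?_⟩
    simp [haa y hy.1, hbb y hy.2]
  add_mem' := by
    intro a b ha hb x
    obtain ⟨U, hU, hx, a', ha', haa⟩ := ha x
    obtain ⟨V, hV, hxV, b', hb', hbb⟩ := hb x
    refine ⟨U ∩ V, hU.inter hV, ⟨hx, hxV⟩, a' + b', add_mem
      (localForms_mono E Set.inter_subset_left ha')
      (localForms_mono E Set.inter_subset_right hb'), fun y hy => ?_⟩
    simp [haa y hy.1, hbb y hy.2]
  algebraMap_mem' := fun r x =>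
    ⟨Set.univ, isOpen_univ, trivial, _, Subalgebra.algebraMap_mem _ r, fun _ _ => rfl⟩

/-- The algebra of smooth differential forms, as a type. -/
abbrev DiffForm : Type _ := smoothForms E M

/-- The space `A^k` of smooth `k`-forms (zero for `k < 0`). -/
def formsOfDegree (k : ℤ) : Submodule ℝ (DiffForm E M) where
  carrier := {a | ∀ x : M, a.1 x ∈ extDeg (Dual ℝ (TangentSpace 𝓘(ℝ, E) x)) k}
  add_mem' := fun ha hb x => add_mem (ha x) (hb x)
  zero_mem' := fun _ => zero_mem _
  smul_mem' := fun r _ ha x => Submodule.smul_mem _ r (ha x)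

variable {M}

theorem involute_mem_localForms {U : Set M} {a : Π x : M, CotangentExt E M x}
    (ha : a ∈ localForms E U) :
    (fun x => (CliffordAlgebra.involute (a x) : CotangentExt E M x)) ∈ localForms E U := by
  induction ha using Algebra.adjoin_induction with
  | mem a ha =>
    rcases ha with ⟨f, hf, rfl⟩ | ⟨g, hg, rfl⟩
    · refine Algebra.subset_adjoin (Or.inl ⟨f, hf, funext fun x => ?_⟩)
      exact AlgHom.commutes _ _
    · have h := neg_mem (Algebra.subset_adjoin (R := ℝ) (Or.inr ⟨g, hg, rfl⟩) :
        (fun x => ExteriorAlgebra.ι ℝ (differentialAt E g x)) ∈ localForms E U)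
      have h2 : (fun x => (CliffordAlgebra.involute
          (ExteriorAlgebra.ι ℝ (differentialAt E g x)) : CotangentExt E M x)) =
          -fun x => ExteriorAlgebra.ι ℝ (differentialAt E g x) := by
        funext x
        exact CliffordAlgebra.involute_ι _
      rw [h2]
      exact h
  | algebraMap r =>
    convert Subalgebra.algebraMap_mem (localForms E U) r using 1
    funext x
    exact AlgHom.commutes _ _
  | add a b _ _ ha hb =>
    convert add_mem ha hb using 1
    funext x
    exact map_add _ _ _
  | mul a b _ _ ha hb =>
    convert mul_mem ha hb using 1
    funext x
    exact map_mul _ _ _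

/-- The parity operator on forms: multiplication by `(-1)^k` on `k`-forms. -/
def parity : End ℝ (DiffForm E M) where
  toFun a := ⟨fun x => CliffordAlgebra.involute (a.1 x), fun x => by
    obtain ⟨U, hU, hx, b, hb, hab⟩ := a.2 x
    exact ⟨U, hU, hx, _, involute_mem_localForms E hb, fun y hy =>
      congrArg _ (hab y hy)⟩⟩
  map_add' a b := Subtype.ext (funext fun x => map_add _ _ _)
  map_smul' r a := Subtype.ext (funext fun x => by
    simp only [RingHom.id_apply, Subalgebra.coe_smul, Pi.smul_apply]
    exact map_smul CliffordAlgebra.involute r (a.1 x))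

theorem involute_of_mem_extDeg {W : Type*} [AddCommGroup W] [Module ℝ W] {k : ℤ}
    {u : ExteriorAlgebra ℝ W} (hu : u ∈ extDeg W k) :
    CliffordAlgebra.involute u = sgn ℝ k • u := by
  cases k with
  | negSucc k =>
    obtain rfl := (Submodule.mem_bot ℝ).1 hu
    rw [map_zero, smul_zero]
  | ofNat k =>
    have hs : sgn ℝ (Int.ofNat k) = (-1 : ℝ) ^ k := by simp [sgn]
    rw [hs]
    change u ∈ ⋀[ℝ]^k W at hu
    rw [← ExteriorAlgebra.ιMulti_span_fixedDegree] at hu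
    induction hu using Submodule.span_induction with
    | mem u hu =>
      obtain ⟨v, rfl⟩ := hu
      rw [ExteriorAlgebra.ιMulti_apply]
      have := CliffordAlgebra.involute_prod_map_ι (Q := (0 : QuadraticForm ℝ W)) (List.ofFn v)
      rw [List.map_ofFn, List.length_ofFn] at this
      exact this
    | zero => rw [map_zero, smul_zero]
    | add u v _ _ hu hv => rw [map_add, hu, hv, smul_add]
    | smul r u _ hu => rw [map_smul, hu, smul_comm]

theorem parity_apply_of_mem {k : ℤ} {a : DiffForm E M} (ha : a ∈ formsOfDegree E M k) :
    parity E a = sgn ℝ k • a := by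
  refine Subtype.ext (funext fun x => ?_)
  rw [Subalgebra.coe_smul, Pi.smul_apply]
  exact involute_of_mem_extDeg (ha x)

/-! #### The exterior derivative -/

variable {E}

/-- Pullback of exterior forms along a linear map. -/
def pullExt {V W : Type*} [AddCommGroup V] [Module ℝ V] [AddCommGroup W] [Module ℝ W]
    (T : V →ₗ[ℝ] W) : ExteriorAlgebra ℝ (Dual ℝ W) →ₐ[ℝ] ExteriorAlgebra ℝ (Dual ℝ V) :=
  ExteriorAlgebra.map T.dualMap

theorem pullExt_ι {V W : Type*} [AddCommGroup V] [Module ℝ V] [AddCommGroup W] [Module ℝ W]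
    (T : V →ₗ[ℝ] W) (θ : Dual ℝ W) :
    pullExt T (ExteriorAlgebra.ι ℝ θ) = ExteriorAlgebra.ι ℝ (θ ∘ₗ T) :=
  ExteriorAlgebra.map_apply_ι _ _

theorem pullExt_involute {V W : Type*} [AddCommGroup V] [Module ℝ V] [AddCommGroup W] [Module ℝ W]
    (T : V →ₗ[ℝ] W) (u : ExteriorAlgebra ℝ (Dual ℝ W)) :
    pullExt T (CliffordAlgebra.involute u) = CliffordAlgebra.involute (pullExt T u) := by
  have h : (pullExt T).comp CliffordAlgebra.involute =
      AlgHom.comp CliffordAlgebra.involute (pullExt T) := by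
    refine ExteriorAlgebra.hom_ext (LinearMap.ext fun θ => ?_)
    change pullExt T (CliffordAlgebra.involute (ExteriorAlgebra.ι ℝ θ)) =
      CliffordAlgebra.involute (pullExt T (ExteriorAlgebra.ι ℝ θ))
    have h1 : CliffordAlgebra.involute (ExteriorAlgebra.ι ℝ θ) = -ExteriorAlgebra.ι ℝ θ :=
      CliffordAlgebra.involute_ι θ
    rw [h1, map_neg, pullExt_ι]
    exact (CliffordAlgebra.involute_ι (θ ∘ₗ T)).symm
  exact DFunLike.congr_fun h u

theorem pullExt_pullExt {V W : Type*} [AddCommGroup V] [Module ℝ V] [AddCommGroup W] [Module ℝ W]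
    (T : V →ₗ[ℝ] W) (S : W →ₗ[ℝ] V) (h : S ∘ₗ T = LinearMap.id)
    (u : ExteriorAlgebra ℝ (Dual ℝ V)) : pullExt T (pullExt S u) = u := by
  have h : (pullExt T).comp (pullExt S) = AlgHom.id ℝ _ := by
    refine ExteriorAlgebra.hom_ext (LinearMap.ext fun θ => ?_)
    change pullExt T (pullExt S (ExteriorAlgebra.ι ℝ θ)) = ExteriorAlgebra.ι ℝ θ
    rw [pullExt_ι, pullExt_ι, LinearMap.comp_assoc, h, LinearMap.comp_id]
  exact DFunLike.congr_fun h u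

theorem ι_mul_eq_involute_mul {W : Type*} [AddCommGroup W] [Module ℝ W] (θ : W)
    (u : ExteriorAlgebra ℝ W) :
    ExteriorAlgebra.ι ℝ θ * u = CliffordAlgebra.involute u * ExteriorAlgebra.ι ℝ θ := by
  induction u using ExteriorAlgebra.induction with
  | algebraMap r => rw [AlgHom.commutes, Algebra.commutes]
  | ι η =>
    have h : CliffordAlgebra.involute (ExteriorAlgebra.ι ℝ η) = -ExteriorAlgebra.ι ℝ η :=
      CliffordAlgebra.involute_ι η
    rw [h, neg_mul]
    exact eq_neg_of_add_eq_zero_left (ExteriorAlgebra.ι_add_mul_swap θ η)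
  | mul a b ha hb => rw [← mul_assoc, ha, mul_assoc, hb, map_mul, mul_assoc]
  | add a b ha hb => rw [mul_add, ha, hb, map_add, add_mul]

section Derivative

variable [FiniteDimensional ℝ E]

instance finite_exteriorAlgebra {W : Type*} [AddCommGroup W] [Module ℝ W] [FiniteDimensional ℝ W] :
    FiniteDimensional ℝ (ExteriorAlgebra ℝ W) :=
  Module.Finite.of_basis (finBasis ℝ W).ExteriorAlgebra

/-- Coordinates on the finite-dimensional vector space of exterior forms on `E`. -/
def extCoord (E : Type*) [NormedAddCommGroup E] [NormedSpace ℝ E] [FiniteDimensional ℝ E] :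
    ExteriorAlgebra ℝ (Dual ℝ E) ≃ₗ[ℝ] (Fin (finrank ℝ (ExteriorAlgebra ℝ (Dual ℝ E))) → ℝ) :=
  (finBasis ℝ (ExteriorAlgebra ℝ (Dual ℝ E))).equivFun

/-- Derivative at `z`, in the direction `v`, of a function on `E` with values in the
finite-dimensional vector space of exterior forms on `E` (componentwise in a basis). -/
def dirDeriv (F : E → ExteriorAlgebra ℝ (Dual ℝ E)) (z v : E) : ExteriorAlgebra ℝ (Dual ℝ E) :=
  (extCoord E).symm (fderiv ℝ (fun y => extCoord E (F y)) z v)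

/-- Differentiability of a function on `E` with values in exterior forms. -/
def DiffAt (F : E → ExteriorAlgebra ℝ (Dual ℝ E)) (z : E) : Prop :=
  DifferentiableAt ℝ (fun y => extCoord E (F y)) z

/-- The exterior derivative `dF = ∑ᵢ εⁱ ∧ ∂ᵢ F` of a form `F` on the vector space `E`,
for a basis `e` of `E` with dual basis `ε`. -/
def flatExtDeriv (F : E → ExteriorAlgebra ℝ (Dual ℝ E)) (z : E) : ExteriorAlgebra ℝ (Dual ℝ E) :=
  ∑ i, ExteriorAlgebra.ι ℝ ((finBasis ℝ E).coord i) * dirDeriv F z (finBasis ℝ E i)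

theorem dirDeriv_congr {F G : E → ExteriorAlgebra ℝ (Dual ℝ E)} {z : E} (h : F =ᶠ[nhds z] G)
    (v : E) : dirDeriv F z v = dirDeriv G z v := by
  have : (fun y => extCoord E (F y)) =ᶠ[nhds z] (fun y => extCoord E (G y)) :=
    h.mono fun y hy => by simp only [hy]
  rw [dirDeriv, this.fderiv_eq, dirDeriv]

theorem flatExtDeriv_congr {F G : E → ExteriorAlgebra ℝ (Dual ℝ E)} {z : E}
    (h : F =ᶠ[nhds z] G) : flatExtDeriv F z = flatExtDeriv G z := by
  simp only [flatExtDeriv, dirDeriv_congr h]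

theorem DiffAt.congr {F G : E → ExteriorAlgebra ℝ (Dual ℝ E)} {z : E} (hF : DiffAt F z)
    (h : F =ᶠ[nhds z] G) : DiffAt G z := by
  have : (fun y => extCoord E (F y)) =ᶠ[nhds z] (fun y => extCoord E (G y)) :=
    h.mono fun y hy => by simp only [hy]
  exact this.differentiableAt_iff.1 hF

theorem DiffAt.add {F G : E → ExteriorAlgebra ℝ (Dual ℝ E)} {z : E} (hF : DiffAt F z)
    (hG : DiffAt G z) : DiffAt (fun y => F y + G y) z := by
  have := DifferentiableAt.fun_add hF hG
  simpa only [DiffAt, map_add] using this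

theorem flatExtDeriv_add {F G : E → ExteriorAlgebra ℝ (Dual ℝ E)} {z : E} (hF : DiffAt F z)
    (hG : DiffAt G z) :
    flatExtDeriv (fun y => F y + G y) z = flatExtDeriv F z + flatExtDeriv G z := by
  have h : ∀ v, dirDeriv (fun y => F y + G y) z v = dirDeriv F z v + dirDeriv G z v := by
    intro v
    simp only [dirDeriv, map_add]
    rw [fderiv_fun_add hF hG, _root_.add_apply, map_add]
  simp only [flatExtDeriv, h, mul_add, Finset.sum_add_distrib]

theorem DiffAt.smul {F : E → ExteriorAlgebra ℝ (Dual ℝ E)} {z : E} (hF : DiffAt F z)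
    (r : ℝ) : DiffAt (fun y => r • F y) z := by
  have := DifferentiableAt.fun_const_smul hF r
  simpa only [DiffAt, map_smul] using this

theorem flatExtDeriv_smul {F : E → ExteriorAlgebra ℝ (Dual ℝ E)} {z : E} (hF : DiffAt F z)
    (r : ℝ) : flatExtDeriv (fun y => r • F y) z = r • flatExtDeriv F z := by
  have h : ∀ v, dirDeriv (fun y => r • F y) z v = r • dirDeriv F z v := by
    intro v
    simp only [dirDeriv, map_smul]
    rw [fderiv_fun_const_smul hF, _root_.smul_apply, map_smul]
  simp only [flatExtDeriv, h, mul_smul_comm, Finset.smul_sum]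

theorem hasFDerivAt_linear {W : Type*} [NormedAddCommGroup W] [NormedSpace ℝ W]
    [FiniteDimensional ℝ W] (T : W →ₗ[ℝ] ExteriorAlgebra ℝ (Dual ℝ E)) {f : E → W} {f' : E →L[ℝ] W}
    {z : E} (hf : HasFDerivAt f f' z) :
    DiffAt (fun y => T (f y)) z ∧ ∀ v, dirDeriv (fun y => T (f y)) z v = T (f' v) := by
  have h := (LinearMap.toContinuousLinearMap ((extCoord E).toLinearMap ∘ₗ T)).hasFDerivAt.comp z hf
  have h' : HasFDerivAt (fun y => extCoord E (T (f y))) _ z := h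
  refine ⟨h'.differentiableAt, fun v => ?_⟩
  rw [dirDeriv, h'.fderiv]
  simp

/-- The product of exterior forms in coordinates. -/
def coordMul (E : Type*) [NormedAddCommGroup E] [NormedSpace ℝ E] [FiniteDimensional ℝ E] :
    (Fin (finrank ℝ (ExteriorAlgebra ℝ (Dual ℝ E))) → ℝ) →ₗ[ℝ]
      (Fin (finrank ℝ (ExteriorAlgebra ℝ (Dual ℝ E))) → ℝ) →ₗ[ℝ]
      (Fin (finrank ℝ (ExteriorAlgebra ℝ (Dual ℝ E))) → ℝ) :=
  LinearMap.mk₂ ℝ (fun a b => extCoord E ((extCoord E).symm a * (extCoord E).symm b))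
    (fun a b c => by rw [map_add, add_mul, map_add])
    (fun r a b => by rw [map_smul, smul_mul_assoc, map_smul])
    (fun a b c => by rw [map_add, mul_add, map_add])
    (fun r a b => by rw [map_smul, mul_smul_comm, map_smul])

theorem coordMul_apply (u w : ExteriorAlgebra ℝ (Dual ℝ E)) :
    coordMul E (extCoord E u) (extCoord E w) = extCoord E (u * w) := by
  rw [coordMul, LinearMap.mk₂_apply, LinearEquiv.symm_apply_apply, LinearEquiv.symm_apply_apply]

theorem coordMul_symm (a b : Fin (finrank ℝ (ExteriorAlgebra ℝ (Dual ℝ E))) → ℝ) :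
    (extCoord E).symm (coordMul E a b) = (extCoord E).symm a * (extCoord E).symm b := by
  rw [coordMul, LinearMap.mk₂_apply, LinearEquiv.symm_apply_apply]

theorem dirDeriv_mul {F G : E → ExteriorAlgebra ℝ (Dual ℝ E)} {z : E} (hF : DiffAt F z)
    (hG : DiffAt G z) : DiffAt (fun y => F y * G y) z ∧
      ∀ v, dirDeriv (fun y => F y * G y) z v = dirDeriv F z v * G z + F z * dirDeriv G z v := by
  have h := (coordMul E).toContinuousBilinearMap.hasFDerivAt_of_bilinear
    hF.hasFDerivAt hG.hasFDerivAt
  simp only [LinearMap.toContinuousBilinearMap_apply, coordMul_apply] at h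
  refine ⟨h.differentiableAt, fun v => ?_⟩
  rw [dirDeriv, h.fderiv]
  simp only [_root_.add_apply, ContinuousLinearMap.precompR_apply,
    ContinuousLinearMap.precompL_apply, LinearMap.toContinuousBilinearMap_apply, map_add,
    coordMul_symm, LinearEquiv.symm_apply_apply]
  rw [add_comm]
  change _ + (extCoord E).symm (coordMul E (extCoord E (F z)) _) = _
  rw [coordMul_symm, LinearEquiv.symm_apply_apply]
  rfl

theorem flatExtDeriv_mul {F G : E → ExteriorAlgebra ℝ (Dual ℝ E)} {z : E} (hF : DiffAt F z)
    (hG : DiffAt G z) : flatExtDeriv (fun y => F y * G y) z =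
      flatExtDeriv F z * G z + CliffordAlgebra.involute (F z) * flatExtDeriv G z := by
  simp only [flatExtDeriv, (dirDeriv_mul hF hG).2, mul_add, Finset.sum_add_distrib,
    Finset.sum_mul, Finset.mul_sum, mul_assoc]
  congr 1
  refine Finset.sum_congr rfl fun i _ => ?_
  rw [← mul_assoc, ι_mul_eq_involute_mul, mul_assoc]

/-- The covector underlying a continuous linear functional. -/
def toCov (E : Type*) [NormedAddCommGroup E] [NormedSpace ℝ E] :
    (E →L[ℝ] ℝ) →ₗ[ℝ] ExteriorAlgebra ℝ (Dual ℝ E) :=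
  ExteriorAlgebra.ι ℝ ∘ₗ ContinuousLinearMap.coeLM ℝ

theorem sum_ι_coord (f : E →L[ℝ] ℝ) :
    ∑ i, f (finBasis ℝ E i) • ExteriorAlgebra.ι ℝ ((finBasis ℝ E).coord i) = toCov E f := by
  have h : ∑ i, f (finBasis ℝ E i) • (finBasis ℝ E).coord i = (f : E →ₗ[ℝ] ℝ) := by
    refine (finBasis ℝ E).ext fun j => ?_
    simp [Finsupp.single_apply]
  change _ = ExteriorAlgebra.ι ℝ (f : E →ₗ[ℝ] ℝ)
  rw [← h, map_sum]
  simp only [map_smul]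

theorem flatExtDeriv_function {f : E → ℝ} {z : E} (hf : DifferentiableAt ℝ f z) :
    DiffAt (fun y => algebraMap ℝ (ExteriorAlgebra ℝ (Dual ℝ E)) (f y)) z ∧
    flatExtDeriv (fun y => algebraMap ℝ (ExteriorAlgebra ℝ (Dual ℝ E)) (f y)) z =
      toCov E (fderiv ℝ f z) := by
  have h := hasFDerivAt_linear (Algebra.linearMap ℝ (ExteriorAlgebra ℝ (Dual ℝ E)))
    hf.hasFDerivAt
  refine ⟨h.1, ?_⟩
  have h2 := h.2
  simp only [Algebra.linearMap_apply] at h2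
  simp only [flatExtDeriv, h2]
  rw [← sum_ι_coord]
  refine Finset.sum_congr rfl fun i _ => ?_
  rw [← Algebra.commutes, ← Algebra.smul_def]

theorem flatExtDeriv_differential {g : E → ℝ} {z : E} (hg : ContDiffAt ℝ ∞ g z) :
    DiffAt (fun y => toCov E (fderiv ℝ g y)) z ∧
    flatExtDeriv (fun y => toCov E (fderiv ℝ g y)) z = 0 := by
  have hd : DifferentiableAt ℝ (fderiv ℝ g) z :=
    (hg.fderiv_right (m := 1) (by norm_cast)).differentiableAt (by norm_num)
  have h := hasFDerivAt_linear (toCov E) hd.hasFDerivAt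
  refine ⟨h.1, ?_⟩
  have hs : IsSymmSndFDerivAt ℝ g z := hg.isSymmSndFDerivAt (by simp; norm_cast)
  have key : flatExtDeriv (fun y => toCov E (fderiv ℝ g y)) z = ∑ i, ∑ j,
      (fderiv ℝ (fderiv ℝ g) z (finBasis ℝ E i) (finBasis ℝ E j)) •
        (ExteriorAlgebra.ι ℝ ((finBasis ℝ E).coord i) *
          ExteriorAlgebra.ι ℝ ((finBasis ℝ E).coord j)) := by
    simp only [flatExtDeriv, h.2]
    simp only [← sum_ι_coord, Finset.mul_sum, mul_smul_comm]
  have key2 : flatExtDeriv (fun y => toCov E (fderiv ℝ g y)) z =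
      -flatExtDeriv (fun y => toCov E (fderiv ℝ g y)) z := by
    conv_lhs => rw [key, Finset.sum_comm]
    rw [key, ← Finset.sum_neg_distrib]
    refine Finset.sum_congr rfl fun i _ => ?_
    rw [← Finset.sum_neg_distrib]
    refine Finset.sum_congr rfl fun j _ => ?_
    rw [hs, ← smul_neg]
    congr 1
    exact eq_neg_of_add_eq_zero_left (ExteriorAlgebra.ι_add_mul_swap _ _)
  have h2 : (2 : ℝ) • flatExtDeriv (fun y => toCov E (fderiv ℝ g y)) z = 0 := by
    rw [two_smul]
    nth_rewrite 1 [key2]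
    exact neg_add_cancel _
  exact (smul_eq_zero.1 h2).resolve_left two_ne_zero

/-- The differential `T_x M → E` at `x` of the chart at `x`. -/
def chartDiff (x : M) : TangentSpace 𝓘(ℝ, E) x →ₗ[ℝ] E :=
  (mfderiv 𝓘(ℝ, E) 𝓘(ℝ, E) (chartAt E x) x).toLinearMap

/-- The differential at `z` of the inverse of the chart at `x`. -/
def chartSymmDiff (x : M) (z : E) : E →ₗ[ℝ] TangentSpace 𝓘(ℝ, E) ((chartAt E x).symm z) :=
  (mfderiv 𝓘(ℝ, E) 𝓘(ℝ, E) (chartAt E x).symm z).toLinearMap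

/-- A field of exterior forms read in the chart at `x`: its pullback along the inverse chart. -/
def chartRep (x : M) (a : Π y : M, CotangentExt E M y) (z : E) : ExteriorAlgebra ℝ (Dual ℝ E) :=
  pullExt (chartSymmDiff x z) (a ((chartAt E x).symm z))

/-- The exterior derivative at `x`: take the exterior derivative `∑ᵢ dxⁱ ∧ ∂ᵢ` of the form read in
the chart at `x`, and pull the result back along the chart. -/
def extDerivAt (a : Π y : M, CotangentExt E M y) (x : M) : CotangentExt E M x :=
  pullExt (chartDiff x) (flatExtDeriv (chartRep x a) (chartAt E x x))

variable [IsManifold 𝓘(ℝ, E) ∞ M]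

theorem pullExt_pullExt_of_eq {x y : M} (h : y = x) (a : Π y : M, CotangentExt E M y)
    (R : E →ₗ[ℝ] TangentSpace 𝓘(ℝ, E) y) (S : TangentSpace 𝓘(ℝ, E) x →ₗ[ℝ] E)
    (hRS : ∀ v : TangentSpace 𝓘(ℝ, E) x, (R (S v) : E) = v) :
    pullExt S (pullExt R (a y)) = a x := by
  subst h
  exact pullExt_pullExt _ _ (LinearMap.ext hRS) _

theorem pull_chartRep (x : M) (a : Π y : M, CotangentExt E M y) :
    pullExt (chartDiff x) (chartRep x a (chartAt E x x)) = a x := by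
  refine pullExt_pullExt_of_eq ((chartAt E x).left_inv (mem_chart_source E x)) a _ _ fun v => ?_
  have h1 : IsManifold 𝓘(ℝ, E) 1 M := IsManifold.of_le (n := ∞) (by norm_cast)
  have := (mdifferentiable_chart (I := 𝓘(ℝ, E)) x).symm_comp_deriv (mem_chart_source E x)
  exact congrArg (fun T => T v) this

theorem eventually_chart {x : M} {U : Set M} (hU : IsOpen U) (hx : x ∈ U) :
    ∀ᶠ z in nhds (chartAt E x x), z ∈ (chartAt E x).target ∧ (chartAt E x).symm z ∈ U := by
  have h1 : (chartAt E x).target ∈ nhds (chartAt E x x) :=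
    (chartAt E x).open_target.mem_nhds (mem_chart_target E x)
  have h2 : ContinuousAt (chartAt E x).symm (chartAt E x x) :=
    (chartAt E x).symm.continuousAt (mem_chart_target E x)
  have h3 : U ∈ nhds ((chartAt E x).symm (chartAt E x x)) := by
    rw [(chartAt E x).left_inv (mem_chart_source E x)]
    exact hU.mem_nhds hx
  exact Filter.Eventually.and h1 (h2 h3)

theorem chartRep_eventuallyEq {x : M} {U : Set M} (hU : IsOpen U) (hx : x ∈ U)
    {a b : Π y : M, CotangentExt E M y} (h : ∀ y ∈ U, a y = b y) :
    chartRep x a =ᶠ[nhds (chartAt E x x)] chartRep x b := by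
  filter_upwards [eventually_chart (E := E) hU hx] with z hz
  rw [chartRep, h _ hz.2, chartRep]

theorem chartRep_differential {x : M} {U : Set M} (hU : IsOpen U) (hx : x ∈ U) {g : M → ℝ}
    (hg : ContMDiffOn 𝓘(ℝ, E) 𝓘(ℝ, ℝ) ∞ g U) :
    ContDiffAt ℝ ∞ (fun z => g ((chartAt E x).symm z)) (chartAt E x x) ∧
    chartRep x (fun y => ExteriorAlgebra.ι ℝ (differentialAt E g y)) =ᶠ[nhds (chartAt E x x)]
      fun z => toCov E (fderiv ℝ (fun z => g ((chartAt E x).symm z)) z) := by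
  have hs : ∀ z ∈ (chartAt E x).target, ContMDiffAt 𝓘(ℝ, E) 𝓘(ℝ, E) ∞ (chartAt E x).symm z :=
    fun z hz => (contMDiffOn_chart_symm (I := 𝓘(ℝ, E)) (n := ∞) (x := x)).contMDiffAt
      ((chartAt E x).open_target.mem_nhds hz)
  have hgU : ∀ y ∈ U, ContMDiffAt 𝓘(ℝ, E) 𝓘(ℝ, ℝ) ∞ g y :=
    fun y hy => hg.contMDiffAt (hU.mem_nhds hy)
  constructor
  · obtain ⟨h1, h2⟩ := (eventually_chart (E := E) hU hx).self_of_nhds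
    exact contMDiffAt_iff_contDiffAt.1 ((hgU _ h2).comp _ (hs _ h1))
  · filter_upwards [eventually_chart (E := E) hU hx] with z hz
    have h : mfderiv 𝓘(ℝ, E) 𝓘(ℝ, ℝ) (g ∘ (chartAt E x).symm) z =
        (mfderiv 𝓘(ℝ, E) 𝓘(ℝ, ℝ) g ((chartAt E x).symm z)).comp
          (mfderiv 𝓘(ℝ, E) 𝓘(ℝ, E) (chartAt E x).symm z) :=
      mfderiv_comp z ((hgU _ hz.2).mdifferentiableAt (by simp))
        ((hs _ hz.1).mdifferentiableAt (by simp))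
    rw [mfderiv_eq_fderiv] at h
    change chartRep x _ z = toCov E (fderiv ℝ (g ∘ (chartAt E x).symm) z)
    rw [h, chartRep, pullExt_ι]
    rfl

theorem chartRep_function (x : M) (f : M → ℝ) :
    chartRep x (fun y => algebraMap ℝ (CotangentExt E M y) (f y)) =
      fun z => algebraMap ℝ (ExteriorAlgebra ℝ (Dual ℝ E)) (f ((chartAt E x).symm z)) :=
  funext fun z => AlgHom.commutes (pullExt (chartSymmDiff x z)) (f ((chartAt E x).symm z))

theorem extDerivAt_function {U : Set M} (hU : IsOpen U) {f : M → ℝ}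
    (hf : ContMDiffOn 𝓘(ℝ, E) 𝓘(ℝ, ℝ) ∞ f U) {x : M} (hx : x ∈ U) :
    DiffAt (chartRep x (fun y => algebraMap ℝ (CotangentExt E M y) (f y))) (chartAt E x x) ∧
      extDerivAt (fun y => algebraMap ℝ (CotangentExt E M y) (f y)) x =
        ExteriorAlgebra.ι ℝ (differentialAt E f x) := by
  obtain ⟨h1, h2⟩ := chartRep_differential hU hx hf
  have h3 := flatExtDeriv_function (h1.differentiableAt (by simp))
  rw [extDerivAt, chartRep_function]
  refine ⟨h3.1, ?_⟩
  have h4 := h2.self_of_nhds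
  rw [h3.2]
  simp only at h4
  rw [← h4]
  exact pull_chartRep x (fun y => ExteriorAlgebra.ι ℝ (differentialAt E f y))

theorem extDerivAt_add {x : M} {a b : Π y : M, CotangentExt E M y}
    (ha : DiffAt (chartRep x a) (chartAt E x x)) (hb : DiffAt (chartRep x b) (chartAt E x x)) :
    DiffAt (chartRep x (a + b)) (chartAt E x x) ∧
      extDerivAt (a + b) x = extDerivAt a x + extDerivAt b x := by
  have h : chartRep x (a + b) = fun z => chartRep x a z + chartRep x b z :=
    funext fun _ => map_add _ _ _
  rw [extDerivAt, h, flatExtDeriv_add ha hb, map_add]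
  exact ⟨ha.add hb, rfl⟩

theorem extDerivAt_smul {x : M} {a : Π y : M, CotangentExt E M y} (r : ℝ)
    (ha : DiffAt (chartRep x a) (chartAt E x x)) :
    extDerivAt (r • a) x = r • extDerivAt a x := by
  have h : chartRep x (r • a) = fun z => r • chartRep x a z :=
    funext fun _ => map_smul (pullExt _) _ _
  rw [extDerivAt, h, flatExtDeriv_smul ha, map_smul]
  rfl

theorem extDerivAt_mul {x : M} {a b : Π y : M, CotangentExt E M y}
    (ha : DiffAt (chartRep x a) (chartAt E x x)) (hb : DiffAt (chartRep x b) (chartAt E x x)) :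
    DiffAt (chartRep x (a * b)) (chartAt E x x) ∧
      extDerivAt (a * b) x =
        extDerivAt a x * b x + CliffordAlgebra.involute (a x) * extDerivAt b x := by
  have h : chartRep x (a * b) = fun z => chartRep x a z * chartRep x b z :=
    funext fun _ => map_mul _ _ _
  rw [extDerivAt, h, flatExtDeriv_mul ha hb, map_add, map_mul, map_mul, pullExt_involute,
    pull_chartRep, pull_chartRep]
  exact ⟨(dirDeriv_mul ha hb).1, rfl⟩

theorem extDerivAt_localForms {U : Set M} (hU : IsOpen U) {a : Π x : M, CotangentExt E M x}
    (ha : a ∈ localForms E U) :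
    (∀ x ∈ U, DiffAt (chartRep x a) (chartAt E x x)) ∧
      ∃ c ∈ localForms E U, ∀ x ∈ U, extDerivAt a x = c x := by
  induction ha using Algebra.adjoin_induction with
  | mem a ha =>
    rcases ha with ⟨f, hf, rfl⟩ | ⟨g, hg, rfl⟩
    · exact ⟨fun x hx => (extDerivAt_function hU hf hx).1, _,
        Algebra.subset_adjoin (Or.inr ⟨f, hf, rfl⟩), fun x hx => (extDerivAt_function hU hf hx).2⟩
    · refine ⟨fun x hx => ?_, 0, zero_mem _, fun x hx => ?_⟩
      · obtain ⟨h1, h2⟩ := chartRep_differential hU hx hg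
        exact (flatExtDeriv_differential h1).1.congr h2.symm
      · obtain ⟨h1, h2⟩ := chartRep_differential hU hx hg
        rw [extDerivAt, flatExtDeriv_congr h2, (flatExtDeriv_differential h1).2, map_zero]
        rfl
  | algebraMap r =>
    have hf : ContMDiffOn 𝓘(ℝ, E) 𝓘(ℝ, ℝ) ∞ (fun _ : M => r) U := contMDiffOn_const
    exact ⟨fun x hx => (extDerivAt_function hU hf hx).1, _,
      Algebra.subset_adjoin (Or.inr ⟨_, hf, rfl⟩), fun x hx => (extDerivAt_function hU hf hx).2⟩
  | add a b _ _ ha hb =>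
    obtain ⟨ha1, a', ha2, ha3⟩ := ha
    obtain ⟨hb1, b', hb2, hb3⟩ := hb
    refine ⟨fun x hx => (extDerivAt_add (ha1 x hx) (hb1 x hx)).1, _, add_mem ha2 hb2,
      fun x hx => ?_⟩
    rw [(extDerivAt_add (ha1 x hx) (hb1 x hx)).2, ha3 x hx, hb3 x hx]
    rfl
  | mul a b hamem hbmem ha hb =>
    obtain ⟨ha1, a', ha2, ha3⟩ := ha
    obtain ⟨hb1, b', hb2, hb3⟩ := hb
    refine ⟨fun x hx => (extDerivAt_mul (ha1 x hx) (hb1 x hx)).1, _,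
      add_mem (mul_mem ha2 hbmem) (mul_mem (involute_mem_localForms E hamem) hb2),
      fun x hx => ?_⟩
    rw [(extDerivAt_mul (ha1 x hx) (hb1 x hx)).2, ha3 x hx, hb3 x hx]
    rfl

theorem extDerivAt_congr {U : Set M} (hU : IsOpen U) {x : M} (hx : x ∈ U)
    {a b : Π y : M, CotangentExt E M y} (h : ∀ y ∈ U, a y = b y) :
    extDerivAt a x = extDerivAt b x := by
  rw [extDerivAt, flatExtDeriv_congr (chartRep_eventuallyEq hU hx h), extDerivAt]

theorem diffAt_chartRep (a : DiffForm E M) (x : M) :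
    DiffAt (chartRep x a.1) (chartAt E x x) := by
  obtain ⟨U, hU, hx, b, hb, hab⟩ := a.2 x
  exact ((extDerivAt_localForms hU hb).1 x hx).congr (chartRep_eventuallyEq hU hx hab).symm

variable (E M)

/-- The exterior derivative `d` on smooth differential forms. -/
def extD : End ℝ (DiffForm E M) where
  toFun a := ⟨extDerivAt a.1, fun x => by
    obtain ⟨U, hU, hx, b, hb, hab⟩ := a.2 x
    obtain ⟨c, hc, hbc⟩ := (extDerivAt_localForms hU hb).2
    exact ⟨U, hU, hx, c, hc, fun y hy => (extDerivAt_congr hU hy hab).trans (hbc y hy)⟩⟩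
  map_add' a b := Subtype.ext (funext fun x =>
    (extDerivAt_add (diffAt_chartRep a x) (diffAt_chartRep b x)).2)
  map_smul' r a := Subtype.ext (funext fun x => by
    have h := extDerivAt_smul r (diffAt_chartRep a x)
    simp only [RingHom.id_apply, Subalgebra.coe_smul, Pi.smul_apply]
    exact h)

variable {E M}

instance finiteDimensional_tangentSpace (x : M) : FiniteDimensional ℝ (TangentSpace 𝓘(ℝ, E) x) :=
  inferInstanceAs (FiniteDimensional ℝ E)

end Derivative

/-! ### Almost symplectic manifolds -/

/-- An almost symplectic form on `M`: a smooth `2`-form, nondegenerate at every point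
(not necessarily closed). -/
structure AlmostSymplecticForm (E : Type*) [NormedAddCommGroup E] [NormedSpace ℝ E]
    (M : Type*) [TopologicalSpace M] [ChartedSpace E M] where
  form : DiffForm E M
  degree_two : form ∈ formsOfDegree E M 2
  nondegenerate : ∀ x : M, (formBilin (form.1 x)).Nondegenerate

namespace AlmostSymplecticForm

variable [FiniteDimensional ℝ E] [IsManifold 𝓘(ℝ, E) ∞ M] (Ω : AlmostSymplecticForm E M)

/-- The pairing `⟨·, ·⟩_ω` of the values of two forms at a point. -/
def fibrePairing (x : M) : LinearMap.BilinForm ℝ (CotangentExt E M x) :=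
  extPairing (formBilin (Ω.form.1 x)) (Ω.nondegenerate x)

/-- The function `⟨α, β⟩_ω` on `M`. -/
def pairing (α β : DiffForm E M) (x : M) : ℝ := Ω.fibrePairing x (α.1 x) (β.1 x)

/-- The volume form `ωⁿ / n!`, where `2n = dim M`. -/
def volumeForm : DiffForm E M :=
  (((finrank ℝ E / 2).factorial : ℝ)⁻¹) • Ω.form ^ (finrank ℝ E / 2)

/-- The defining property of the symplectic Hodge star operator: it maps `A^k` to `A^{2n-k}` and
`α ∧ ⋆β = ⟨α, β⟩_ω ωⁿ / n!` for `α, β ∈ A^k`. -/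
structure IsSymplecticStar (σ : End ℝ (DiffForm E M)) : Prop where
  degree : ∀ k : ℤ, ∀ β ∈ formsOfDegree E M k,
    σ β ∈ formsOfDegree E M (2 * ((finrank ℝ E / 2 : ℕ) : ℤ) - k)
  wedge_star : ∀ k : ℤ, ∀ α ∈ formsOfDegree E M k, ∀ β ∈ formsOfDegree E M k, ∀ x : M,
    (α * σ β).1 x = Ω.pairing α β x • Ω.volumeForm.1 x

/-- The symplectic Hodge star operator. -/
def hodgeStar : End ℝ (DiffForm E M) := Classical.epsilon Ω.IsSymplecticStar

/-- `ψ` is a symplectic adjoint of `φ`: `⟨φ α, β⟩_ω = ⟨α, ψ β⟩_ω`. -/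
def IsSymplecticAdjoint (φ ψ : End ℝ (DiffForm E M)) : Prop :=
  ∀ (α β : DiffForm E M) (x : M), Ω.pairing (φ α) β x = Ω.pairing α (ψ β) x

/-- The symplectic adjoint `φ^ω` of an operator `φ` (meaningful for operators that have one). -/
def adjoint (φ : End ℝ (DiffForm E M)) : End ℝ (DiffForm E M) :=
  Classical.epsilon (Ω.IsSymplecticAdjoint φ)

/-- The Lefschetz operator `L α = ω ∧ α`. -/
def lefschetz : End ℝ (DiffForm E M) := LinearMap.mulLeft ℝ Ω.form

/-- The operator `Λ = L^ω`. -/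
def dualLefschetz : End ℝ (DiffForm E M) := Ω.adjoint Ω.lefschetz

/-- The operator `d^ω = (-1)^k ⋆ d ⋆` on `A^k`. -/
def codiff : End ℝ (DiffForm E M) := Ω.hodgeStar * extD E M * Ω.hodgeStar * parity E

/-- The operator `[d, L]`, of degree `3`. -/
def bracketDL : End ℝ (DiffForm E M) := gradedBracket 1 2 (extD E M) Ω.lefschetz

/-- The operator `[Λ, [d, L]]`, of degree `1`. -/
def bracketLambdaDL : End ℝ (DiffForm E M) := gradedBracket (-2) 3 Ω.dualLefschetz Ω.bracketDL

/-- `Δ₁ = d^ω + [Λ, [d, L]]^ω`. -/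
def delta₁ : End ℝ (DiffForm E M) := Ω.codiff + Ω.adjoint Ω.bracketLambdaDL

/-- `Δ₂ = -[d, L]^ω`. -/
def delta₂ : End ℝ (DiffForm E M) := -Ω.adjoint Ω.bracketDL

/-- `ι` is the operator `i_π` of contraction by the bivector field `π` associated to `ω`:
`π(a, b) = ω(♯a, ♯b)` with `ω(♯a, ·) = a`. -/
def IsPoissonContraction (ι : End ℝ (DiffForm E M)) : Prop :=
  ∀ (α : DiffForm E M) (x : M),
    (ι α).1 x = contractPoisson (formBilin (Ω.form.1 x)) (Ω.nondegenerate x) (α.1 x)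

end AlmostSymplecticForm

end Manifold

end SymplForms

end

open SymplForms

noncomputable section

namespace SymplForms

open Module

/-! ### Signs, degrees and orders of operators -/

section Order

variable {𝕜 A : Type*} [Field 𝕜] [Ring A] [Algebra 𝕜 A]

/-! Everything follows from one conjugation identity in the group generated by e^L and e^Λ. Write 2n
for the dimension, m = [d, L] (multiplication by dω), m' = m^ω, δ = d^ω, and w = e^{-L} e^Λ e^{-L}.
L and Λ are nilpotent, so all exponentials are polynomials.

On one cotangent space, wedging with a covector a and contracting with ♯a span a two-dimensional
representation of the sl₂ generated by L and Λ, and w acts on it as a quarter turn: it exchanges the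
two, up to sign (`fibreWeyl_mul_ι`, `fibreWeyl_mul_contract`). The symplectic star also exchanges
them, up to reversal of the order of the factors. Hence ⋆ = (-1)^n w ∘ (reversal) once the values at
1 agree, and this is an sl₂ computation with the divided powers of ω (`fibreStar_one`,
`fibreStar_divPow`). The formula is taken as the construction of ⋆; it yields the involution ⋆⋆ = 1,
the defining property (`mul_fibreStar`) and the expressions of Λ and m' through ⋆.

On the manifold, reversal commutes with d up to parity, and with m up to parity and a sign. Since ⋆
is w times reversal, this gives w d = δ w and w m = m' w (`weyl_mul_extD`, `weyl_mul_bracketDL`). As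
[d, L] = m commutes with L, also e^{-L} d e^L = d + m. Cancelling the exponentials of L leaves e^Λ
(d + m) e^{-Λ} = e^L δ e^{-L} and e^Λ m e^{-Λ} = e^L m' e^{-L}. The left sides are expansions in a
lowering operator, the right sides in a raising one, so comparing components degree by degree is
very restrictive (`conjCoeff_component`). The coefficients of ξ, ξ² and ξʲ, j ≥ 3, in e^{Λξ} d
e^{-Λξ} come out as δ - [L, m'], -m' and 0 (`conjCoeff_of_weyl`). Adjunction turns [Λ, m] into [m',
L], so these are Δ₁, Δ₂ and 0.

The BV-infinity axioms are then formal. The quadratic relations are the coefficients of e^{Λξ} d²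
e^{-Λξ} = 0. The order bounds hold because Λ has order ≤ 2, d has order ≤ 1, Δ₁ = [Λ, d], Δ₂ = ½[Λ,
Δ₁], and a bracket with Λ raises the order by at most one. If dω = 0 then m' = 0, and Koszul's
formula is Δ₁ = [Λ, d] together with Λ = i_π (`contractPoisson_eq`).

The remaining work is to pass from fibres to the manifold. A smooth family of fibre operators acts
on forms (`liftOp`); smoothness of contractions comes from Cramer's rule in a chart
(`contractForm_mem_smoothOps`). Uniqueness of ⋆ and of adjoints holds because every value at a point
extends to a global form (`exists_form_apply_eq`) and the pairing is nondegenerate. -/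

theorem sgn_add (p q : ℤ) : sgn 𝕜 (p + q) = sgn 𝕜 p * sgn 𝕜 q := by
  simp [sgn, Int.negOnePow_add]

theorem sgn_eq_or (p : ℤ) : sgn 𝕜 p = 1 ∨ sgn 𝕜 p = -1 := by
  rcases Int.units_eq_one_or p.negOnePow with h | h <;> simp [sgn, h]

theorem sgn_mul_self (p : ℤ) : sgn 𝕜 p * sgn 𝕜 p = 1 := by
  rcases sgn_eq_or (𝕜 := 𝕜) p with h | h <;> simp [h]

theorem sgn_of_even {p : ℤ} (hp : Even p) : sgn 𝕜 p = 1 := by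
  simp [sgn, Int.negOnePow_even p hp]

theorem sgn_of_odd {p : ℤ} (hp : Odd p) : sgn 𝕜 p = -1 := by
  simp [sgn, Int.negOnePow_odd p hp]

theorem gradedBracket_eq_smul (p q : ℤ) (f g : End 𝕜 A) :
    gradedBracket p q f g = (-sgn 𝕜 (p * q)) • gradedBracket q p g f := by
  have h := sgn_mul_self (𝕜 := 𝕜) (p * q)
  rw [gradedBracket, gradedBracket, mul_comm q p, smul_sub, smul_smul, neg_mul, h]
  simp only [neg_smul, one_smul]
  abel

/-- Graded Jacobi identity. Only the signs attached to the three pairs of degrees occur, so eight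
cases settle it. -/
theorem gradedBracket_gradedBracket (j p q : ℤ) (a f g : End 𝕜 A) :
    gradedBracket j (p + q) a (gradedBracket p q f g) =
      gradedBracket (j + p) q (gradedBracket j p a f) g +
        sgn 𝕜 (j * p) • gradedBracket p (j + q) f (gradedBracket j q a g) := by
  have hneg : ∀ (c : 𝕜) (x : End 𝕜 A), (-c) • x = -(c • x) := fun c x => neg_smul c x
  simp only [gradedBracket, mul_add, add_mul, sgn_add, mul_comm p j]
  rcases sgn_eq_or (𝕜 := 𝕜) (j * p) with h1 | h1 <;>
  rcases sgn_eq_or (𝕜 := 𝕜) (j * q) with h2 | h2 <;>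
  rcases sgn_eq_or (𝕜 := 𝕜) (p * q) with h3 | h3 <;>
  simp only [h1, h2, h3, mul_one, one_smul, hneg, mul_neg, neg_neg,
    sub_neg_eq_add, mul_sub, sub_mul, mul_add, add_mul, mul_assoc] <;>
  abel

theorem gradedBracket_mul (j p q : ℤ) (a f g : End 𝕜 A) :
    gradedBracket j (p + q) a (f * g) =
      gradedBracket j p a f * g + sgn 𝕜 (j * p) • (f * gradedBracket j q a g) := by
  simp only [gradedBracket, mul_add, sgn_add, smul_sub, mul_sub, sub_mul, smul_mul_assoc,
    mul_smul_comm, smul_smul, mul_assoc]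
  abel

theorem gradedBracket_add (p q : ℤ) (a f g : End 𝕜 A) :
    gradedBracket p q a (f + g) = gradedBracket p q a f + gradedBracket p q a g := by
  simp only [gradedBracket, mul_add, add_mul, smul_add]
  abel

theorem gradedBracket_smul (p q : ℤ) (a f : End 𝕜 A) (c : 𝕜) :
    gradedBracket p q a (c • f) = c • gradedBracket p q a f := by
  simp only [gradedBracket, smul_sub, mul_smul_comm, smul_mul_assoc, smul_comm c]

theorem gradedBracket_zero (p q : ℤ) (a : End 𝕜 A) : gradedBracket p q a 0 = 0 := by
  simp [gradedBracket]

/-! ### Homogeneous operators and operators of bounded order -/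

variable {𝒜 : ℤ → Submodule 𝕜 A}

theorem IsOfDegree.mul {p q : ℤ} {f g : End 𝕜 A} (hf : IsOfDegree 𝒜 p f)
    (hg : IsOfDegree 𝒜 q g) : IsOfDegree 𝒜 (p + q) (f * g) := fun r a ha => by
  have := hf _ _ (hg _ _ ha)
  rwa [show r + (p + q) = r + q + p by ring]

theorem IsOfDegree.add {p : ℤ} {f g : End 𝕜 A} (hf : IsOfDegree 𝒜 p f)
    (hg : IsOfDegree 𝒜 p g) : IsOfDegree 𝒜 p (f + g) := fun r a ha =>
  add_mem (hf r a ha) (hg r a ha)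

theorem IsOfDegree.smul {p : ℤ} {f : End 𝕜 A} (hf : IsOfDegree 𝒜 p f) (c : 𝕜) :
    IsOfDegree 𝒜 p (c • f) := fun r a ha => Submodule.smul_mem _ c (hf r a ha)

theorem IsOfDegree.neg {p : ℤ} {f : End 𝕜 A} (hf : IsOfDegree 𝒜 p f) :
    IsOfDegree 𝒜 p (-f) := fun r a ha => neg_mem (hf r a ha)

theorem IsOfDegree.zero (p : ℤ) : IsOfDegree 𝒜 p 0 := fun _ _ _ => zero_mem _

theorem IsOfDegree.sum {ι : Type*} {s : Finset ι} {p : ℤ} {f : ι → End 𝕜 A}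
    (hf : ∀ i ∈ s, IsOfDegree 𝒜 p (f i)) : IsOfDegree 𝒜 p (∑ i ∈ s, f i) := fun r a ha => by
  rw [LinearMap.sum_apply]
  exact sum_mem fun i hi => hf i hi r a ha

theorem IsOfDegree.pow {p : ℤ} {f : End 𝕜 A} (hf : IsOfDegree 𝒜 p f) (n : ℕ) :
    IsOfDegree 𝒜 (n * p) (f ^ n) := by
  induction n with
  | zero => intro r a ha; simpa using ha
  | succ n ih =>
    have := ih.mul hf
    rw [pow_succ]
    convert this using 1
    push_cast
    ring

theorem IsOfDegree.gradedBracket {p q : ℤ} {f g : End 𝕜 A} (hf : IsOfDegree 𝒜 p f)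
    (hg : IsOfDegree 𝒜 q g) : IsOfDegree 𝒜 (p + q) (gradedBracket p q f g) := by
  have h := (hg.mul hf).smul (-sgn 𝕜 (p * q))
  rw [add_comm q p] at h
  have := (hf.mul hg).add h
  have h2 : SymplForms.gradedBracket p q f g = f * g + (-sgn 𝕜 (p * q)) • (g * f) := by
    rw [SymplForms.gradedBracket, neg_smul (sgn 𝕜 (p * q)) (g * f), sub_eq_add_neg]
  rwa [h2]

theorem isOfDegree_mulLeft (hmul : ∀ p q : ℤ, ∀ a ∈ 𝒜 p, ∀ b ∈ 𝒜 q, a * b ∈ 𝒜 (p + q)) {k : ℤ}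
    {a : A} (ha : a ∈ 𝒜 k) : IsOfDegree 𝒜 k (LinearMap.mulLeft 𝕜 a) := fun p b hb => by
  rw [add_comm]
  exact hmul k p a ha b hb

theorem HasOrderLE.add {r : ℕ} {k : ℤ} {f g : End 𝕜 A} (hf : HasOrderLE 𝒜 r k f)
    (hg : HasOrderLE 𝒜 r k g) : HasOrderLE 𝒜 r k (f + g) := by
  induction r generalizing k f g with
  | zero =>
    obtain ⟨a, ha, rfl⟩ := hf
    obtain ⟨b, hb, rfl⟩ := hg
    exact ⟨a + b, add_mem ha hb, LinearMap.ext fun x => by simp [add_mul]⟩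
  | succ r ih =>
    exact ⟨hf.1.add hg.1, fun j a ha => by
      rw [gradedBracket_add]
      exact ih (hf.2 j a ha) (hg.2 j a ha)⟩

theorem HasOrderLE.smul {r : ℕ} {k : ℤ} {f : End 𝕜 A} (hf : HasOrderLE 𝒜 r k f) (c : 𝕜) :
    HasOrderLE 𝒜 r k (c • f) := by
  induction r generalizing k f with
  | zero =>
    obtain ⟨a, ha, rfl⟩ := hf
    exact ⟨c • a, Submodule.smul_mem _ c ha, LinearMap.ext fun x => by simp⟩
  | succ r ih =>
    exact ⟨hf.1.smul c, fun j a ha => by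
      rw [gradedBracket_smul]
      exact ih (hf.2 j a ha)⟩

theorem HasOrderLE.zero (r : ℕ) (k : ℤ) : HasOrderLE 𝒜 r k (0 : End 𝕜 A) := by
  induction r generalizing k with
  | zero => exact ⟨0, zero_mem _, LinearMap.ext fun x => by simp⟩
  | succ r ih =>
    exact ⟨IsOfDegree.zero k, fun j a _ => by
      rw [gradedBracket_zero]
      exact ih _⟩

theorem HasOrderLE.isOfDegree (hmul : ∀ p q : ℤ, ∀ a ∈ 𝒜 p, ∀ b ∈ 𝒜 q, a * b ∈ 𝒜 (p + q))
    {r : ℕ} {k : ℤ} {f : End 𝕜 A} (hf : HasOrderLE 𝒜 r k f) : IsOfDegree 𝒜 k f := by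
  cases r with
  | zero =>
    obtain ⟨a, ha, rfl⟩ := hf
    exact isOfDegree_mulLeft hmul ha
  | succ r => exact hf.1

/-- Operators of order `≤ r` and `≤ s + 1` have a graded commutator of order `≤ r + s`. -/
theorem HasOrderLE.gradedBracket {r s : ℕ} {p q : ℤ} {f g : End 𝕜 A} (hf : HasOrderLE 𝒜 r p f)
    (hg : HasOrderLE 𝒜 (s + 1) q g) : HasOrderLE 𝒜 (r + s) (p + q) (gradedBracket p q f g) := by
  -- Double induction on the two orders: by the Jacobi identity a test multiplication is bracketed
  -- with one factor at a time, which lowers the order of that factor.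
  induction r generalizing s p q f g with
  | zero =>
    obtain ⟨a, ha, rfl⟩ := hf
    rw [zero_add]
    exact hg.2 p a ha
  | succ r ihr =>
    induction s generalizing p q f g with
    | zero =>
      refine ⟨hf.1.gradedBracket hg.1, fun j a ha => ?_⟩
      rw [gradedBracket_gradedBracket, ← add_assoc]
      refine (ihr (hf.2 j a ha) hg).add (HasOrderLE.smul ?_ _)
      -- Here `g` has order ≤ 1, so [a, g] is multiplication by some `b`, and [f, b] is up to sign
      -- [b, f], which the order of `f` controls.
      obtain ⟨b, hb, hab⟩ := hg.2 j a ha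
      rw [hab, gradedBracket_eq_smul, add_right_comm]
      exact (hf.2 _ b hb).smul _
    | succ s ihs =>
      refine ⟨hf.1.gradedBracket hg.1, fun j a ha => ?_⟩
      rw [gradedBracket_gradedBracket, ← add_assoc]
      have h1 := ihr (hf.2 j a ha) hg
      have h2 := ihs hf (hg.2 j a ha)
      rw [add_left_comm, ← add_assoc, Nat.add_right_comm] at h2
      have h3 := h1.add (h2.smul (sgn 𝕜 (j * p)))
      rwa [show (r + 1).add s = r + (s + 1) from Nat.add_right_comm r 1 s]

/-- Operators of order `≤ r` and `≤ s` have a composition of order `≤ r + s`. -/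
theorem HasOrderLE.mul
    (hmul : ∀ p q : ℤ, ∀ a ∈ 𝒜 p, ∀ b ∈ 𝒜 q, a * b ∈ 𝒜 (p + q))
    (hcomm : ∀ p q : ℤ, ∀ a ∈ 𝒜 p, ∀ b ∈ 𝒜 q, a * b = sgn 𝕜 (p * q) • (b * a))
    {r s : ℕ} {p q : ℤ} {f g : End 𝕜 A} (hf : HasOrderLE 𝒜 r p f)
    (hg : HasOrderLE 𝒜 s q g) : HasOrderLE 𝒜 (r + s) (p + q) (f * g) := by
  -- By graded commutativity two multiplications commute, so a factor of order 0 contributes no term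
  -- to the Leibniz rule for the bracket.
  have hzero : ∀ (j p : ℤ) (a b : A), a ∈ 𝒜 j → b ∈ 𝒜 p →
      SymplForms.gradedBracket j p (LinearMap.mulLeft 𝕜 a) (LinearMap.mulLeft 𝕜 b) = 0 := by
    intro j p a b ha hb
    refine LinearMap.ext fun x => ?_
    simp only [SymplForms.gradedBracket, LinearMap.sub_apply, LinearMap.smul_apply,
      Module.End.mul_apply, LinearMap.mulLeft_apply, LinearMap.zero_apply]
    rw [← mul_assoc, ← mul_assoc, hcomm j p a ha b hb, smul_mul_assoc, sub_self]
  induction r generalizing s p q f g with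
  | zero =>
    induction s generalizing p q f g with
    | zero =>
      obtain ⟨a, ha, rfl⟩ := hf
      obtain ⟨b, hb, rfl⟩ := hg
      exact ⟨a * b, hmul _ _ a ha b hb, LinearMap.ext fun x => by simp⟩
    | succ s ih =>
      refine ⟨(hf.isOfDegree hmul).mul hg.1, fun j a ha => ?_⟩
      obtain ⟨b, hb, rfl⟩ := hf
      rw [gradedBracket_mul, hzero j p a b ha hb, zero_mul, zero_add]
      have := ih ⟨b, hb, rfl⟩ (hg.2 j a ha)
      rw [add_left_comm] at this
      exact this.smul _
  | succ r ihr =>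
    induction s generalizing p q f g with
    | zero =>
      refine ⟨hf.1.mul (hg.isOfDegree hmul), fun j a ha => ?_⟩
      have h1 := ihr (hf.2 j a ha) hg
      obtain ⟨b, hb, rfl⟩ := hg
      rw [gradedBracket_mul, hzero j q a b ha hb, mul_zero, smul_zero, add_zero, ← add_assoc]
      exact h1
    | succ s ihs =>
      refine ⟨hf.1.mul hg.1, fun j a ha => ?_⟩
      have h1 := ihr (hf.2 j a ha) hg
      have h2 := ihs hf (hg.2 j a ha)
      rw [gradedBracket_mul]
      rw [add_assoc] at h1
      rw [add_left_comm, Nat.add_right_comm] at h2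
      have h3 := h1.add (h2.smul (sgn 𝕜 (j * p)))
      rwa [show (r + 1).add s = r + (s + 1) from Nat.add_right_comm r 1 s]

theorem eq_of_homogeneous (h : DirectSum.IsInternal 𝒜) {S T : End 𝕜 A}
    (hST : ∀ k, ∀ a ∈ 𝒜 k, S a = T a) : S = T := by
  refine LinearMap.ext fun x => ?_
  have hx : x ∈ ⨆ k, 𝒜 k := by
    rw [h.submodule_iSup_eq_top]; trivial
  induction hx using Submodule.iSup_induction' with
  | mem k a ha => exact hST k a ha
  | zero => rw [map_zero, map_zero]
  | add a b _ _ ha hb => rw [map_add, map_add, ha, hb]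

/-- The projections of an internally graded module. -/
theorem exists_projection (h : DirectSum.IsInternal 𝒜) :
    ∃ π : ℤ → End 𝕜 A, ∀ p q : ℤ, ∀ a ∈ 𝒜 p, π q a = if p = q then a else 0 := by
  classical
  let e := LinearEquiv.ofBijective (DirectSum.coeLinearMap 𝒜) h
  refine ⟨fun q => (𝒜 q).subtype ∘ₗ DirectSum.component 𝕜 ℤ (fun i => 𝒜 i) q ∘ₗ
    e.symm.toLinearMap, fun p q a ha => ?_⟩
  have h1 : e.symm a = DirectSum.lof 𝕜 ℤ (fun i => 𝒜 i) p ⟨a, ha⟩ := by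
    rw [LinearEquiv.symm_apply_eq]
    exact (DirectSum.coeLinearMap_lof 𝒜 p ⟨a, ha⟩).symm
  simp only [LinearMap.comp_apply, LinearEquiv.coe_coe, h1, Submodule.subtype_apply]
  split_ifs with hpq
  · subst hpq
    rw [DirectSum.component.lof_self]
  · rw [DirectSum.component.of, dif_neg hpq, ZeroMemClass.coe_zero]

end Order

/-! ### Exponentials of nilpotent elements -/

section Exponential

variable {R : Type*} [Ring R] [Algebra ℝ R]

theorem neg_pow_eq_zero {N : ℕ} {a : R} (h : a ^ N = 0) : (-a) ^ N = 0 := by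
  rw [neg_pow, h, mul_zero]

/-- The truncated exponential `∑_{i < N} aⁱ / i!`; it is the exponential of `a` if `a ^ N = 0`. -/
def nilExp (N : ℕ) (a : R) : R := ∑ i ∈ Finset.range N, ((i.factorial : ℝ)⁻¹) • a ^ i

/-- The polynomial `∑_{i < N} aⁱ ξⁱ / i!`. -/
def nilExpPoly (N : ℕ) (a : R) : Polynomial R :=
  ∑ i ∈ Finset.range N, Polynomial.monomial i (((i.factorial : ℝ)⁻¹) • a ^ i)

/-- The sum of the coefficients of a polynomial over a ring. -/
def coeffSum : Polynomial R →+* R :=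
  Polynomial.eval₂RingHom' (RingHom.id R) 1 fun a => Commute.one_right a

theorem coeffSum_eq_sum {p : Polynomial R} {K : ℕ} (hp : p.natDegree < K) :
    coeffSum p = ∑ j ∈ Finset.range K, p.coeff j := by
  change Polynomial.eval₂ (RingHom.id R) 1 p = _
  rw [Polynomial.eval₂_eq_sum_range' _ hp]
  simp

theorem coeffSum_monomial (i : ℕ) (a : R) : coeffSum (Polynomial.monomial i a) = a := by
  change Polynomial.eval₂ (RingHom.id R) 1 _ = _
  simp

theorem coeffSum_C (a : R) : coeffSum (Polynomial.C a) = a := coeffSum_monomial 0 a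

/-- Setting ξ = 1. Identities checked coefficient by coefficient in R[ξ] descend to R this way. -/
theorem coeffSum_nilExpPoly (N : ℕ) (a : R) : coeffSum (nilExpPoly N a) = nilExp N a := by
  simp only [nilExpPoly, map_sum, coeffSum_monomial, nilExp]

/-- Nilpotency makes the truncation invisible: the omitted terms vanish, so the formula holds for
every `n`. -/
theorem coeff_nilExpPoly {N : ℕ} {a : R} (h : a ^ N = 0) (n : ℕ) :
    (nilExpPoly N a).coeff n = ((n.factorial : ℝ)⁻¹) • a ^ n := by
  simp only [nilExpPoly, Polynomial.finsetSum_coeff, Polynomial.coeff_monomial]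
  rw [Finset.sum_ite_eq']
  split_ifs with hn
  · rfl
  · rw [pow_eq_zero_of_le (by simpa using hn) h, smul_zero]

/-- The binomial theorem divided by n!, that is, one coefficient of e^{aξ} e^{bξ} = e^{(a+b)ξ}. -/
theorem sum_antidiagonal_factorial (a b : R) (hab : Commute a b) (n : ℕ) :
    ∑ ij ∈ Finset.HasAntidiagonal.antidiagonal n, (((ij.1.factorial : ℝ)⁻¹) • a ^ ij.1) *
      (((ij.2.factorial : ℝ)⁻¹) • b ^ ij.2) = ((n.factorial : ℝ)⁻¹) • (a + b) ^ n := by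
  rw [hab.add_pow', Finset.smul_sum]
  refine Finset.sum_congr rfl fun ij hij => ?_
  obtain rfl := Finset.HasAntidiagonal.mem_antidiagonal.1 hij
  have h := Nat.add_choose_mul_factorial_mul_factorial ij.1 ij.2
  rw [← Nat.choose_symm_add] at h
  have h' : (((ij.1 + ij.2).choose ij.1 : ℕ) : ℝ) * (ij.1.factorial : ℝ) * (ij.2.factorial : ℝ) =
    ((ij.1 + ij.2).factorial : ℝ) := by exact_mod_cast h
  rw [smul_mul_smul_comm, ← Nat.cast_smul_eq_nsmul ℝ, smul_smul, ← h']
  congr 1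
  have h1 : ((ij.1 + ij.2).choose ij.1 : ℝ) ≠ 0 := by
    exact_mod_cast (Nat.choose_pos (Nat.le_add_right _ _)).ne'
  field_simp

theorem nilExpPoly_mul_neg {N : ℕ} {a : R} (h : a ^ N = 0) :
    nilExpPoly N a * nilExpPoly N (-a) = 1 := by
  have h' := neg_pow_eq_zero h
  ext n
  rw [Polynomial.coeff_mul]
  simp only [coeff_nilExpPoly h, coeff_nilExpPoly h']
  rw [sum_antidiagonal_factorial a (-a) (Commute.neg_right (Commute.refl a)), add_neg_cancel,
    Polynomial.coeff_one]
  rcases Nat.eq_zero_or_pos n with rfl | hn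
  · simp
  · rw [zero_pow hn.ne', smul_zero, if_neg hn.ne']

theorem nilExp_mul_neg {N : ℕ} {a : R} (h : a ^ N = 0) : nilExp N a * nilExp N (-a) = 1 := by
  rw [← coeffSum_nilExpPoly, ← coeffSum_nilExpPoly, ← map_mul, nilExpPoly_mul_neg h, map_one]

theorem nilExp_neg_mul {N : ℕ} {a : R} (h : a ^ N = 0) : nilExp N (-a) * nilExp N a = 1 := by
  have h' := neg_pow_eq_zero h
  simpa using nilExp_mul_neg h'

theorem map_nilExp {S : Type*} [Ring S] [Algebra ℝ S] (φ : R →ₐ[ℝ] S) (N : ℕ) (a : R) :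
    φ (nilExp N a) = nilExp N (φ a) := by
  simp only [nilExp, map_sum, map_smul, map_pow]

/-- If `[a, x] = y` and `[a, y] = 0` then `eᵃ x = (x + y) eᵃ`. -/
theorem nilExp_mul {N : ℕ} {a x y : R} (h : a ^ N = 0) (hx : a * x = x * a + y)
    (hy : a * y = y * a) : nilExp N a * x = (x + y) * nilExp N a := by
  -- Each of the n + 1 passages of `a` across `x` leaves one `y`, and no further terms arise since
  -- `y` commutes with `a`.
  have h1 : ∀ n : ℕ, a ^ (n + 1) * x = x * a ^ (n + 1) + ((n + 1 : ℕ) : ℝ) • (y * a ^ n) := by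
    intro n
    induction n with
    | zero => simp [hx]
    | succ n ih =>
      have hyn : a * (y * a ^ n) = y * a ^ (n + 1) := by
        rw [← mul_assoc, hy, mul_assoc, ← pow_succ']
      rw [pow_succ' a (n + 1), mul_assoc, ih, mul_add, ← mul_assoc, hx, add_mul, mul_assoc,
        mul_smul_comm, hyn, add_assoc]
      congr 1
      push_cast
      module
  -- The sum is lengthened by the vanishing term a^N, so that the index shift caused by the
  -- commutator lands exactly on `nilExp N a`.
  have h2 : nilExp (N + 1) a = nilExp N a := by
    rw [nilExp, Finset.sum_range_succ, h, smul_zero, add_zero, nilExp]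
  have h3 : nilExp (N + 1) a = (∑ i ∈ Finset.range N,
      (((i + 1).factorial : ℝ)⁻¹) • a ^ (i + 1)) + 1 := by
    rw [nilExp, Finset.sum_range_succ']
    simp
  have h4 : (∑ i ∈ Finset.range N, (((i + 1).factorial : ℝ)⁻¹) • a ^ (i + 1)) * x =
      x * (∑ i ∈ Finset.range N, (((i + 1).factorial : ℝ)⁻¹) • a ^ (i + 1)) +
        y * nilExp N a := by
    rw [Finset.sum_mul, nilExp, Finset.mul_sum, Finset.mul_sum, ← Finset.sum_add_distrib]
    refine Finset.sum_congr rfl fun i _ => ?_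
    rw [smul_mul_assoc, h1, smul_add, mul_smul_comm, smul_smul, mul_smul_comm,
      Nat.factorial_succ]
    congr 2
    have : ((i + 1 : ℕ) : ℝ) ≠ 0 := by positivity
    have : (i.factorial : ℝ) ≠ 0 := by positivity
    push_cast
    field_simp
  rw [add_mul x y]
  generalize (∑ i ∈ Finset.range N, (((i + 1).factorial : ℝ)⁻¹) • a ^ (i + 1)) = S at h3 h4
  rw [h2] at h3
  have h5 : nilExp N a * x = (S + 1) * x := by rw [← h3]
  have h6 : x * nilExp N a = x * (S + 1) := by rw [← h3]
  rw [h5, h6, add_mul, h4]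
  noncomm_ring

theorem nilExp_commute {N : ℕ} {a x : R} (hx : a * x = x * a) :
    nilExp N a * x = x * nilExp N a := by
  have h : Commute a x := hx
  rw [nilExp, Finset.sum_mul, Finset.mul_sum]
  refine Finset.sum_congr rfl fun i _ => ?_
  rw [smul_mul_assoc, mul_smul_comm, (h.pow_left i).eq]

theorem nilExp_neg_mul_of_commutator {N : ℕ} {a x y : R} (h : a ^ N = 0)
    (hx : x * a = a * x + y) (hy : a * y = y * a) :
    nilExp N (-a) * x = (x + y) * nilExp N (-a) :=
  nilExp_mul (neg_pow_eq_zero h) (by rw [mul_neg, hx]; noncomm_ring)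
    (by rw [neg_mul, hy, mul_neg])

/-- The intended values are y = e^{-L}, x = e^Λ, e the wedge with a covector and c the contraction
with its dual vector. Conjugation by x and by y acts on the span of e and c by opposite shears,
whose product yxy is a quarter turn: e goes to -c, and c goes to e in `weyl_mul_lower`. -/
theorem weyl_mul_raise {x y e c : R} (h1 : y * e = e * y) (h2 : y * c = (c + e) * y)
    (h3 : x * e = (e - c) * x) : y * x * y * e = -(c * (y * x * y)) := by
  have h4 : y * (e - c) = -(c * y) := by
    rw [mul_sub, h1, h2]
    noncomm_ring
  rw [mul_assoc, h1, ← mul_assoc, mul_assoc y, h3, ← mul_assoc, h4]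
  noncomm_ring

theorem weyl_mul_lower {x y e c : R} (h1 : y * e = e * y) (h2 : y * c = (c + e) * y)
    (h3 : x * e = (e - c) * x) (h4 : x * c = c * x) : y * x * y * c = e * (y * x * y) := by
  have h5 : x * (c + e) = e * x := by
    rw [mul_add, h3, h4]
    noncomm_ring
  rw [mul_assoc, h2, ← mul_assoc, mul_assoc y, h5, ← mul_assoc, h1]
  noncomm_ring

/-- The coefficient of `ξʲ` in `e^{aξ} x e^{-aξ}`. -/
def conjCoeff (N : ℕ) (a x : R) (j : ℕ) : R :=
  (nilExpPoly N a * Polynomial.C x * nilExpPoly N (-a)).coeff j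

theorem conjCoeff_eq_sum {N : ℕ} {a : R} (h : a ^ N = 0) (x : R) (j : ℕ) :
    conjCoeff N a x j = ∑ ij ∈ Finset.HasAntidiagonal.antidiagonal j,
      ((((ij.1.factorial : ℝ)⁻¹) • a ^ ij.1) * x) * (((ij.2.factorial : ℝ)⁻¹) • (-a) ^ ij.2) := by
  have h' := neg_pow_eq_zero h
  simp only [conjCoeff, Polynomial.coeff_mul _ (nilExpPoly N (-a)), Polynomial.coeff_mul_C,
    coeff_nilExpPoly h, coeff_nilExpPoly h']

theorem conjCoeff_zero {N : ℕ} {a : R} (h : a ^ N = 0) (x : R) : conjCoeff N a x 0 = x := by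
  simp [conjCoeff_eq_sum h]

theorem conjCoeff_one {N : ℕ} {a : R} (h : a ^ N = 0) (x : R) :
    conjCoeff N a x 1 = a * x - x * a := by
  rw [conjCoeff_eq_sum h, Finset.Nat.sum_antidiagonal_eq_sum_range_succ_mk]
  simp [Finset.sum_range_succ]
  abel

/-- Only a lower bound is imposed on the truncation, so that several such expansions can be cut at a
common index. -/
theorem nilExp_conj (N : ℕ) (a x : R) :
    ∃ K, ∀ K' ≥ K, nilExp N a * x * nilExp N (-a) = ∑ j ∈ Finset.range K', conjCoeff N a x j := by
  refine ⟨(nilExpPoly N a * Polynomial.C x * nilExpPoly N (-a)).natDegree + 1, fun K' hK => ?_⟩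
  have := coeffSum_eq_sum (p := nilExpPoly N a * Polynomial.C x * nilExpPoly N (-a))
    (Nat.lt_of_succ_le hK)
  rw [map_mul, map_mul, coeffSum_nilExpPoly, coeffSum_nilExpPoly, coeffSum_C] at this
  exact this

/-- Conjugation by an invertible polynomial is multiplicative. For x = y = d this converts d² = 0
into all the multicomplex relations at once. -/
theorem conjCoeff_mul {N : ℕ} {a : R} (h : a ^ N = 0) (x y : R) (j : ℕ) :
    ∑ ij ∈ Finset.HasAntidiagonal.antidiagonal j, conjCoeff N a x ij.1 * conjCoeff N a y ij.2 =
      conjCoeff N a (x * y) j := by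
  have h' := neg_pow_eq_zero h
  have h1 : nilExpPoly N (-a) * nilExpPoly N a = 1 := by simpa using nilExpPoly_mul_neg h'
  simp only [conjCoeff]
  rw [← Polynomial.coeff_mul]
  congr 1
  rw [Polynomial.C_mul]
  simp only [mul_assoc]
  rw [← mul_assoc (nilExpPoly N (-a)), h1, one_mul]

/-- The second coefficient is half a double commutator; this exhibits Δ₂ as a bracket, from which
its order is read off. -/
theorem conjCoeff_two {N : ℕ} {a : R} (h : a ^ N = 0) (x : R) :
    (2 : ℝ) • conjCoeff N a x 2 = a * conjCoeff N a x 1 - conjCoeff N a x 1 * a := by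
  rw [conjCoeff_one h, conjCoeff_eq_sum h, Finset.Nat.sum_antidiagonal_eq_sum_range_succ_mk]
  simp only [Finset.sum_range_succ, Finset.sum_range_zero, Nat.sub_zero, Nat.factorial,
    pow_zero, pow_one, Nat.sub_self, Nat.add_one_sub_one, neg_sq]
  simp only [pow_two, mul_sub, sub_mul, mul_assoc]
  norm_num [mul_assoc]
  module

end Exponential

/-! ### The grading of an exterior algebra -/

section ExteriorGrading

variable {W : Type*} [AddCommGroup W] [Module ℝ W]

theorem extDeg_natCast (k : ℕ) : extDeg W (k : ℤ) = ⋀[ℝ]^k W := rfl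

theorem one_mem_extDeg : (1 : ExteriorAlgebra ℝ W) ∈ extDeg W 0 := by
  change (1 : ExteriorAlgebra ℝ W) ∈ ⋀[ℝ]^0 W
  rw [ExteriorAlgebra.exteriorPower, pow_zero]
  exact Submodule.one_le.1 le_rfl

theorem ι_mem_extDeg (θ : W) : ExteriorAlgebra.ι ℝ θ ∈ extDeg W 1 := by
  change _ ∈ ⋀[ℝ]^1 W
  rw [ExteriorAlgebra.exteriorPower, pow_one]
  exact LinearMap.mem_range_self _ _

theorem mul_mem_extDeg {p q : ℤ} {u v : ExteriorAlgebra ℝ W} (hu : u ∈ extDeg W p)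
    (hv : v ∈ extDeg W q) : u * v ∈ extDeg W (p + q) := by
  cases p with
  | negSucc p => rw [(Submodule.mem_bot ℝ).1 hu, zero_mul]; exact zero_mem _
  | ofNat p =>
    cases q with
    | negSucc q => rw [(Submodule.mem_bot ℝ).1 hv, mul_zero]; exact zero_mem _
    | ofNat q =>
      change u * v ∈ ⋀[ℝ]^(p + q) W
      rw [ExteriorAlgebra.exteriorPower, pow_add]
      exact Submodule.mul_mem_mul hu hv

theorem mem_extDeg_zero {u : ExteriorAlgebra ℝ W} (hu : u ∈ extDeg W 0) :
    ∃ r : ℝ, u = algebraMap ℝ _ r := by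
  change u ∈ ⋀[ℝ]^0 W at hu
  rw [ExteriorAlgebra.exteriorPower, pow_zero, Submodule.mem_one] at hu
  obtain ⟨r, rfl⟩ := hu
  exact ⟨r, rfl⟩

theorem mem_extDeg_one {u : ExteriorAlgebra ℝ W} (hu : u ∈ extDeg W 1) :
    ∃ θ : W, u = ExteriorAlgebra.ι ℝ θ := by
  change u ∈ ⋀[ℝ]^1 W at hu
  rw [ExteriorAlgebra.exteriorPower, pow_one] at hu
  obtain ⟨θ, rfl⟩ := hu
  exact ⟨θ, rfl⟩

/-- Forms of degree `k + 1` are sums of products of a covector and a form of degree `k`. -/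
theorem extDeg_succ_induction {k : ℕ} {P : ExteriorAlgebra ℝ W → Prop}
    (hmul : ∀ θ : W, ∀ u ∈ extDeg W k, P (ExteriorAlgebra.ι ℝ θ * u))
    (hadd : ∀ u v, P u → P v → P (u + v)) {u : ExteriorAlgebra ℝ W}
    (hu : u ∈ extDeg W ((k + 1 : ℕ) : ℤ)) : P u := by
  rw [extDeg_natCast, ExteriorAlgebra.exteriorPower, pow_succ'] at hu
  induction hu using Submodule.mul_induction_on' with
  | mem_mul_mem m hm n hn =>
    obtain ⟨θ, rfl⟩ := hm
    exact hmul θ n hn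
  | add x _ y _ hx hy => exact hadd x y hx hy

theorem extDeg_two_induction {P : ExteriorAlgebra ℝ W → Prop}
    (hmul : ∀ a b : W, P (ExteriorAlgebra.ι ℝ a * ExteriorAlgebra.ι ℝ b))
    (hadd : ∀ u v, P u → P v → P (u + v)) {u : ExteriorAlgebra ℝ W}
    (hu : u ∈ extDeg W 2) : P u := by
  refine extDeg_succ_induction (k := 1) (fun θ u hu => ?_) hadd hu
  obtain ⟨η, rfl⟩ := mem_extDeg_one hu
  exact hmul θ η

theorem extDeg_three_induction {P : ExteriorAlgebra ℝ W → Prop}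
    (hmul : ∀ a b c : W, P (ExteriorAlgebra.ι ℝ a * (ExteriorAlgebra.ι ℝ b * ExteriorAlgebra.ι ℝ c)))
    (hadd : ∀ u v, P u → P v → P (u + v)) {u : ExteriorAlgebra ℝ W}
    (hu : u ∈ extDeg W 3) : P u := by
  refine extDeg_succ_induction (k := 2) (fun θ u hu => ?_) hadd hu
  refine extDeg_two_induction (P := fun u => P (ExteriorAlgebra.ι ℝ θ * u))
    (fun a b => hmul θ a b) (fun u v hu hv => ?_) hu
  rw [mul_add]
  exact hadd _ _ hu hv

theorem ext_left_induction {P : ExteriorAlgebra ℝ W → Prop} (hone : P 1)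
    (hadd : ∀ u v, P u → P v → P (u + v)) (hsmul : ∀ (r : ℝ) u, P u → P (r • u))
    (hmul : ∀ (θ : W) u, P u → P (ExteriorAlgebra.ι ℝ θ * u)) (u : ExteriorAlgebra ℝ W) : P u := by
  induction u using CliffordAlgebra.left_induction with
  | algebraMap r =>
    rw [Algebra.algebraMap_eq_smul_one]
    exact hsmul r 1 hone
  | add x y hx hy => exact hadd x y hx hy
  | ι_mul x m hx => exact hmul m x hx

theorem end_ext_of_ι_mul {N : Type*} [AddCommGroup N] [Module ℝ N]
    {S T : ExteriorAlgebra ℝ W →ₗ[ℝ] N} (h1 : S 1 = T 1)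
    (h : ∀ (θ : W) u, S u = T u → S (ExteriorAlgebra.ι ℝ θ * u) = T (ExteriorAlgebra.ι ℝ θ * u)) :
    S = T := by
  refine LinearMap.ext fun u => ?_
  refine ext_left_induction (P := fun u => S u = T u) h1 (fun u v hu hv => ?_) (fun r u hu => ?_)
    h u
  · rw [map_add, map_add, hu, hv]
  · rw [map_smul, map_smul, hu]

/-- The algebra map `θ ↦ θ ξ` which records the degree of a form. -/
def gradingHom (W : Type*) [AddCommGroup W] [Module ℝ W] :
    ExteriorAlgebra ℝ W →ₐ[ℝ] Polynomial (ExteriorAlgebra ℝ W) :=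
  ExteriorAlgebra.lift ℝ
    ⟨((Polynomial.monomial (R := ExteriorAlgebra ℝ W) 1).restrictScalars ℝ) ∘ₗ
      ExteriorAlgebra.ι ℝ, fun θ => by simp [Polynomial.monomial_mul_monomial]⟩

theorem gradingHom_ι (θ : W) : gradingHom W (ExteriorAlgebra.ι ℝ θ) =
    Polynomial.monomial 1 (ExteriorAlgebra.ι ℝ θ) := by
  simp [gradingHom]

theorem gradingHom_of_mem {k : ℕ} {u : ExteriorAlgebra ℝ W} (hu : u ∈ extDeg W k) :
    gradingHom W u = Polynomial.monomial k u := by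
  induction k generalizing u with
  | zero =>
    obtain ⟨r, rfl⟩ := mem_extDeg_zero hu
    rw [AlgHom.commutes]
    rfl
  | succ k ih =>
    refine extDeg_succ_induction (P := fun u => gradingHom W u = Polynomial.monomial (k + 1) u)
      (fun θ u hu => ?_) (fun u v hu hv => by rw [map_add, map_add, hu, hv]) hu
    rw [map_mul, gradingHom_ι, ih hu, Polynomial.monomial_mul_monomial, add_comm]

/-- The component of degree `k` of a form. -/
def extProj (k : ℕ) : End ℝ (ExteriorAlgebra ℝ W) :=
  ((Polynomial.lcoeff (ExteriorAlgebra ℝ W) k).restrictScalars ℝ) ∘ₗ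
    (gradingHom W).toLinearMap

theorem extProj_apply (k : ℕ) (u : ExteriorAlgebra ℝ W) :
    extProj k u = (gradingHom W u).coeff k := rfl

theorem extProj_of_mem {k l : ℕ} {u : ExteriorAlgebra ℝ W} (hu : u ∈ extDeg W k) :
    extProj l u = if k = l then u else 0 := by
  rw [extProj_apply, gradingHom_of_mem hu, Polynomial.coeff_monomial]

theorem extProj_mul (k : ℕ) (u v : ExteriorAlgebra ℝ W) : extProj k (u * v) =
    ∑ ij ∈ Finset.HasAntidiagonal.antidiagonal k, extProj ij.1 u * extProj ij.2 v := by
  simp only [extProj_apply, map_mul, Polynomial.coeff_mul]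

theorem extProj_mem (k : ℕ) (u : ExteriorAlgebra ℝ W) : extProj k u ∈ extDeg W k := by
  induction u using ExteriorAlgebra.induction generalizing k with
  | algebraMap r =>
    rw [Algebra.algebraMap_eq_smul_one, map_smul]
    refine Submodule.smul_mem _ _ ?_
    rw [extProj_of_mem (k := 0) one_mem_extDeg]
    split_ifs with h
    · subst h; exact one_mem_extDeg
    · exact zero_mem _
  | ι θ =>
    rw [extProj_of_mem (k := 1) (ι_mem_extDeg θ)]
    split_ifs with h
    · subst h; exact ι_mem_extDeg θ
    · exact zero_mem _
  | mul a b ha hb =>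
    rw [extProj_mul]
    refine sum_mem fun ij hij => ?_
    rw [← Finset.HasAntidiagonal.mem_antidiagonal.1 hij]
    exact mul_mem_extDeg (ha _) (hb _)
  | add a b ha hb =>
    rw [map_add]
    exact add_mem (ha k) (hb k)

/-- More vectors than the dimension are linearly dependent, and an alternating product of dependent
vectors vanishes. -/
theorem extDeg_eq_bot [FiniteDimensional ℝ W] {k : ℤ} (hk : (finrank ℝ W : ℤ) < k) :
    extDeg W k = ⊥ := by
  obtain ⟨k, rfl⟩ := Int.eq_ofNat_of_zero_le (by omega : 0 ≤ k)
  rw [extDeg_natCast, ← ExteriorAlgebra.ιMulti_span_fixedDegree, Submodule.span_eq_bot]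
  rintro _ ⟨v, rfl⟩
  refine AlternatingMap.map_linearDependent _ v fun h => ?_
  have := h.fintype_card_le_finrank
  rw [Fintype.card_fin] at this
  omega

/-- Adding up the components means setting ξ = 1 after θ ↦ θξ, which is the identity on generators.
Degrees above the dimension vanish, so any larger truncation is harmless. -/
theorem sum_extProj [FiniteDimensional ℝ W] {K : ℕ} (hK : finrank ℝ W < K)
    (u : ExteriorAlgebra ℝ W) : ∑ k ∈ Finset.range K, extProj k u = u := by
  have h1 : (gradingHom W u).natDegree ≤ finrank ℝ W := by
    refine Polynomial.natDegree_le_iff_coeff_eq_zero.2 fun k hk => ?_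
    have := extProj_mem k u
    rw [extDeg_eq_bot (by exact_mod_cast hk), Submodule.mem_bot] at this
    exact this
  have h2 := coeffSum_eq_sum (lt_of_le_of_lt h1 hK)
  simp only [← extProj_apply] at h2
  rw [← h2]
  have h3 : ∀ (θ : W) (v : ExteriorAlgebra ℝ W), coeffSum (gradingHom W v) = v →
      coeffSum (gradingHom W (ExteriorAlgebra.ι ℝ θ * v)) = ExteriorAlgebra.ι ℝ θ * v := by
    intro θ v hv
    rw [map_mul, map_mul, gradingHom_ι, coeffSum_monomial, hv]
  refine ext_left_induction (P := fun u => coeffSum (gradingHom W u) = u) (by simp)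
    (fun u v hu hv => by rw [map_add, map_add, hu, hv]) (fun r u hu => ?_) h3 u
  have h4 : coeffSum (algebraMap ℝ (Polynomial (ExteriorAlgebra ℝ W)) r) =
    algebraMap ℝ (ExteriorAlgebra ℝ W) r := coeffSum_C _
  rw [Algebra.smul_def, map_mul, map_mul, hu, AlgHom.commutes, h4]

theorem involute_involute (u : ExteriorAlgebra ℝ W) :
    CliffordAlgebra.involute (CliffordAlgebra.involute u) = u :=
  CliffordAlgebra.involute_involute u

theorem involute_ι (θ : W) :
    CliffordAlgebra.involute (ExteriorAlgebra.ι ℝ θ) = -ExteriorAlgebra.ι ℝ θ :=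
  CliffordAlgebra.involute_ι θ

theorem reverse_ι (θ : W) :
    CliffordAlgebra.reverse (ExteriorAlgebra.ι ℝ θ) = ExteriorAlgebra.ι ℝ θ :=
  CliffordAlgebra.reverse_ι θ

theorem involute_mem_extDeg {k : ℤ} {u : ExteriorAlgebra ℝ W} (hu : u ∈ extDeg W k) :
    CliffordAlgebra.involute u ∈ extDeg W k := by
  rw [involute_of_mem_extDeg hu]
  exact Submodule.smul_mem _ _ hu

theorem extDeg_graded_comm {p q : ℤ} {u v : ExteriorAlgebra ℝ W} (hu : u ∈ extDeg W p)
    (hv : v ∈ extDeg W q) : u * v = sgn ℝ (p * q) • (v * u) := by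
  cases p with
  | negSucc p => rw [(Submodule.mem_bot ℝ).1 hu, zero_mul, mul_zero, smul_zero]
  | ofNat p =>
    change u ∈ extDeg W (p : ℤ) at hu
    change _ = sgn ℝ ((p : ℤ) * q) • _
    induction p generalizing u with
    | zero =>
      obtain ⟨r, rfl⟩ := mem_extDeg_zero hu
      rw [Algebra.commutes, Nat.cast_zero, zero_mul, sgn_of_even Even.zero, one_smul]
    | succ p ih =>
      refine extDeg_succ_induction (P := fun u => u * v = sgn ℝ (((p + 1 : ℕ) : ℤ) * q) • (v * u))
        (fun θ u hu => ?_) (fun u u' hu hu' => by rw [add_mul, mul_add, smul_add, hu, hu']) hu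
      rw [mul_assoc, ih hu, mul_smul_comm, ← mul_assoc, ι_mul_eq_involute_mul θ v,
        involute_of_mem_extDeg hv, smul_mul_assoc, smul_mul_assoc, smul_smul, ← sgn_add, mul_assoc]
      congr 2
      push_cast
      ring

theorem reverse_ι_mul (θ : W) (u : ExteriorAlgebra ℝ W) :
    CliffordAlgebra.reverse (ExteriorAlgebra.ι ℝ θ * u) =
      ExteriorAlgebra.ι ℝ θ * CliffordAlgebra.involute (CliffordAlgebra.reverse u) := by
  rw [CliffordAlgebra.reverse.map_mul, reverse_ι, ι_mul_eq_involute_mul, involute_involute]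

/-- Reversing k factors takes k(k-1)/2 transpositions; the induction is Pascal's rule. -/
theorem reverse_of_mem_extDeg {k : ℕ} {u : ExteriorAlgebra ℝ W} (hu : u ∈ extDeg W k) :
    CliffordAlgebra.reverse u = (-1 : ℝ) ^ (k.choose 2) • u := by
  induction k generalizing u with
  | zero =>
    obtain ⟨r, rfl⟩ := mem_extDeg_zero hu
    simp
  | succ k ih =>
    refine extDeg_succ_induction
      (P := fun u => CliffordAlgebra.reverse u = (-1 : ℝ) ^ ((k + 1).choose 2) • u)
      (fun θ u hu => ?_) (fun u v hu hv => by rw [map_add, smul_add, hu, hv]) hu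
    have h : sgn ℝ (k : ℤ) = (-1 : ℝ) ^ k := by simp [sgn]
    rw [reverse_ι_mul, ih hu, map_smul, involute_of_mem_extDeg hu, smul_smul, mul_smul_comm, h,
      ← pow_add, Nat.choose_succ_succ' k 1, Nat.choose_one_right, add_comm]

theorem reverse_mem_extDeg {k : ℤ} {u : ExteriorAlgebra ℝ W} (hu : u ∈ extDeg W k) :
    CliffordAlgebra.reverse u ∈ extDeg W k := by
  cases k with
  | negSucc k => rw [(Submodule.mem_bot ℝ).1 hu, map_zero]; exact zero_mem _
  | ofNat k =>
    rw [reverse_of_mem_extDeg (k := k) hu]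
    exact Submodule.smul_mem _ _ hu

end ExteriorGrading

/-! ### Contractions -/

section Contraction

variable {V : Type*} [AddCommGroup V] [Module ℝ V]

theorem contract_ι (v : V) (θ : Dual ℝ V) :
    contract v (ExteriorAlgebra.ι ℝ θ) = algebraMap ℝ _ (θ v) :=
  CliffordAlgebra.contractLeft_ι ..

theorem contract_algebraMap (v : V) (r : ℝ) :
    contract v (algebraMap ℝ (ExteriorAlgebra ℝ (Dual ℝ V)) r) = 0 :=
  CliffordAlgebra.contractLeft_algebraMap ..

theorem contract_comm (v w : V) (u : ExteriorAlgebra ℝ (Dual ℝ V)) :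
    contract v (contract w u) = -contract w (contract v u) :=
  CliffordAlgebra.contractLeft_comm ..

theorem contract_involute (v : V) (u : ExteriorAlgebra ℝ (Dual ℝ V)) :
    contract v (CliffordAlgebra.involute u) = -CliffordAlgebra.involute (contract v u) := by
  refine ext_left_induction (P := fun u => contract v (CliffordAlgebra.involute u) =
    -CliffordAlgebra.involute (contract v u)) ?_ (fun u u' hu hu' => ?_) (fun r u hu => ?_)
    (fun θ u hu => ?_) u
  · rw [map_one, contract_one, map_zero, neg_zero]
  · simp only [map_add, hu, hu', neg_add]
  · simp only [map_smul, hu, smul_neg]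
  · rw [map_mul, involute_ι, neg_mul, map_neg, contract_ι_mul, hu, contract_ι_mul, map_sub, map_mul,
      involute_ι, map_smul]
    simp

theorem contract_mul (v : V) (u u' : ExteriorAlgebra ℝ (Dual ℝ V)) :
    contract v (u * u') = contract v u * u' + CliffordAlgebra.involute u * contract v u' := by
  refine ext_left_induction (P := fun u => contract v (u * u') =
    contract v u * u' + CliffordAlgebra.involute u * contract v u') ?_ (fun u u' hu hu' => ?_)
    (fun r u hu => ?_) (fun θ u hu => ?_) u
  · simp [contract_one]
  · simp only [add_mul, map_add, hu, hu']
    abel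
  · simp only [map_smul, smul_mul_assoc, hu, smul_add]
  · rw [mul_assoc, contract_ι_mul, hu, contract_ι_mul, map_mul, involute_ι]
    simp only [mul_add, sub_mul, smul_mul_assoc, neg_mul, mul_assoc]
    abel

theorem contract_mem_extDeg (v : V) {k : ℤ} {u : ExteriorAlgebra ℝ (Dual ℝ V)}
    (hu : u ∈ extDeg (Dual ℝ V) k) : contract v u ∈ extDeg (Dual ℝ V) (k - 1) := by
  cases k with
  | negSucc k => rw [(Submodule.mem_bot ℝ).1 hu, map_zero]; exact zero_mem _
  | ofNat k =>
    change u ∈ extDeg _ (k : ℤ) at hu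
    change _ ∈ extDeg _ ((k : ℤ) - 1)
    induction k generalizing u with
    | zero =>
      obtain ⟨r, rfl⟩ := mem_extDeg_zero hu
      rw [contract_algebraMap]
      exact zero_mem _
    | succ k ih =>
      refine extDeg_succ_induction
        (P := fun u => contract v u ∈ extDeg _ (((k + 1 : ℕ) : ℤ) - 1))
        (fun θ u hu => ?_) (fun u v hu hv => by rw [map_add]; exact add_mem hu hv) hu
      have h1 := mul_mem_extDeg (ι_mem_extDeg θ) (ih hu)
      rw [contract_ι_mul]
      push_cast
      rw [add_sub_cancel_right]
      rw [add_sub_cancel] at h1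
      exact sub_mem (Submodule.smul_mem _ _ hu) h1

variable [FiniteDimensional ℝ V]

/-- Euler's formula for forms of degree `k`. -/
theorem sum_ι_mul_contract {ι' : Type*} [Fintype ι'] [DecidableEq ι'] (b : Basis ι' ℝ V) {k : ℕ}
    {u : ExteriorAlgebra ℝ (Dual ℝ V)} (hu : u ∈ extDeg (Dual ℝ V) k) :
    ∑ i, ExteriorAlgebra.ι ℝ (b.coord i) * contract (b i) u = (k : ℝ) • u := by
  induction k generalizing u with
  | zero =>
    obtain ⟨r, rfl⟩ := mem_extDeg_zero hu
    simp [contract_algebraMap]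
  | succ k ih =>
    refine extDeg_succ_induction (P := fun u =>
      ∑ i, ExteriorAlgebra.ι ℝ (b.coord i) * contract (b i) u = ((k + 1 : ℕ) : ℝ) • u)
      (fun θ u hu => ?_) (fun u v hu hv => ?_) hu
    · have h1 : ∑ i, θ (b i) • b.coord i = θ := by
        refine b.ext fun j => ?_
        simp
      have h2 : ∀ i, ExteriorAlgebra.ι ℝ (b.coord i) * contract (b i) (ExteriorAlgebra.ι ℝ θ * u) =
          ExteriorAlgebra.ι ℝ (θ (b i) • b.coord i) * u +
            ExteriorAlgebra.ι ℝ θ * (ExteriorAlgebra.ι ℝ (b.coord i) * contract (b i) u) := by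
        intro i
        rw [contract_ι_mul, mul_sub, mul_smul_comm, map_smul, smul_mul_assoc, ← mul_assoc,
          ← mul_assoc, eq_neg_of_add_eq_zero_left (ExteriorAlgebra.ι_add_mul_swap (b.coord i) θ)]
        simp [sub_eq_add_neg]
      simp only [h2, Finset.sum_add_distrib, ← Finset.mul_sum, ← Finset.sum_mul, ih hu,
        ← map_sum, h1]
      rw [mul_smul_comm]
      push_cast
      module
    · simp only [map_add, mul_add, Finset.sum_add_distrib, hu, hv, smul_add]

end Contraction

/-! ### Linear symplectic geometry -/

section SymplecticFibre

variable {V : Type*} [AddCommGroup V] [Module ℝ V]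

theorem formBilin_swap (u : ExteriorAlgebra ℝ (Dual ℝ V)) (v w : V) :
    formBilin u v w = -formBilin u w v := by
  simp only [formBilin, LinearMap.mk₂_apply]
  rw [contract_comm, map_neg]

theorem contract_eq_ι_formBilin {η : ExteriorAlgebra ℝ (Dual ℝ V)} (hη : η ∈ extDeg (Dual ℝ V) 2)
    (v : V) : contract v η = ExteriorAlgebra.ι ℝ (formBilin η v) := by
  obtain ⟨c, hc⟩ := mem_extDeg_one (contract_mem_extDeg v hη : _ ∈ extDeg _ (2 - 1))
  rw [hc]
  congr 1
  refine LinearMap.ext fun w => ?_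
  rw [formBilin, LinearMap.mk₂_apply, hc, contract_ι, ExteriorAlgebra.algebraMap_leftInverse]

theorem involute_of_deg_two {η : ExteriorAlgebra ℝ (Dual ℝ V)} (hη : η ∈ extDeg (Dual ℝ V) 2) :
    CliffordAlgebra.involute η = η := by
  rw [involute_of_mem_extDeg hη, sgn_of_even even_two, one_smul]

theorem reverse_of_deg_two {η : ExteriorAlgebra ℝ (Dual ℝ V)} (hη : η ∈ extDeg (Dual ℝ V) 2) :
    CliffordAlgebra.reverse η = -η := by
  rw [reverse_of_mem_extDeg (k := 2) hη]
  simp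

theorem deg_two_mul_comm {η : ExteriorAlgebra ℝ (Dual ℝ V)} (hη : η ∈ extDeg (Dual ℝ V) 2)
    (θ : Dual ℝ V) : η * ExteriorAlgebra.ι ℝ θ = ExteriorAlgebra.ι ℝ θ * η := by
  rw [ι_mul_eq_involute_mul, involute_of_deg_two hη]

variable [FiniteDimensional ℝ V]

/-! ### Pairing and contraction for a nondegenerate bilinear form -/

section Bilin

variable (B : LinearMap.BilinForm ℝ V) (hB : B.Nondegenerate)

theorem apply_sharp (a : Dual ℝ V) (v : V) : B (sharp B hB a) v = a v :=
  LinearMap.BilinForm.apply_toDual_symm_apply a v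

theorem contractForm_ι (a : Dual ℝ V) :
    contractForm B hB (ExteriorAlgebra.ι ℝ a) = contract (sharp B hB a) := by
  simp [contractForm]

theorem contractForm_mem_extDeg {p q : ℤ} {u v : ExteriorAlgebra ℝ (Dual ℝ V)}
    (hu : u ∈ extDeg (Dual ℝ V) p) (hv : v ∈ extDeg (Dual ℝ V) q) :
    contractForm B hB u v ∈ extDeg (Dual ℝ V) (q - p) := by
  cases p with
  | negSucc p =>
    rw [(Submodule.mem_bot ℝ).1 hu, map_zero]
    exact zero_mem _
  | ofNat p =>
    change u ∈ extDeg _ (p : ℤ) at hu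
    change _ ∈ extDeg _ (q - (p : ℤ))
    induction p generalizing u with
    | zero =>
      obtain ⟨r, rfl⟩ := mem_extDeg_zero hu
      rw [AlgHom.commutes, Module.algebraMap_end_apply, Nat.cast_zero, sub_zero]
      exact Submodule.smul_mem _ _ hv
    | succ p ih =>
      refine extDeg_succ_induction
        (P := fun u => contractForm B hB u v ∈ extDeg _ (q - ((p + 1 : ℕ) : ℤ)))
        (fun θ u hu => ?_) (fun u u' hu hu' => by rw [map_add]; exact add_mem hu hu') hu
      have := contract_mem_extDeg (sharp B hB θ) (ih hu)
      rw [map_mul, contractForm_ι, Module.End.mul_apply]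
      push_cast
      rwa [← sub_sub]

/-- Reversal is an antihomomorphism, so a left factor simply moves to the other side. This provides
the adjoint of every multiplication operator. -/
theorem extPairing_mul (u α β : ExteriorAlgebra ℝ (Dual ℝ V)) :
    extPairing B hB (u * α) β =
      extPairing B hB α (contractForm B hB (CliffordAlgebra.reverse u) β) := by
  simp only [extPairing, LinearMap.mk₂_apply, CliffordAlgebra.reverse.map_mul, map_mul,
    Module.End.mul_apply]

theorem extPairing_of_ne {j k : ℤ} (hjk : j ≠ k) {α β : ExteriorAlgebra ℝ (Dual ℝ V)}
    (hα : α ∈ extDeg (Dual ℝ V) j) (hβ : β ∈ extDeg (Dual ℝ V) k) : extPairing B hB α β = 0 := by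
  cases j with
  | negSucc j => rw [(Submodule.mem_bot ℝ).1 hα, map_zero, LinearMap.zero_apply]
  | ofNat j =>
    change α ∈ extDeg _ (j : ℤ) at hα
    change (j : ℤ) ≠ k at hjk
    induction j generalizing k α β with
    | zero =>
      obtain ⟨r, rfl⟩ := mem_extDeg_zero hα
      rw [Algebra.algebraMap_eq_smul_one, map_smul, LinearMap.smul_apply, extPairing_one]
      cases k with
      | negSucc k => rw [(Submodule.mem_bot ℝ).1 hβ, map_zero, smul_zero]
      | ofNat k =>
        obtain ⟨k, rfl⟩ : ∃ l, k = l + 1 := Nat.exists_eq_succ_of_ne_zero fun h => hjk (by simp [h])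
        refine extDeg_succ_induction (k := k)
          (P := fun β => r • ExteriorAlgebra.algebraMapInv β = 0)
          (fun θ u _ => by simp [ExteriorAlgebra.algebraMapInv])
          (fun u v hu hv => by rw [map_add, smul_add, hu, hv, add_zero]) hβ
    | succ j ih =>
      refine extDeg_succ_induction (P := fun α => extPairing B hB α β = 0)
        (fun θ u hu => ?_) (fun u v hu hv => by rw [map_add, LinearMap.add_apply, hu, hv,
          add_zero]) hα
      rw [extPairing_ι_mul]
      exact ih (contract_mem_extDeg _ hβ) hu (by push_cast at hjk; omega)

/-- Induction on the degree. Since ♯ is onto, every contraction of `w` is orthogonal to all forms of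
one degree less, hence zero; Euler's formula then forces `w` itself to vanish. -/
theorem eq_zero_of_extPairing_homogeneous {k : ℤ} {w : ExteriorAlgebra ℝ (Dual ℝ V)}
    (hw : w ∈ extDeg (Dual ℝ V) k)
    (h : ∀ α ∈ extDeg (Dual ℝ V) k, extPairing B hB α w = 0) : w = 0 := by
  cases k with
  | negSucc k => exact (Submodule.mem_bot ℝ).1 hw
  | ofNat k =>
    change w ∈ extDeg _ (k : ℤ) at hw
    change ∀ α ∈ extDeg _ (k : ℤ), _ at h
    induction k generalizing w with
    | zero =>
      obtain ⟨r, rfl⟩ := mem_extDeg_zero hw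
      have := h 1 one_mem_extDeg
      rw [extPairing_one, ExteriorAlgebra.algebraMap_leftInverse] at this
      rw [this, map_zero]
    | succ k ih =>
      have h1 : ∀ v, contract v w = 0 := by
        intro v
        obtain ⟨a, rfl⟩ : ∃ a, sharp B hB a = v := ⟨B.toDual hB v, by simp [sharp]⟩
        have h2 := contract_mem_extDeg (sharp B hB a) hw
        push_cast at h2
        rw [add_sub_cancel_right] at h2
        refine ih h2 fun α hα => ?_
        rw [← extPairing_ι_mul]
        have := mul_mem_extDeg (ι_mem_extDeg a) hα
        refine h _ ?_
        push_cast
        rwa [add_comm]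
      have h3 := sum_ι_mul_contract (finBasis ℝ V) hw
      simp only [h1, mul_zero, Finset.sum_const_zero] at h3
      exact (smul_eq_zero.1 h3.symm).resolve_left (by positivity)

theorem eq_zero_of_extPairing {w : ExteriorAlgebra ℝ (Dual ℝ V)}
    (h : ∀ α, extPairing B hB α w = 0) : w = 0 := by
  rw [← sum_extProj (Nat.lt_succ_self _) w]
  refine Finset.sum_eq_zero fun k hk => ?_
  refine eq_zero_of_extPairing_homogeneous B hB (extProj_mem k w) fun α hα => ?_
  have h1 := h α
  rw [← sum_extProj (Nat.lt_succ_self _) w, map_sum, Finset.sum_eq_single_of_mem k hk] at h1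
  · exact h1
  · intro j _ hj
    exact extPairing_of_ne B hB (by exact_mod_cast hj.symm) hα (extProj_mem j w)

/-- Contraction is an antiderivation, so its bracket with multiplication by `a` is, up to sign,
multiplication by the contraction of `a`. -/
theorem hasOrderLE_contract (v : V) :
    HasOrderLE (extDeg (Dual ℝ V)) 1 (-1) (contract v) := by
  refine ⟨fun p a ha => contract_mem_extDeg v ha, fun j a ha => ?_⟩
  refine ⟨-sgn ℝ j • contract v a, Submodule.smul_mem _ _ (contract_mem_extDeg v ha), ?_⟩
  refine LinearMap.ext fun u => ?_
  have h1 : sgn ℝ (j * -1) = sgn ℝ j := by simp [sgn]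
  simp only [gradedBracket, LinearMap.sub_apply, LinearMap.smul_apply, Module.End.mul_apply,
    LinearMap.mulLeft_apply, contract_mul, involute_of_mem_extDeg ha, h1, smul_add, smul_mul_assoc,
    smul_smul, sgn_mul_self, one_smul]
  rw [neg_smul]
  abel

theorem hasOrderLE_contractForm {u : ExteriorAlgebra ℝ (Dual ℝ V)}
    (hu : u ∈ extDeg (Dual ℝ V) 2) :
    HasOrderLE (extDeg (Dual ℝ V)) 2 (-2) (contractForm B hB u) := by
  refine extDeg_two_induction
    (P := fun u => HasOrderLE (extDeg (Dual ℝ V)) 2 (-2) (contractForm B hB u))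
    (fun a b => ?_) (fun u v hu hv => by rw [map_add]; exact hu.add hv) hu
  rw [map_mul, contractForm_ι, contractForm_ι]
  exact (hasOrderLE_contract _).mul (fun _ _ _ ha _ hb => mul_mem_extDeg ha hb)
    (fun _ _ _ ha _ hb => extDeg_graded_comm ha hb) (hasOrderLE_contract _)

end Bilin

/-! ### The sl₂ relations between L and Λ, and the powers of the form -/

variable {η : ExteriorAlgebra ℝ (Dual ℝ V)}

theorem contract_sharp_form (hη : η ∈ extDeg (Dual ℝ V) 2)
    (hB : (formBilin η).Nondegenerate)
    (a : Dual ℝ V) :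
    contract (sharp (formBilin η) hB a) η = ExteriorAlgebra.ι ℝ a := by
  rw [contract_eq_ι_formBilin hη]
  congr 1
  exact LinearMap.ext fun v => apply_sharp _ hB a v

theorem apply_sharp_swap (hB : (formBilin η).Nondegenerate)
    (a b : Dual ℝ V) :
    a (sharp (formBilin η) hB b) = -b (sharp (formBilin η) hB a) := by
  rw [← apply_sharp _ hB a, ← apply_sharp _ hB b, formBilin_swap]

/-- The sign, absent from `extPairing_ι_mul`, expresses the antisymmetry of ω⁻¹. For a 2-form two
such signs cancel, which is why L is also the adjoint of Λ. -/
theorem extPairing_contract_sharp (hB : (formBilin η).Nondegenerate)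
    (b : Dual ℝ V) (α β : ExteriorAlgebra ℝ (Dual ℝ V)) :
    extPairing (formBilin η) hB (contract (sharp (formBilin η) hB b) α) β =
      -extPairing (formBilin η) hB α (ExteriorAlgebra.ι ℝ b * β) := by
  refine ext_left_induction (P := fun α => ∀ β,
    extPairing (formBilin η) hB (contract (sharp (formBilin η) hB b) α) β =
      -extPairing (formBilin η) hB α (ExteriorAlgebra.ι ℝ b * β)) (fun β => ?_)
    (fun u v hu hv β => ?_) (fun r u hu β => ?_) (fun θ u hu β => ?_) α β
  · rw [contract_one, map_zero, LinearMap.zero_apply, extPairing_one]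
    simp [ExteriorAlgebra.algebraMapInv]
  · simp only [map_add, LinearMap.add_apply, hu, hv, neg_add]
  · simp only [map_smul, LinearMap.smul_apply, hu, smul_neg]
  · rw [contract_ι_mul, map_sub, LinearMap.sub_apply, map_smul, LinearMap.smul_apply,
      extPairing_ι_mul, hu, extPairing_ι_mul, contract_ι_mul, map_sub, map_smul,
      apply_sharp_swap hB θ b]
    simp only [smul_eq_mul]
    ring

/-- The adjoint `Λ` of the wedge product with `η`. -/
theorem extPairing_contractForm_reverse (hη : η ∈ extDeg (Dual ℝ V) 2)
    (hB : (formBilin η).Nondegenerate)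
    (α β : ExteriorAlgebra ℝ (Dual ℝ V)) :
    extPairing (formBilin η) hB
        (contractForm (formBilin η) hB (CliffordAlgebra.reverse η) α) β =
      extPairing (formBilin η) hB α (η * β) := by
  refine extDeg_two_induction (P := fun u => extPairing (formBilin η) hB
        (contractForm (formBilin η) hB (CliffordAlgebra.reverse u) α) β =
      extPairing (formBilin η) hB α (u * β)) (fun a b => ?_) (fun u v hu hv => ?_) hη
  · rw [CliffordAlgebra.reverse.map_mul, reverse_ι, reverse_ι, map_mul, contractForm_ι,
      contractForm_ι, Module.End.mul_apply, extPairing_contract_sharp, extPairing_contract_sharp,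
      neg_neg, mul_assoc]
  · rw [map_add, map_add, LinearMap.add_apply, map_add, LinearMap.add_apply, hu, hv, add_mul,
      map_add]

/-- The commutator of contraction by `u` with the wedge by `a` is again a contraction, by i_{♯a} u.
For u = η this is `a`, so the relations close up. -/
theorem contractForm_ι_mul (hB : (formBilin η).Nondegenerate)
    {u : ExteriorAlgebra ℝ (Dual ℝ V)} (hu : u ∈ extDeg (Dual ℝ V) 2)
    (a : Dual ℝ V) (x : ExteriorAlgebra ℝ (Dual ℝ V)) :
    contractForm (formBilin η) hB u (ExteriorAlgebra.ι ℝ a * x) =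
      ExteriorAlgebra.ι ℝ a * contractForm (formBilin η) hB u x +
        contractForm (formBilin η) hB (contract (sharp (formBilin η) hB a) u) x := by
  refine extDeg_two_induction (P := fun u =>
    contractForm (formBilin η) hB u (ExteriorAlgebra.ι ℝ a * x) =
      ExteriorAlgebra.ι ℝ a * contractForm (formBilin η) hB u x +
        contractForm (formBilin η) hB (contract (sharp (formBilin η) hB a) u) x)
    (fun b c => ?_) (fun u v hu hv => ?_) hu
  · rw [contract_ι_mul, contract_ι, ← Algebra.commutes, ← Algebra.smul_def,
      map_mul (contractForm (formBilin η) hB), map_sub, map_smul, map_smul]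
    simp only [contractForm_ι, Module.End.mul_apply, LinearMap.sub_apply, LinearMap.smul_apply,
      contract_ι_mul, map_sub, map_smul]
    rw [apply_sharp_swap hB a c, apply_sharp_swap hB a b]
    module
  · simp only [map_add, LinearMap.add_apply, hu, hv, mul_add]
    abel

/-- The operator `Λ` of a symplectic vector space. -/
def fibreLambda (η : ExteriorAlgebra ℝ (Dual ℝ V)) (hB : (formBilin η).Nondegenerate) :
    End ℝ (ExteriorAlgebra ℝ (Dual ℝ V)) :=
  contractForm (formBilin η) hB (CliffordAlgebra.reverse η)

theorem fibreLambda_eq (hη : η ∈ extDeg (Dual ℝ V) 2)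
    (hB : (formBilin η).Nondegenerate)
    : fibreLambda η hB = -contractForm (formBilin η) hB η := by
  rw [fibreLambda, reverse_of_deg_two hη, map_neg]

/-- With `fibreLambda_mul_contract`, `contract_sharp_mul` and `mulLeft_form_mul_ι`, this says that Λ
and L act by commutators on the span of a∧ and i_{♯a} as nilpotent 2×2 matrices. -/
theorem fibreLambda_mul_ι (hη : η ∈ extDeg (Dual ℝ V) 2)
    (hB : (formBilin η).Nondegenerate)
    (a : Dual ℝ V) :
    fibreLambda η hB * LinearMap.mulLeft ℝ (ExteriorAlgebra.ι ℝ a) =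
      LinearMap.mulLeft ℝ (ExteriorAlgebra.ι ℝ a) * fibreLambda η hB -
        contract (sharp (formBilin η) hB a) := by
  refine LinearMap.ext fun x => ?_
  rw [fibreLambda_eq hη]
  simp only [Module.End.mul_apply, LinearMap.mulLeft_apply, LinearMap.neg_apply,
    LinearMap.sub_apply, contractForm_ι_mul hB hη, contract_sharp_form hη, contractForm_ι, mul_neg]
  abel

/-- Both operators are contractions by forms, and they commute because η and the covector commute in
the exterior algebra. -/
theorem fibreLambda_mul_contract (hη : η ∈ extDeg (Dual ℝ V) 2)
    (hB : (formBilin η).Nondegenerate)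
    (a : Dual ℝ V) :
    fibreLambda η hB * contract (sharp (formBilin η) hB a) =
      contract (sharp (formBilin η) hB a) * fibreLambda η hB := by
  have h := congrArg (contractForm (formBilin η) hB) (deg_two_mul_comm hη a)
  rw [map_mul, map_mul, contractForm_ι] at h
  refine LinearMap.ext fun x => ?_
  have h1 := DFunLike.congr_fun h x
  simp only [Module.End.mul_apply] at h1
  simp only [fibreLambda_eq hη, Module.End.mul_apply, LinearMap.neg_apply, map_neg, h1]

theorem fibreLambda_one (hη : η ∈ extDeg (Dual ℝ V) 2)
    (hB : (formBilin η).Nondegenerate)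
    : fibreLambda η hB 1 = 0 := by
  rw [fibreLambda_eq hη, LinearMap.neg_apply, neg_eq_zero]
  refine extDeg_two_induction (P := fun u => contractForm (formBilin η) hB u 1 = 0)
    (fun b c => ?_) (fun u v hu hv => ?_) hη
  · rw [map_mul, Module.End.mul_apply, contractForm_ι, contractForm_ι, contract_one, map_zero]
  · rw [map_add, LinearMap.add_apply, hu, hv, add_zero]

theorem contract_sharp_mul (hη : η ∈ extDeg (Dual ℝ V) 2)
    (hB : (formBilin η).Nondegenerate)
    (a : Dual ℝ V) :
    contract (sharp (formBilin η) hB a) * LinearMap.mulLeft ℝ η =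
      LinearMap.mulLeft ℝ η * contract (sharp (formBilin η) hB a) +
        LinearMap.mulLeft ℝ (ExteriorAlgebra.ι ℝ a) := by
  refine LinearMap.ext fun x => ?_
  simp only [Module.End.mul_apply, LinearMap.mulLeft_apply, LinearMap.add_apply, contract_mul,
    contract_sharp_form hη, involute_of_deg_two hη]
  abel

theorem mulLeft_form_mul_ι (hη : η ∈ extDeg (Dual ℝ V) 2)
    (a : Dual ℝ V) :
    LinearMap.mulLeft ℝ η * LinearMap.mulLeft ℝ (ExteriorAlgebra.ι ℝ a) =
      LinearMap.mulLeft ℝ (ExteriorAlgebra.ι ℝ a) * LinearMap.mulLeft ℝ η := by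
  refine LinearMap.ext fun x => ?_
  simp only [Module.End.mul_apply, LinearMap.mulLeft_apply, ← mul_assoc, deg_two_mul_comm hη]

/-- The commutator `[Λ, L]`. -/
def fibreWeight (η : ExteriorAlgebra ℝ (Dual ℝ V)) (hB : (formBilin η).Nondegenerate) :
    End ℝ (ExteriorAlgebra ℝ (Dual ℝ V)) :=
  fibreLambda η hB * LinearMap.mulLeft ℝ η - LinearMap.mulLeft ℝ η * fibreLambda η hB

/-- Each covector lowers the weight by one. Together with the value at 1 this determines [Λ, L]
without a Darboux basis. -/
theorem fibreWeight_ι_mul (hη : η ∈ extDeg (Dual ℝ V) 2)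
    (hB : (formBilin η).Nondegenerate)
    (a : Dual ℝ V) (x : ExteriorAlgebra ℝ (Dual ℝ V)) :
    fibreWeight η hB (ExteriorAlgebra.ι ℝ a * x) =
      ExteriorAlgebra.ι ℝ a * fibreWeight η hB x - ExteriorAlgebra.ι ℝ a * x := by
  have h1 := fun y => DFunLike.congr_fun (fibreLambda_mul_ι hη hB a) y
  have h2 := fun y => DFunLike.congr_fun (contract_sharp_mul hη hB a) y
  have h3 := fun y => DFunLike.congr_fun (mulLeft_form_mul_ι hη a) y
  simp only [Module.End.mul_apply, LinearMap.mulLeft_apply, LinearMap.sub_apply,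
    LinearMap.add_apply] at h1 h2 h3
  simp only [fibreWeight, Module.End.mul_apply, LinearMap.mulLeft_apply, LinearMap.sub_apply,
    h3, h1, h2, mul_sub]
  abel

theorem fibreWeight_form_mul (hη : η ∈ extDeg (Dual ℝ V) 2)
    (hB : (formBilin η).Nondegenerate)
    (x : ExteriorAlgebra ℝ (Dual ℝ V)) :
    fibreWeight η hB (η * x) = η * fibreWeight η hB x - (2 : ℝ) • (η * x) := by
  refine extDeg_two_induction (P := fun u => fibreWeight η hB (u * x) =
    u * fibreWeight η hB x - (2 : ℝ) • (u * x)) (fun b c => ?_) (fun u v hu hv => ?_) hη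
  · rw [mul_assoc, fibreWeight_ι_mul hη, fibreWeight_ι_mul hη, mul_sub, mul_assoc, two_smul]
    abel
  · rw [add_mul, map_add, hu, hv, add_mul, smul_add]
    abel

/-- Euler's formula writes 2η as a sum of εⁱ ∧ i_{eᵢ} η over a basis, and Λ maps each summand to 1.
-/
theorem fibreLambda_form (hη : η ∈ extDeg (Dual ℝ V) 2)
    (hB : (formBilin η).Nondegenerate)
    :
    fibreLambda η hB η = ((finrank ℝ V : ℝ) / 2) • (1 : ExteriorAlgebra ℝ (Dual ℝ V)) := by
  have h1 := fun a x => DFunLike.congr_fun (fibreLambda_mul_ι hη hB a) x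
  simp only [Module.End.mul_apply, LinearMap.mulLeft_apply, LinearMap.sub_apply] at h1
  have h2 : ∀ a, fibreLambda η hB (ExteriorAlgebra.ι ℝ a) = 0 := by
    intro a
    have := h1 a 1
    rwa [fibreLambda_one hη, contract_one, mul_zero, sub_zero, mul_one] at this
  have h3 : ∀ i, fibreLambda η hB (ExteriorAlgebra.ι ℝ ((finBasis ℝ V).coord i) *
      contract (finBasis ℝ V i) η) = 1 := by
    intro i
    rw [contract_eq_ι_formBilin hη, h1, h2, mul_zero, contract_ι, formBilin_swap, apply_sharp]
    simp
  have h4 := congrArg (fibreLambda η hB) (sum_ι_mul_contract (finBasis ℝ V) (k := 2) hη)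
  simp only [map_sum, h3, map_smul] at h4
  rw [div_eq_inv_mul, mul_smul, eq_inv_smul_iff₀ two_ne_zero]
  have h5 : ((2 : ℕ) : ℝ) = 2 := by norm_num
  rw [h5] at h4
  rw [← h4]
  simp [Algebra.smul_def]

theorem fibreWeight_pow (hη : η ∈ extDeg (Dual ℝ V) 2)
    (hB : (formBilin η).Nondegenerate)
    (m : ℕ) :
    fibreWeight η hB (η ^ m) = ((finrank ℝ V : ℝ) / 2 - 2 * m) • η ^ m := by
  induction m with
  | zero =>
    simp only [fibreWeight, LinearMap.sub_apply, Module.End.mul_apply, LinearMap.mulLeft_apply,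
      pow_zero, mul_one, fibreLambda_one hη, fibreLambda_form hη, mul_zero, sub_zero]
    simp
  | succ m ih =>
    rw [pow_succ', fibreWeight_form_mul hη, ih, mul_smul_comm]
    push_cast
    module

/-- Moving Λ to the right collects the weights dim V / 2 - 2i for i ≤ m, and Λ kills 1; the
coefficient is their sum. -/
theorem fibreLambda_pow_succ (hη : η ∈ extDeg (Dual ℝ V) 2)
    (hB : (formBilin η).Nondegenerate)
    (m : ℕ) :
    fibreLambda η hB (η ^ (m + 1)) =
      (((m : ℝ) + 1) * ((finrank ℝ V : ℝ) / 2 - m)) • η ^ m := by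
  have h : ∀ x, fibreLambda η hB (η * x) = η * fibreLambda η hB x + fibreWeight η hB x := by
    intro x
    simp [fibreWeight]
  induction m with
  | zero => simp [fibreLambda_form hη]
  | succ m ih =>
    rw [pow_succ', h, ih, fibreWeight_pow hη, mul_smul_comm, ← pow_succ']
    push_cast
    module

theorem pow_mem_extDeg (hη : η ∈ extDeg (Dual ℝ V) 2)
    (m : ℕ) : η ^ m ∈ extDeg (Dual ℝ V) (2 * m : ℤ) := by
  induction m with
  | zero => simpa using one_mem_extDeg (W := Dual ℝ V)
  | succ m ih =>
    have := mul_mem_extDeg hη ih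
    rw [pow_succ']
    convert this using 1
    push_cast
    ring_nf

theorem pow_eq_zero_of_lt (hη : η ∈ extDeg (Dual ℝ V) 2)
    {m : ℕ} (hm : finrank ℝ V < 2 * m) : η ^ m = 0 := by
  have h := pow_mem_extDeg hη m
  rw [extDeg_eq_bot (by rw [Subspace.dual_finrank_eq]; exact_mod_cast hm)] at h
  exact (Submodule.mem_bot ℝ).1 h

/-- A symplectic vector space has even dimension. -/
theorem two_mul_finrank_div_two (hη : η ∈ extDeg (Dual ℝ V) 2)
    (hB : (formBilin η).Nondegenerate) :
    2 * (finrank ℝ V / 2) = finrank ℝ V := by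
  classical
  have hex : ∃ m, η ^ (m + 1) = 0 := ⟨finrank ℝ V, pow_eq_zero_of_lt hη (by omega)⟩
  -- Let ηᵐ be the last nonzero power. Applying Λ to η^{m+1} = 0 gives a multiple of ηᵐ whose
  -- coefficient can vanish only if dim V = 2m.
  have h1 := fibreLambda_pow_succ hη hB (Nat.find hex)
  rw [Nat.find_spec hex, map_zero] at h1
  have h2 : η ^ Nat.find hex ≠ 0 := by
    rcases Nat.eq_zero_or_pos (Nat.find hex) with h | h
    · rw [h, pow_zero]
      exact one_ne_zero
    · have := Nat.find_min hex (Nat.sub_lt h one_pos)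
      rwa [Nat.sub_one_add_one h.ne'] at this
  have h3 := (smul_eq_zero.1 h1.symm).resolve_right h2
  have h4 : (finrank ℝ V : ℝ) = 2 * (Nat.find hex : ℝ) := by
    have : ((Nat.find hex : ℝ) + 1) ≠ 0 := by positivity
    have := (mul_eq_zero.1 h3).resolve_left this
    linarith
  have h5 : finrank ℝ V = 2 * Nat.find hex := by exact_mod_cast h4
  omega

/-- The divided power `ηᵐ / m!`. -/
def divPow (η : ExteriorAlgebra ℝ (Dual ℝ V)) (m : ℕ) : ExteriorAlgebra ℝ (Dual ℝ V) :=
  ((m.factorial : ℝ)⁻¹) • η ^ m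

theorem fibreLambda_divPow (hη : η ∈ extDeg (Dual ℝ V) 2)
    (hB : (formBilin η).Nondegenerate)
    (m : ℕ) : fibreLambda η hB (divPow η (m + 1)) =
    ((finrank ℝ V / 2 : ℕ) - m : ℝ) • divPow η m := by
  have h : ((finrank ℝ V / 2 : ℕ) : ℝ) = (finrank ℝ V : ℝ) / 2 := by
    conv_rhs => rw [← two_mul_finrank_div_two hη hB]
    push_cast
    ring
  rw [divPow, map_smul, fibreLambda_pow_succ hη, smul_smul, h, divPow, smul_smul,
    Nat.factorial_succ]
  congr 1
  have : (m : ℝ) + 1 ≠ 0 := by positivity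
  have : (m.factorial : ℝ) ≠ 0 := by positivity
  push_cast
  field_simp

/-- Starting from the top divided power, the i-th application of Λ contributes the factor i, so i!
appears exactly. -/
theorem fibreLambda_pow_divPow (hη : η ∈ extDeg (Dual ℝ V) 2)
    (hB : (formBilin η).Nondegenerate)
    (i : ℕ) (hi : i ≤ finrank ℝ V / 2) :
    ((i.factorial : ℝ)⁻¹) • (fibreLambda η hB ^ i) (divPow η (finrank ℝ V / 2)) =
      divPow η (finrank ℝ V / 2 - i) := by
  induction i with
  | zero => simp
  | succ i ih =>
    obtain ⟨m, hm⟩ := Nat.exists_eq_add_of_le hi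
    have h := ih (by omega)
    have h1 : finrank ℝ V / 2 - i = m + 1 := by omega
    have h2 : finrank ℝ V / 2 - (i + 1) = m := by omega
    rw [h1, inv_smul_eq_iff₀ (by positivity)] at h
    rw [pow_succ', Module.End.mul_apply, h, map_smul, fibreLambda_divPow hη, h2, smul_smul,
      smul_smul, Nat.factorial_succ, hm]
    have h3 : (i.factorial : ℝ) ≠ 0 := by positivity
    have h4 : ((i : ℝ) + 1) ≠ 0 := by positivity
    conv_rhs => rw [← one_smul ℝ (divPow η m)]
    congr 1
    push_cast
    field_simp
    ring

theorem fibreLambda_pow_divPow_of_lt (hη : η ∈ extDeg (Dual ℝ V) 2)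
    (hB : (formBilin η).Nondegenerate)
    (i : ℕ) (hi : finrank ℝ V / 2 < i) :
    (fibreLambda η hB ^ i) (divPow η (finrank ℝ V / 2)) = 0 := by
  have h := fibreLambda_pow_divPow hη hB _ le_rfl
  rw [Nat.sub_self, inv_smul_eq_iff₀ (by positivity)] at h
  obtain ⟨m, rfl⟩ := Nat.exists_eq_add_of_lt hi
  rw [show finrank ℝ V / 2 + m + 1 = m + 1 + finrank ℝ V / 2 by ring, pow_add,
    Module.End.mul_apply, h, map_smul, pow_succ, Module.End.mul_apply, divPow, pow_zero, map_smul,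
    fibreLambda_one hη, smul_zero, map_zero, smul_zero]

end SymplecticFibre

/-! ### The symplectic star on a symplectic vector space -/

section FibreStar

variable {V : Type*} [AddCommGroup V] [Module ℝ V]

/-- The reversal of exterior forms, as a linear map. -/
def revEnd (W : Type*) [AddCommGroup W] [Module ℝ W] : End ℝ (ExteriorAlgebra ℝ W) :=
  CliffordAlgebra.reverse

/-- The parity operator on exterior forms, as a linear map. -/
def parEnd (W : Type*) [AddCommGroup W] [Module ℝ W] : End ℝ (ExteriorAlgebra ℝ W) :=
  CliffordAlgebra.involute.toLinearMap

theorem revEnd_apply {W : Type*} [AddCommGroup W] [Module ℝ W] (u : ExteriorAlgebra ℝ W) :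
    revEnd W u = CliffordAlgebra.reverse u := rfl

theorem parEnd_apply {W : Type*} [AddCommGroup W] [Module ℝ W] (u : ExteriorAlgebra ℝ W) :
    parEnd W u = CliffordAlgebra.involute u := rfl

theorem reverse_involute {W : Type*} [AddCommGroup W] [Module ℝ W] (u : ExteriorAlgebra ℝ W) :
    CliffordAlgebra.reverse (CliffordAlgebra.involute u) =
      CliffordAlgebra.involute (CliffordAlgebra.reverse u) :=
  CliffordAlgebra.reverse_involute u

theorem reverse_contract (v : V) (u : ExteriorAlgebra ℝ (Dual ℝ V)) :
    CliffordAlgebra.reverse (contract v u) =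
      -contract v (CliffordAlgebra.involute (CliffordAlgebra.reverse u)) := by
  refine ext_left_induction (P := fun u => CliffordAlgebra.reverse (contract v u) =
      -contract v (CliffordAlgebra.involute (CliffordAlgebra.reverse u))) ?_
    (fun u u' hu hu' => ?_) (fun r u hu => ?_) (fun θ u hu => ?_) u
  · simp [contract_one]
  · simp only [map_add, hu, hu', neg_add]
  · simp only [map_smul, hu, smul_neg]
  · rw [contract_ι_mul, map_sub, map_smul, reverse_ι_mul, hu, reverse_ι_mul, map_mul,
      involute_involute, involute_ι, contract_involute, neg_neg, involute_involute, neg_mul, map_neg,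
      contract_ι_mul, neg_neg]

variable [FiniteDimensional ℝ V] {η : ExteriorAlgebra ℝ (Dual ℝ V)}

theorem contractForm_involute (B : LinearMap.BilinForm ℝ V) (hB : B.Nondegenerate)
    {u : ExteriorAlgebra ℝ (Dual ℝ V)} (hu : u ∈ extDeg (Dual ℝ V) 2)
    (x : ExteriorAlgebra ℝ (Dual ℝ V)) :
    contractForm B hB u (CliffordAlgebra.involute x) =
      CliffordAlgebra.involute (contractForm B hB u x) := by
  refine extDeg_two_induction (P := fun u => contractForm B hB u (CliffordAlgebra.involute x) =
      CliffordAlgebra.involute (contractForm B hB u x)) (fun a b => ?_) (fun u v hu hv => ?_) hu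
  · rw [map_mul (contractForm B hB), contractForm_ι, contractForm_ι, Module.End.mul_apply,
      Module.End.mul_apply, contract_involute, map_neg, contract_involute, neg_neg]
  · rw [map_add, LinearMap.add_apply, hu, hv, LinearMap.add_apply, map_add]

/-- The Weyl element `e^{-L} e^{Λ} e^{-L}`. -/
def fibreWeyl (N : ℕ) (η : ExteriorAlgebra ℝ (Dual ℝ V)) (hB : (formBilin η).Nondegenerate) :
    End ℝ (ExteriorAlgebra ℝ (Dual ℝ V)) :=
  nilExp N (-LinearMap.mulLeft ℝ η) * nilExp N (fibreLambda η hB) *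
    nilExp N (-LinearMap.mulLeft ℝ η)

/-- The symplectic star of a symplectic vector space. -/
def fibreStar (N : ℕ) (η : ExteriorAlgebra ℝ (Dual ℝ V)) (hB : (formBilin η).Nondegenerate) :
    End ℝ (ExteriorAlgebra ℝ (Dual ℝ V)) :=
  ((-1 : ℝ) ^ (finrank ℝ V / 2)) • (fibreWeyl N η hB * revEnd (Dual ℝ V))

theorem mulLeft_form_pow {N : ℕ} (hN : finrank ℝ V < N) (hη : η ∈ extDeg (Dual ℝ V) 2) :
    LinearMap.mulLeft ℝ η ^ N = 0 := by
  rw [LinearMap.pow_mulLeft, pow_eq_zero_of_lt hη (by omega), LinearMap.mulLeft_zero_eq_zero]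

theorem reverse_pow (u : ExteriorAlgebra ℝ (Dual ℝ V)) (m : ℕ) :
    CliffordAlgebra.reverse (u ^ m) = CliffordAlgebra.reverse u ^ m := by
  induction m with
  | zero => simp
  | succ m ih => rw [pow_succ, CliffordAlgebra.reverse.map_mul, ih, pow_succ']

theorem fibreLambda_pow {N : ℕ} (hN : finrank ℝ V < N) (hη : η ∈ extDeg (Dual ℝ V) 2)
    (hB : (formBilin η).Nondegenerate) : fibreLambda η hB ^ N = 0 := by
  rw [fibreLambda, ← map_pow, ← reverse_pow, pow_eq_zero_of_lt hη (by omega), map_zero, map_zero]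

/-! ### The Weyl element and the star exchange wedges and contractions -/

variable {N : ℕ}

theorem nilExp_neg_mulLeft_mul_ι (hη : η ∈ extDeg (Dual ℝ V) 2)
    (a : Dual ℝ V) :
    nilExp N (-LinearMap.mulLeft ℝ η) * LinearMap.mulLeft ℝ (ExteriorAlgebra.ι ℝ a) =
      LinearMap.mulLeft ℝ (ExteriorAlgebra.ι ℝ a) * nilExp N (-LinearMap.mulLeft ℝ η) := by
  have h : Commute (LinearMap.mulLeft ℝ η) (LinearMap.mulLeft ℝ (ExteriorAlgebra.ι ℝ a)) :=
    mulLeft_form_mul_ι hη a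
  exact nilExp_commute h.neg_left

theorem nilExp_neg_mulLeft_mul_contract (hN : finrank ℝ V < N) (hη : η ∈ extDeg (Dual ℝ V) 2)
    (hB : (formBilin η).Nondegenerate)
    (a : Dual ℝ V) :
    nilExp N (-LinearMap.mulLeft ℝ η) * contract (sharp (formBilin η) hB a) =
      (contract (sharp (formBilin η) hB a) + LinearMap.mulLeft ℝ (ExteriorAlgebra.ι ℝ a)) *
        nilExp N (-LinearMap.mulLeft ℝ η) := by
  exact nilExp_neg_mul_of_commutator (mulLeft_form_pow hN hη) (contract_sharp_mul hη hB a)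
    (mulLeft_form_mul_ι hη a)

theorem nilExp_fibreLambda_mul_ι (hN : finrank ℝ V < N) (hη : η ∈ extDeg (Dual ℝ V) 2)
    (hB : (formBilin η).Nondegenerate)
    (a : Dual ℝ V) :
    nilExp N (fibreLambda η hB) * LinearMap.mulLeft ℝ (ExteriorAlgebra.ι ℝ a) =
      (LinearMap.mulLeft ℝ (ExteriorAlgebra.ι ℝ a) - contract (sharp (formBilin η) hB a)) *
        nilExp N (fibreLambda η hB) := by
  have h1 := fibreLambda_mul_ι hη hB a
  have h2 : Commute (fibreLambda η hB) (contract (sharp (formBilin η) hB a)) :=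
    fibreLambda_mul_contract hη hB a
  rw [sub_eq_add_neg] at h1 ⊢
  exact nilExp_mul (fibreLambda_pow hN hη hB) h1 h2.neg_right

theorem nilExp_fibreLambda_mul_contract (hη : η ∈ extDeg (Dual ℝ V) 2)
    (hB : (formBilin η).Nondegenerate)
    (a : Dual ℝ V) :
    nilExp N (fibreLambda η hB) * contract (sharp (formBilin η) hB a) =
      contract (sharp (formBilin η) hB a) * nilExp N (fibreLambda η hB) :=
  nilExp_commute (fibreLambda_mul_contract hη hB a)

theorem fibreWeyl_mul_ι (hN : finrank ℝ V < N) (hη : η ∈ extDeg (Dual ℝ V) 2)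
    (hB : (formBilin η).Nondegenerate)
    (a : Dual ℝ V) :
    fibreWeyl N η hB * LinearMap.mulLeft ℝ (ExteriorAlgebra.ι ℝ a) =
      -(contract (sharp (formBilin η) hB a) * fibreWeyl N η hB) := by
  exact weyl_mul_raise (nilExp_neg_mulLeft_mul_ι hη a) (nilExp_neg_mulLeft_mul_contract hN hη hB a)
    (nilExp_fibreLambda_mul_ι hN hη hB a)

theorem fibreWeyl_mul_contract (hN : finrank ℝ V < N) (hη : η ∈ extDeg (Dual ℝ V) 2)
    (hB : (formBilin η).Nondegenerate)
    (a : Dual ℝ V) :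
    fibreWeyl N η hB * contract (sharp (formBilin η) hB a) =
      LinearMap.mulLeft ℝ (ExteriorAlgebra.ι ℝ a) * fibreWeyl N η hB := by
  exact weyl_mul_lower (nilExp_neg_mulLeft_mul_ι hη a) (nilExp_neg_mulLeft_mul_contract hN hη hB a)
    (nilExp_fibreLambda_mul_ι hN hη hB a) (nilExp_fibreLambda_mul_contract hη hB a)

theorem fibreWeyl_mul_par (hη : η ∈ extDeg (Dual ℝ V) 2)
    (hB : (formBilin η).Nondegenerate) :
    fibreWeyl N η hB * parEnd (Dual ℝ V) = parEnd (Dual ℝ V) * fibreWeyl N η hB := by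
  have h1 : (-LinearMap.mulLeft ℝ η) * parEnd (Dual ℝ V) =
      parEnd (Dual ℝ V) * (-LinearMap.mulLeft ℝ η) := by
    refine LinearMap.ext fun x => ?_
    simp only [Module.End.mul_apply, LinearMap.neg_apply, LinearMap.mulLeft_apply, parEnd_apply,
      map_neg, map_mul, involute_of_deg_two hη]
  have h2 : fibreLambda η hB * parEnd (Dual ℝ V) = parEnd (Dual ℝ V) * fibreLambda η hB := by
    refine LinearMap.ext fun x => ?_
    simp only [Module.End.mul_apply, fibreLambda, parEnd_apply]
    exact contractForm_involute _ hB (reverse_mem_extDeg hη) x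
  have h3 := nilExp_commute (N := N) h1
  have h4 := nilExp_commute (N := N) h2
  rw [fibreWeyl]
  generalize parEnd (Dual ℝ V) = p at *
  generalize nilExp N (fibreLambda η hB) = x at *
  generalize nilExp N (-LinearMap.mulLeft ℝ η) = y at *
  rw [mul_assoc, h3, ← mul_assoc, mul_assoc y, h4, ← mul_assoc, h3]
  noncomm_ring

theorem fibreStar_par (hη : η ∈ extDeg (Dual ℝ V) 2)
    (hB : (formBilin η).Nondegenerate)
    (x : ExteriorAlgebra ℝ (Dual ℝ V)) :
    fibreStar N η hB (CliffordAlgebra.involute x) =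
      CliffordAlgebra.involute (fibreStar N η hB x) := by
  have h := DFunLike.congr_fun (fibreWeyl_mul_par (N := N) hη hB) (CliffordAlgebra.reverse x)
  simp only [Module.End.mul_apply, parEnd_apply] at h
  simp only [fibreStar, LinearMap.smul_apply, Module.End.mul_apply, revEnd_apply, reverse_involute,
    h, map_smul]

/-- Reversal preserves the left factor up to parity and the Weyl element turns it into a
contraction. Together with the value at 1 this rule determines the star. -/
theorem fibreStar_ι_mul (hN : finrank ℝ V < N) (hη : η ∈ extDeg (Dual ℝ V) 2)
    (hB : (formBilin η).Nondegenerate)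
    (a : Dual ℝ V) (x : ExteriorAlgebra ℝ (Dual ℝ V)) :
    fibreStar N η hB (ExteriorAlgebra.ι ℝ a * x) =
      -contract (sharp (formBilin η) hB a) (fibreStar N η hB (CliffordAlgebra.involute x)) := by
  have h := DFunLike.congr_fun (fibreWeyl_mul_ι hN hη hB a)
    (CliffordAlgebra.involute (CliffordAlgebra.reverse x))
  simp only [Module.End.mul_apply, LinearMap.mulLeft_apply, LinearMap.neg_apply] at h
  simp only [fibreStar, LinearMap.smul_apply, Module.End.mul_apply, revEnd_apply, reverse_involute,
    reverse_ι_mul, h, map_smul, smul_neg]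

theorem fibreStar_contract (hN : finrank ℝ V < N) (hη : η ∈ extDeg (Dual ℝ V) 2)
    (hB : (formBilin η).Nondegenerate)
    (a : Dual ℝ V) (x : ExteriorAlgebra ℝ (Dual ℝ V)) :
    fibreStar N η hB (contract (sharp (formBilin η) hB a) x) =
      -(ExteriorAlgebra.ι ℝ a * fibreStar N η hB (CliffordAlgebra.involute x)) := by
  have h := DFunLike.congr_fun (fibreWeyl_mul_contract hN hη hB a)
    (CliffordAlgebra.involute (CliffordAlgebra.reverse x))
  simp only [Module.End.mul_apply, LinearMap.mulLeft_apply] at h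
  simp only [fibreStar, LinearMap.smul_apply, Module.End.mul_apply, revEnd_apply, reverse_involute,
    reverse_contract, map_neg, h, smul_neg, mul_smul_comm]

/-! ### Values of the star at 1 and at the volume form -/

theorem divPow_eq_zero (hη : η ∈ extDeg (Dual ℝ V) 2)
    {m : ℕ} (hm : finrank ℝ V / 2 < m) : divPow η m = 0 := by
  rw [divPow, pow_eq_zero_of_lt hη (by omega), smul_zero]

theorem nilExp_neg_mulLeft_divPow (hN : finrank ℝ V < N) (hη : η ∈ extDeg (Dual ℝ V) 2) :
    nilExp N (-LinearMap.mulLeft ℝ η) (divPow η (finrank ℝ V / 2)) =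
      divPow η (finrank ℝ V / 2) := by
  obtain ⟨K, rfl⟩ : ∃ K, N = K + 1 := ⟨N - 1, by omega⟩
  rw [nilExp, Finset.sum_range_succ', LinearMap.add_apply, LinearMap.sum_apply,
    Finset.sum_eq_zero, zero_add]
  · simp
  · intro i _
    rw [LinearMap.smul_apply, pow_succ, Module.End.mul_apply, LinearMap.neg_apply,
      LinearMap.mulLeft_apply, divPow, mul_smul_comm, ← pow_succ', pow_eq_zero_of_lt hη (by omega)]
    simp

/-- The scalar `s` allows e^L and e^{-L} to be treated together, with s = 1 and s = -1. -/
theorem nilExp_mulLeft_one (hN : finrank ℝ V < N) (hη : η ∈ extDeg (Dual ℝ V) 2)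
    (s : ℝ) : nilExp N (s • LinearMap.mulLeft ℝ η) 1 =
    ∑ i ∈ Finset.range (finrank ℝ V / 2 + 1), s ^ i • divPow η i := by
  rw [nilExp, LinearMap.sum_apply]
  have h : ∀ i, (((i.factorial : ℝ)⁻¹) • (s • LinearMap.mulLeft ℝ η) ^ i) 1 =
      s ^ i • divPow η i := by
    intro i
    rw [smul_pow, LinearMap.smul_apply, LinearMap.smul_apply, LinearMap.pow_mulLeft,
      LinearMap.mulLeft_apply, mul_one, divPow, smul_comm]
  have h' : ∀ i ∈ Finset.range N, i ∉ Finset.range (finrank ℝ V / 2 + 1) →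
      s ^ i • divPow η i = 0 := fun i _ hi => by
    rw [divPow_eq_zero hη (by simpa using hi), smul_zero]
  rw [Finset.sum_congr rfl fun i _ => h i,
    ← Finset.sum_subset (Finset.range_mono (show finrank ℝ V / 2 + 1 ≤ N by omega)) h']

theorem nilExp_fibreLambda_divPow (hN : finrank ℝ V < N) (hη : η ∈ extDeg (Dual ℝ V) 2)
    (hB : (formBilin η).Nondegenerate)
    (s : ℝ) :
    nilExp N (s • fibreLambda η hB) (divPow η (finrank ℝ V / 2)) =
      ∑ i ∈ Finset.range (finrank ℝ V / 2 + 1), s ^ i • divPow η (finrank ℝ V / 2 - i) := by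
  rw [nilExp, LinearMap.sum_apply]
  have h : ∀ i, (((i.factorial : ℝ)⁻¹) • (s • fibreLambda η hB) ^ i)
      (divPow η (finrank ℝ V / 2)) = s ^ i • (((i.factorial : ℝ)⁻¹) •
        (fibreLambda η hB ^ i) (divPow η (finrank ℝ V / 2))) := by
    intro i
    rw [smul_pow, LinearMap.smul_apply, LinearMap.smul_apply, smul_comm]
  have h' : ∀ i ∈ Finset.range N, i ∉ Finset.range (finrank ℝ V / 2 + 1) →
      s ^ i • (((i.factorial : ℝ)⁻¹) • (fibreLambda η hB ^ i) (divPow η (finrank ℝ V / 2))) = 0 :=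
    fun i _ hi => by
      rw [fibreLambda_pow_divPow_of_lt hη hB i (by simpa using hi), smul_zero, smul_zero]
  rw [Finset.sum_congr rfl fun i _ => h i,
    ← Finset.sum_subset (Finset.range_mono (show finrank ℝ V / 2 + 1 ≤ N by omega)) h']
  refine Finset.sum_congr rfl fun i hi => ?_
  rw [fibreLambda_pow_divPow hη hB i (Nat.lt_succ_iff.1 (Finset.mem_range.1 hi))]

/-- Λ lowers the top divided power through all divided powers with coefficient 1, while L raises 1
through the same list in the opposite order. -/
theorem nilExp_fibreLambda_divPow_eq (hN : finrank ℝ V < N) (hη : η ∈ extDeg (Dual ℝ V) 2)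
    (hB : (formBilin η).Nondegenerate) :
    nilExp N (fibreLambda η hB) (divPow η (finrank ℝ V / 2)) =
      nilExp N (LinearMap.mulLeft ℝ η) 1 := by
  have h1 := nilExp_fibreLambda_divPow hN hη hB 1
  have h2 := nilExp_mulLeft_one hN hη 1
  simp only [one_smul, one_pow] at h1 h2
  rw [h1, h2]
  exact Finset.sum_flip (fun i => divPow η i)

theorem nilExp_neg_fibreLambda_divPow_eq (hN : finrank ℝ V < N) (hη : η ∈ extDeg (Dual ℝ V) 2)
    (hB : (formBilin η).Nondegenerate) :
    nilExp N (-fibreLambda η hB) (divPow η (finrank ℝ V / 2)) =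
      (-1 : ℝ) ^ (finrank ℝ V / 2) • nilExp N (-LinearMap.mulLeft ℝ η) 1 := by
  have h1 := nilExp_fibreLambda_divPow hN hη hB (-1)
  have h2 := nilExp_mulLeft_one hN hη (-1)
  have h3 : (-1 : ℝ) • fibreLambda η hB = -fibreLambda η hB := by
    exact neg_one_smul ℝ (fibreLambda η hB)
  have h4 : (-1 : ℝ) • LinearMap.mulLeft ℝ η = -LinearMap.mulLeft ℝ η :=
    neg_one_smul ℝ (LinearMap.mulLeft ℝ η)
  rw [h3] at h1
  rw [h4] at h2
  rw [h1, h2, ← Finset.sum_flip (fun i => (-1 : ℝ) ^ i • divPow η i), Finset.smul_sum]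
  refine Finset.sum_congr rfl fun i hi => ?_
  obtain ⟨m, hm⟩ := Nat.exists_eq_add_of_le (Nat.lt_succ_iff.1 (Finset.mem_range.1 hi))
  rw [hm, Nat.add_sub_cancel_left, smul_smul, pow_add, mul_assoc, ← mul_pow]
  simp

/-- By the preceding lemma e^Λ e^{-L} 1 is (-1)^n times the volume form, which e^{-L} fixes for
degree reasons. The sign in `fibreStar` compensates for this. -/
theorem fibreStar_one (hN : finrank ℝ V < N) (hη : η ∈ extDeg (Dual ℝ V) 2)
    (hB : (formBilin η).Nondegenerate)
    : fibreStar N η hB 1 = divPow η (finrank ℝ V / 2) := by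
  have h1 := congrArg (fun x => nilExp N (fibreLambda η hB) x)
    (nilExp_neg_fibreLambda_divPow_eq hN hη hB)
  simp only [← Module.End.mul_apply, nilExp_mul_neg (fibreLambda_pow hN hη hB),
    Module.End.one_apply, map_smul] at h1
  have h2 := nilExp_neg_mulLeft_divPow hN hη
  simp only [fibreStar, fibreWeyl, LinearMap.smul_apply, Module.End.mul_apply, revEnd_apply,
    CliffordAlgebra.reverse.map_one]
  rw [Module.End.mul_apply] at h1
  rw [← map_smul, ← h1, h2]

theorem fibreStar_divPow (hN : finrank ℝ V < N) (hη : η ∈ extDeg (Dual ℝ V) 2)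
    (hB : (formBilin η).Nondegenerate)
    : fibreStar N η hB (divPow η (finrank ℝ V / 2)) = 1 := by
  have h1 : CliffordAlgebra.reverse (divPow η (finrank ℝ V / 2)) =
      (-1 : ℝ) ^ (finrank ℝ V / 2) • divPow η (finrank ℝ V / 2) := by
    rw [divPow, map_smul, reverse_pow, reverse_of_deg_two hη, smul_comm, neg_pow, ← smul_mul_assoc]
    have : (-1 : ExteriorAlgebra ℝ (Dual ℝ V)) ^ (finrank ℝ V / 2) =
        algebraMap ℝ _ ((-1) ^ (finrank ℝ V / 2)) := by simp
    rw [this, smul_mul_assoc, ← Algebra.smul_def]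
  have h2 := nilExp_neg_mul (mulLeft_form_pow hN hη)
  simp only [fibreStar, fibreWeyl, LinearMap.smul_apply, Module.End.mul_apply, revEnd_apply, h1,
    map_smul, smul_smul, nilExp_neg_mulLeft_divPow hN hη, nilExp_fibreLambda_divPow_eq hN hη hB]
  rw [← mul_pow, neg_one_mul, neg_neg, one_pow, one_smul]
  exact DFunLike.congr_fun h2 1

/-- The symplectic star is an involution. -/
theorem fibreStar_fibreStar (hN : finrank ℝ V < N) (hη : η ∈ extDeg (Dual ℝ V) 2)
    (hB : (formBilin η).Nondegenerate)
    (x : ExteriorAlgebra ℝ (Dual ℝ V)) :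
    fibreStar N η hB (fibreStar N η hB x) = x := by
  have h : fibreStar N η hB ∘ₗ fibreStar N η hB = LinearMap.id := by
    -- The square of the star fixes 1 and commutes with wedging by a covector: the star turns the
    -- wedge into a contraction and back, with the signs cancelling.
    refine end_ext_of_ι_mul ?_ fun θ u hu => ?_
    · rw [LinearMap.comp_apply, fibreStar_one hN hη, fibreStar_divPow hN hη, LinearMap.id_apply]
    · rw [LinearMap.comp_apply, LinearMap.id_apply] at *
      rw [fibreStar_ι_mul hN hη, map_neg, fibreStar_contract hN hη, neg_neg, fibreStar_par hη,
        fibreStar_par hη, fibreStar_par hη, involute_involute, hu]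
  exact DFunLike.congr_fun h x

theorem fibreStar_mem_extDeg (hN : finrank ℝ V < N) (hη : η ∈ extDeg (Dual ℝ V) 2)
    (hB : (formBilin η).Nondegenerate)
    {k : ℤ} {u : ExteriorAlgebra ℝ (Dual ℝ V)}
    (hu : u ∈ extDeg (Dual ℝ V) k) :
    fibreStar N η hB u ∈ extDeg (Dual ℝ V) (2 * ((finrank ℝ V / 2 : ℕ) : ℤ) - k) := by
  cases k with
  | negSucc k => rw [(Submodule.mem_bot ℝ).1 hu, map_zero]; exact zero_mem _
  | ofNat k =>
    change u ∈ extDeg _ (k : ℤ) at hu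
    change _ ∈ extDeg _ (_ - (k : ℤ))
    induction k generalizing u with
    | zero =>
      obtain ⟨r, rfl⟩ := mem_extDeg_zero hu
      rw [Algebra.algebraMap_eq_smul_one, map_smul, fibreStar_one hN hη, divPow, Nat.cast_zero,
        sub_zero]
      exact Submodule.smul_mem _ _ (Submodule.smul_mem _ _ (pow_mem_extDeg hη _))
    | succ k ih =>
      refine extDeg_succ_induction (P := fun u => fibreStar N η hB u ∈ extDeg _
        (2 * ((finrank ℝ V / 2 : ℕ) : ℤ) - ((k + 1 : ℕ) : ℤ)))
        (fun θ u hu => ?_) (fun u v hu hv => by rw [map_add]; exact add_mem hu hv) hu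
      rw [fibreStar_ι_mul hN hη]
      have := neg_mem (contract_mem_extDeg (sharp (formBilin η) hB θ) (ih (involute_mem_extDeg hu)))
      push_cast
      rwa [← sub_sub]

/-- Induction on the degree: in the pairing a covector of `α` becomes a contraction of `β`, which
the star turns back into a wedge. The parity sign of `β` in that rule absorbs the one from moving
the covector across the rest of `α`. -/
theorem mul_fibreStar (hN : finrank ℝ V < N) (hη : η ∈ extDeg (Dual ℝ V) 2)
    (hB : (formBilin η).Nondegenerate)
    {k : ℤ} {α β : ExteriorAlgebra ℝ (Dual ℝ V)}
    (hα : α ∈ extDeg (Dual ℝ V) k) (hβ : β ∈ extDeg (Dual ℝ V) k) :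
    α * fibreStar N η hB β =
      extPairing (formBilin η) hB α β • divPow η (finrank ℝ V / 2) := by
  cases k with
  | negSucc k =>
    rw [(Submodule.mem_bot ℝ).1 hα, map_zero, LinearMap.zero_apply, zero_smul, zero_mul]
  | ofNat k =>
    change α ∈ extDeg _ (k : ℤ) at hα
    change β ∈ extDeg _ (k : ℤ) at hβ
    induction k generalizing α β with
    | zero =>
      obtain ⟨r, rfl⟩ := mem_extDeg_zero hα
      obtain ⟨s, rfl⟩ := mem_extDeg_zero hβ
      rw [Algebra.algebraMap_eq_smul_one r, map_smul, LinearMap.smul_apply, extPairing_one,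
        ExteriorAlgebra.algebraMap_leftInverse, Algebra.algebraMap_eq_smul_one s, map_smul,
        fibreStar_one hN hη, smul_mul_assoc, one_mul, smul_smul, smul_eq_mul]
    | succ k ih =>
      refine extDeg_succ_induction (P := fun α => α * fibreStar N η hB β =
        extPairing (formBilin η) hB α β • divPow η (finrank ℝ V / 2)) (fun θ u hu => ?_)
        (fun u v hu hv => by rw [add_mul, map_add, LinearMap.add_apply, hu, hv, add_smul]) hα
      have h1 := contract_mem_extDeg (sharp (formBilin η) hB θ) hβ
      push_cast at h1
      rw [add_sub_cancel_right] at h1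
      rw [extPairing_ι_mul, ← ih hu h1, fibreStar_contract hN hη, ι_mul_eq_involute_mul,
        involute_of_mem_extDeg hu, involute_of_mem_extDeg hβ]
      push_cast
      rw [sgn_add, sgn_of_odd odd_one, map_smul, mul_smul_comm]
      simp only [mul_one, neg_smul, neg_neg, mul_neg, mul_smul_comm, smul_mul_assoc, mul_assoc]

/-- Covectors cross the star one at a time and become contractions, after which the two stars
cancel. For two covectors the parities cancel as well; in degree three a sign and a parity survive.
-/
theorem fibreStar_mul_fibreStar_deg_two (hN : finrank ℝ V < N) (hη : η ∈ extDeg (Dual ℝ V) 2)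
    (hB : (formBilin η).Nondegenerate)
    {u : ExteriorAlgebra ℝ (Dual ℝ V)}
    (hu : u ∈ extDeg (Dual ℝ V) 2) (x : ExteriorAlgebra ℝ (Dual ℝ V)) :
    fibreStar N η hB (u * fibreStar N η hB x) =
      contractForm (formBilin η) hB (CliffordAlgebra.reverse u) x := by
  refine extDeg_two_induction (P := fun u => fibreStar N η hB (u * fibreStar N η hB x) =
      contractForm (formBilin η) hB (CliffordAlgebra.reverse u) x) (fun a b => ?_)
      (fun u v hu hv => ?_) hu
  · rw [CliffordAlgebra.reverse.map_mul, reverse_ι, reverse_ι,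
      map_mul (contractForm (formBilin η) hB), contractForm_ι, contractForm_ι,
      Module.End.mul_apply, mul_assoc, fibreStar_ι_mul hN hη, map_mul, involute_ι,
      neg_mul, map_neg, fibreStar_ι_mul hN hη, involute_involute, fibreStar_fibreStar hN hη,
      neg_neg, contract_comm, neg_neg]
  · rw [add_mul, map_add, hu, hv, map_add, map_add, LinearMap.add_apply]

theorem fibreStar_mul_fibreStar_deg_three (hN : finrank ℝ V < N) (hη : η ∈ extDeg (Dual ℝ V) 2)
    (hB : (formBilin η).Nondegenerate)
    {u : ExteriorAlgebra ℝ (Dual ℝ V)}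
    (hu : u ∈ extDeg (Dual ℝ V) 3) (x : ExteriorAlgebra ℝ (Dual ℝ V)) :
    -fibreStar N η hB (u * fibreStar N η hB (CliffordAlgebra.involute x)) =
      contractForm (formBilin η) hB (CliffordAlgebra.reverse u) x := by
  refine extDeg_three_induction (P := fun u =>
      -fibreStar N η hB (u * fibreStar N η hB (CliffordAlgebra.involute x)) =
      contractForm (formBilin η) hB (CliffordAlgebra.reverse u) x) (fun a b c => ?_)
      (fun u v hu hv => ?_) hu
  · have h := fibreStar_mul_fibreStar_deg_two hN hη hB
      (mul_mem_extDeg (ι_mem_extDeg b) (ι_mem_extDeg c) : _ ∈ extDeg _ (1 + 1)) x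
    have h1 : contractForm (formBilin η) hB (CliffordAlgebra.reverse
        (ExteriorAlgebra.ι ℝ a * (ExteriorAlgebra.ι ℝ b * ExteriorAlgebra.ι ℝ c))) x =
        contract (sharp (formBilin η) hB a) (contractForm (formBilin η) hB
          (CliffordAlgebra.reverse (ExteriorAlgebra.ι ℝ b * ExteriorAlgebra.ι ℝ c)) x) := by
      simp only [CliffordAlgebra.reverse.map_mul, reverse_ι, map_mul, contractForm_ι,
        Module.End.mul_apply]
      rw [contract_comm (sharp (formBilin η) hB b), map_neg, contract_comm, neg_neg]
    rw [h1, ← h, mul_assoc, fibreStar_ι_mul hN hη, neg_neg,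
      map_mul CliffordAlgebra.involute, map_mul CliffordAlgebra.involute, involute_ι, involute_ι,
      fibreStar_par hη, involute_involute, neg_mul_neg]
  · rw [add_mul, map_add, neg_add, hu, hv, map_add, map_add, LinearMap.add_apply]

/-- Both operators kill 1 and have the same commutator -i_{♯θ} with the wedge by θ. The factor ½ is
absorbed because, by antisymmetry, θ meets the two contractions with equal effect. -/
theorem contractPoisson_eq (hη : η ∈ extDeg (Dual ℝ V) 2) (hB : (formBilin η).Nondegenerate) :
    contractPoisson (formBilin η) hB = fibreLambda η hB := by
  refine end_ext_of_ι_mul ?_ fun θ u hu => ?_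
  · rw [fibreLambda_one hη]
    simp [contractPoisson, contract_one]
  · have h1 : ∑ i, θ (finBasis ℝ V i) • (finBasis ℝ V).coord i = θ := by
      refine (finBasis ℝ V).ext fun j => ?_
      simp
    set c : Fin (finrank ℝ V) → Fin (finrank ℝ V) → ℝ := fun i j =>
      formBilin η (sharp (formBilin η) hB ((finBasis ℝ V).coord i))
        (sharp (formBilin η) hB ((finBasis ℝ V).coord j)) with hc
    have hanti : ∀ i j, c i j = -c j i := fun i j => formBilin_swap _ _ _
    have h2 : ∑ j, ∑ i, (c i j * θ (finBasis ℝ V i)) • contract (finBasis ℝ V j) u =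
        -contract (sharp (formBilin η) hB θ) u := by
      have h3 : ∀ j, ∑ i, c i j * θ (finBasis ℝ V i) =
          -(finBasis ℝ V).coord j (sharp (formBilin η) hB θ) := by
        intro j
        rw [← apply_sharp_swap hB θ, ← apply_sharp (formBilin η) hB θ]
        conv_rhs => rw [← h1]
        simp only [map_sum, map_smul, LinearMap.sum_apply, LinearMap.smul_apply, smul_eq_mul, hc]
        exact Finset.sum_congr rfl fun i _ => mul_comm _ _
      have h4 : ∑ j, (finBasis ℝ V).coord j (sharp (formBilin η) hB θ) • finBasis ℝ V j =
          sharp (formBilin η) hB θ := (finBasis ℝ V).sum_repr _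
      simp only [← Finset.sum_smul, h3]
      conv_rhs => rw [← h4]
      simp only [map_sum, map_smul, LinearMap.sum_apply, LinearMap.smul_apply, neg_smul,
        Finset.sum_neg_distrib]
    have h5 : contractPoisson (formBilin η) hB (ExteriorAlgebra.ι ℝ θ * u) =
        (1 / 2 : ℝ) • (∑ i, ∑ j, (c i j * θ (finBasis ℝ V i)) • contract (finBasis ℝ V j) u -
          ∑ i, ∑ j, (c i j * θ (finBasis ℝ V j)) • contract (finBasis ℝ V i) u) +
        ExteriorAlgebra.ι ℝ θ * contractPoisson (formBilin η) hB u := by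
      simp only [contractPoisson, LinearMap.smul_apply, LinearMap.sum_apply, Module.End.mul_apply,
        contract_ι_mul, map_sub, map_smul, mul_smul_comm, Finset.mul_sum, ← smul_add,
        ← Finset.sum_sub_distrib, ← Finset.sum_add_distrib]
      refine congrArg (fun z : ExteriorAlgebra ℝ (Dual ℝ V) => (1 / 2 : ℝ) • z)
        (Finset.sum_congr rfl fun i _ => Finset.sum_congr rfl fun j _ => ?_)
      simp only [hc]
      module
    have h6 : ∑ i, ∑ j, (c i j * θ (finBasis ℝ V j)) • contract (finBasis ℝ V i) u =
        -∑ j, ∑ i, (c i j * θ (finBasis ℝ V i)) • contract (finBasis ℝ V j) u := by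
      simp only [← Finset.sum_neg_distrib]
      refine Finset.sum_congr rfl fun i _ => Finset.sum_congr rfl fun j _ => ?_
      rw [hanti i j, neg_mul, neg_smul]
    have h7 := DFunLike.congr_fun (fibreLambda_mul_ι hη hB θ) u
    simp only [Module.End.mul_apply, LinearMap.mulLeft_apply, LinearMap.sub_apply] at h7
    rw [h5, h7, h6, Finset.sum_comm, h2, hu]
    module

end FibreStar

/-! ### The exterior derivative -/

section ExteriorDerivative

theorem pullExt_mem_extDeg {V W : Type*} [AddCommGroup V] [Module ℝ V] [AddCommGroup W]
    [Module ℝ W] (T : V →ₗ[ℝ] W) {k : ℤ} {u : ExteriorAlgebra ℝ (Dual ℝ W)}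
    (hu : u ∈ extDeg (Dual ℝ W) k) : pullExt T u ∈ extDeg (Dual ℝ V) k := by
  cases k with
  | negSucc k => rw [(Submodule.mem_bot ℝ).1 hu, map_zero]; exact zero_mem _
  | ofNat k =>
    change u ∈ extDeg _ (k : ℤ) at hu
    change _ ∈ extDeg _ (k : ℤ)
    induction k generalizing u with
    | zero =>
      obtain ⟨r, rfl⟩ := mem_extDeg_zero hu
      rw [AlgHom.commutes, Algebra.algebraMap_eq_smul_one]
      exact Submodule.smul_mem _ _ one_mem_extDeg
    | succ k ih =>
      refine extDeg_succ_induction (P := fun u => pullExt T u ∈ extDeg _ ((k + 1 : ℕ) : ℤ))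
        (fun θ u hu => ?_) (fun u v hu hv => by rw [map_add]; exact add_mem hu hv) hu
      rw [map_mul, pullExt_ι]
      have := mul_mem_extDeg (ι_mem_extDeg (θ ∘ₗ T)) (ih hu)
      push_cast
      rwa [add_comm]

variable {E : Type*} [NormedAddCommGroup E] [NormedSpace ℝ E] [FiniteDimensional ℝ E]

theorem dirDeriv_linear (T : End ℝ (ExteriorAlgebra ℝ (Dual ℝ E)))
    {F : E → ExteriorAlgebra ℝ (Dual ℝ E)} {z : E} (hF : DiffAt F z) :
    DiffAt (fun y => T (F y)) z ∧ ∀ v, dirDeriv (fun y => T (F y)) z v = T (dirDeriv F z v) := by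
  have h := hasFDerivAt_linear (T ∘ₗ (extCoord E).symm.toLinearMap) hF.hasFDerivAt
  simpa [dirDeriv] using h

theorem flatExtDeriv_involute {F : E → ExteriorAlgebra ℝ (Dual ℝ E)} {z : E} (hF : DiffAt F z) :
    flatExtDeriv (fun y => CliffordAlgebra.involute (F y)) z =
      -CliffordAlgebra.involute (flatExtDeriv F z) := by
  have h := (dirDeriv_linear (CliffordAlgebra.involute (Q := (0 : QuadraticForm ℝ (Dual ℝ E)))).toLinearMap hF).2
  simp only [AlgHom.toLinearMap_apply] at h
  have hι : ∀ θ : Dual ℝ E, CliffordAlgebra.involute (ExteriorAlgebra.ι ℝ θ) =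
      -ExteriorAlgebra.ι ℝ θ := involute_ι
  simp only [flatExtDeriv, h, map_sum, map_mul, hι, neg_mul, Finset.sum_neg_distrib, neg_neg]

theorem flatExtDeriv_mem_extDeg {F : E → ExteriorAlgebra ℝ (Dual ℝ E)} {z : E} (hF : DiffAt F z)
    {k : ℤ} (h : ∀ y, F y ∈ extDeg (Dual ℝ E) k) :
    flatExtDeriv F z ∈ extDeg (Dual ℝ E) (k + 1) := by
  refine sum_mem fun i _ => ?_
  rw [add_comm]
  refine mul_mem_extDeg (ι_mem_extDeg _) ?_
  cases k with
  | negSucc k =>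
    have h0 : F = fun _ => 0 := funext fun y => (Submodule.mem_bot ℝ).1 (h y)
    have h1 := (dirDeriv_linear 0 hF).2 (finBasis ℝ E i)
    simp only [LinearMap.zero_apply] at h1
    rw [h0, h1]
    exact zero_mem _
  | ofNat k =>
    -- A directional derivative commutes with the constant projection to degree k, so it stays in
    -- that degree.
    have h0 : F = fun y => extProj k (F y) := by
      funext y
      rw [extProj_of_mem (h y), if_pos rfl]
    rw [h0, (dirDeriv_linear (extProj k) hF).2]
    exact extProj_mem k _

variable {M : Type*} [TopologicalSpace M] [ChartedSpace E M] [IsManifold 𝓘(ℝ, E) ∞ M]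

theorem extDerivAt_involute {x : M} {a : Π y : M, CotangentExt E M y}
    (ha : DiffAt (chartRep x a) (chartAt E x x)) :
    extDerivAt (fun y => (CliffordAlgebra.involute (a y) : CotangentExt E M y)) x =
      -CliffordAlgebra.involute (extDerivAt a x) := by
  have h : chartRep x (fun y => (CliffordAlgebra.involute (a y) : CotangentExt E M y)) =
      fun z => CliffordAlgebra.involute (chartRep x a z) :=
    funext fun _ => pullExt_involute _ _
  rw [extDerivAt, h, flatExtDeriv_involute ha, map_neg, pullExt_involute, extDerivAt]

theorem extDerivAt_differential {U : Set M} (hU : IsOpen U) {g : M → ℝ}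
    (hg : ContMDiffOn 𝓘(ℝ, E) 𝓘(ℝ, ℝ) ∞ g U) {x : M} (hx : x ∈ U) :
    extDerivAt (fun y => ExteriorAlgebra.ι ℝ (differentialAt E g y)) x = 0 := by
  obtain ⟨h1, h2⟩ := chartRep_differential hU hx hg
  rw [extDerivAt, flatExtDeriv_congr h2, (flatExtDeriv_differential h1).2, map_zero]

/-- d² vanishes on functions and on differentials, and this passes to products because the cross
terms of the Leibniz rule cancel by parity. The local form `c` supplies the differentiability needed
for the second derivative. -/
theorem extDerivAt_extDerivAt_localForms {U : Set M} (hU : IsOpen U)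
    {a : Π x : M, CotangentExt E M x} (ha : a ∈ localForms E U) :
    ∃ c ∈ localForms E U, ∀ x ∈ U, extDerivAt a x = c x ∧ extDerivAt c x = 0 := by
  have hfun : ∀ f : M → ℝ, ContMDiffOn 𝓘(ℝ, E) 𝓘(ℝ, ℝ) ∞ f U →
      ∃ c ∈ localForms E U, ∀ x ∈ U, extDerivAt (fun x => algebraMap ℝ (CotangentExt E M x) (f x))
        x = c x ∧ extDerivAt c x = 0 := fun f hf =>
    ⟨_, Algebra.subset_adjoin (Or.inr ⟨f, hf, rfl⟩), fun x hx =>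
      ⟨(extDerivAt_function hU hf hx).2, extDerivAt_differential hU hf hx⟩⟩
  have hzero : ∀ x ∈ U, extDerivAt (0 : Π x : M, CotangentExt E M x) x = 0 := by
    intro x hx
    have h := ((extDerivAt_localForms hU (zero_mem (localForms E U))).1 x hx)
    have := extDerivAt_smul 0 h
    rwa [zero_smul, zero_smul] at this
  induction ha using Algebra.adjoin_induction with
  | mem a ha =>
    rcases ha with ⟨f, hf, rfl⟩ | ⟨g, hg, rfl⟩
    · exact hfun f hf
    · exact ⟨0, zero_mem _, fun x hx => ⟨extDerivAt_differential hU hg hx, hzero x hx⟩⟩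
  | algebraMap r => exact hfun _ contMDiffOn_const
  | add a b ha' hb' ha hb =>
    obtain ⟨a', ha2, ha3⟩ := ha
    obtain ⟨b', hb2, hb3⟩ := hb
    refine ⟨_, add_mem ha2 hb2, fun x hx => ?_⟩
    rw [(extDerivAt_add ((extDerivAt_localForms hU ha').1 x hx)
        ((extDerivAt_localForms hU hb').1 x hx)).2,
      (extDerivAt_add ((extDerivAt_localForms hU ha2).1 x hx)
        ((extDerivAt_localForms hU hb2).1 x hx)).2, (ha3 x hx).1, (hb3 x hx).1, (ha3 x hx).2,
      (hb3 x hx).2, add_zero]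
    exact ⟨rfl, rfl⟩
  | mul a b ha' hb' ha hb =>
    obtain ⟨a', ha2, ha3⟩ := ha
    obtain ⟨b', hb2, hb3⟩ := hb
    have hinv := involute_mem_localForms E ha'
    refine ⟨_, add_mem (mul_mem ha2 hb') (mul_mem hinv hb2), fun x hx => ?_⟩
    have d1 := (extDerivAt_localForms hU ha').1 x hx
    have d2 := (extDerivAt_localForms hU hb').1 x hx
    have d3 := (extDerivAt_localForms hU ha2).1 x hx
    have d4 := (extDerivAt_localForms hU hb2).1 x hx
    have d5 := (extDerivAt_localForms hU hinv).1 x hx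
    rw [(extDerivAt_mul d1 d2).2, (extDerivAt_add (extDerivAt_mul d3 d2).1
      (extDerivAt_mul d5 d4).1).2, (extDerivAt_mul d3 d2).2, (extDerivAt_mul d5 d4).2,
      extDerivAt_involute d1, (ha3 x hx).1, (hb3 x hx).1, (ha3 x hx).2, (hb3 x hx).2]
    refine ⟨rfl, ?_⟩
    simp

theorem extD_extD (a : DiffForm E M) : extD E M (extD E M a) = 0 := by
  refine Subtype.ext (funext fun x => ?_)
  obtain ⟨U, hU, hx, b, hb, hab⟩ := a.2 x
  obtain ⟨c, hc, hbc⟩ := extDerivAt_extDerivAt_localForms hU hb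
  change extDerivAt (fun y => extDerivAt a.1 y) x = 0
  rw [extDerivAt_congr hU hx (b := c) fun y hy =>
    (extDerivAt_congr hU hy hab).trans (hbc y hy).1, (hbc x hx).2]

theorem extD_mul (a b : DiffForm E M) :
    extD E M (a * b) = extD E M a * b + parity E a * extD E M b :=
  Subtype.ext (funext fun x => (extDerivAt_mul (diffAt_chartRep a x) (diffAt_chartRep b x)).2)

theorem extD_mem {k : ℤ} {a : DiffForm E M} (ha : a ∈ formsOfDegree E M k) :
    extD E M a ∈ formsOfDegree E M (k + 1) := fun x =>
  pullExt_mem_extDeg _ (flatExtDeriv_mem_extDeg (diffAt_chartRep a x) fun _ =>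
    pullExt_mem_extDeg _ (ha _))

end ExteriorDerivative

/-! ### Operators on forms which are linear over functions -/

section LocalOperators

variable {E : Type*} [NormedAddCommGroup E] [NormedSpace ℝ E]
  {M : Type*} [TopologicalSpace M] [ChartedSpace E M]

theorem function_mem_localForms {U : Set M} {f : M → ℝ}
    (hf : ContMDiffOn 𝓘(ℝ, E) 𝓘(ℝ, ℝ) ∞ f U) :
    (fun x => algebraMap ℝ (CotangentExt E M x) (f x)) ∈ localForms E U :=
  Algebra.subset_adjoin (Or.inl ⟨f, hf, rfl⟩)

theorem differential_mem_localForms {U : Set M} {g : M → ℝ}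
    (hg : ContMDiffOn 𝓘(ℝ, E) 𝓘(ℝ, ℝ) ∞ g U) :
    (fun x => (ExteriorAlgebra.ι ℝ (differentialAt E g x) : CotangentExt E M x)) ∈
      localForms E U :=
  Algebra.subset_adjoin (Or.inr ⟨g, hg, rfl⟩)

theorem localForms_induction {U : Set M} {P : (Π x : M, CotangentExt E M x) → Prop}
    (hfun : ∀ f : M → ℝ, ContMDiffOn 𝓘(ℝ, E) 𝓘(ℝ, ℝ) ∞ f U →
      P fun x => algebraMap ℝ (CotangentExt E M x) (f x))
    (hdiff : ∀ g : M → ℝ, ContMDiffOn 𝓘(ℝ, E) 𝓘(ℝ, ℝ) ∞ g U →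
      P fun x => ExteriorAlgebra.ι ℝ (differentialAt E g x))
    (hadd : ∀ a ∈ localForms E U, ∀ b ∈ localForms E U, P a → P b → P (a + b))
    (hmul : ∀ a ∈ localForms E U, ∀ b ∈ localForms E U, P a → P b → P (a * b))
    {a : Π x : M, CotangentExt E M x} (ha : a ∈ localForms E U) : P a := by
  induction ha using Algebra.adjoin_induction with
  | mem a ha =>
    rcases ha with ⟨f, hf, rfl⟩ | ⟨g, hg, rfl⟩
    · exact hfun f hf
    · exact hdiff g hg
  | algebraMap r => exact hfun _ contMDiffOn_const
  | add a b ha hb iha ihb => exact hadd a ha b hb iha ihb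
  | mul a b ha hb iha ihb => exact hmul a ha b hb iha ihb

theorem reverse_mem_localForms {U : Set M} {a : Π x : M, CotangentExt E M x}
    (ha : a ∈ localForms E U) :
    (fun x => (CliffordAlgebra.reverse (a x) : CotangentExt E M x)) ∈ localForms E U := by
  refine localForms_induction (P := fun a =>
    (fun x => (CliffordAlgebra.reverse (a x) : CotangentExt E M x)) ∈ localForms E U)
    (fun f hf => ?_) (fun g hg => ?_) (fun a _ b _ ha hb => ?_) (fun a _ b _ ha hb => ?_) ha
  · convert function_mem_localForms hf using 2
    exact CliffordAlgebra.reverse.commutes _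
  · convert differential_mem_localForms hg using 2
    exact reverse_ι _
  · convert add_mem ha hb using 1
    exact funext fun x => map_add _ _ _
  · convert mul_mem hb ha using 1
    exact funext fun x => CliffordAlgebra.reverse.map_mul _ _

theorem extProj_mem_localForms {U : Set M} {a : Π x : M, CotangentExt E M x}
    (ha : a ∈ localForms E U) (k : ℕ) :
    (fun x => (extProj k (a x) : CotangentExt E M x)) ∈ localForms E U := by
  refine localForms_induction (P := fun a => ∀ k,
    (fun x => (extProj k (a x) : CotangentExt E M x)) ∈ localForms E U)
    (fun f hf k => ?_) (fun g hg k => ?_) (fun a _ b _ ha hb k => ?_)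
    (fun a _ b _ ha hb k => ?_) ha k
  · have h : ∀ x, extProj k (algebraMap ℝ (CotangentExt E M x) (f x)) =
        if 0 = k then algebraMap ℝ _ (f x) else 0 := fun x => by
      refine extProj_of_mem ?_
      rw [Algebra.algebraMap_eq_smul_one]
      exact Submodule.smul_mem _ _ one_mem_extDeg
    simp only [h]
    split_ifs
    · exact function_mem_localForms hf
    · exact zero_mem _
  · have h : ∀ x, extProj k (ExteriorAlgebra.ι ℝ (differentialAt E g x)) =
        if 1 = k then ExteriorAlgebra.ι ℝ (differentialAt E g x) else 0 := fun x =>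
      extProj_of_mem (ι_mem_extDeg _)
    simp only [h]
    split_ifs
    · exact differential_mem_localForms hg
    · exact zero_mem _
  · convert add_mem (ha k) (hb k) using 1
    exact funext fun x => map_add _ _ _
  · convert sum_mem (S := localForms E U)
      (t := Finset.HasAntidiagonal.antidiagonal k) fun ij _ => mul_mem (ha ij.1) (hb ij.2) using 1
    funext x
    rw [Finset.sum_apply]
    exact extProj_mul _ _ _

theorem contMDiffOn_algebraMapInv {U : Set M} {a : Π x : M, CotangentExt E M x}
    (ha : a ∈ localForms E U) :
    ContMDiffOn 𝓘(ℝ, E) 𝓘(ℝ, ℝ) ∞ (fun x => ExteriorAlgebra.algebraMapInv (a x)) U := by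
  refine localForms_induction (P := fun a =>
    ContMDiffOn 𝓘(ℝ, E) 𝓘(ℝ, ℝ) ∞ (fun x => ExteriorAlgebra.algebraMapInv (a x)) U)
    (fun f hf => ?_) (fun g hg => ?_) (fun a _ b _ ha hb => ?_) (fun a _ b _ ha hb => ?_) ha
  · convert hf using 2
    exact ExteriorAlgebra.algebraMap_leftInverse _ _
  · convert contMDiffOn_const (c := (0 : ℝ)) using 2
    simp [ExteriorAlgebra.algebraMapInv]
  · simp only [Pi.add_apply, map_add]
    exact ha.add hb
  · simp only [Pi.mul_apply, map_mul]
    exact ha.mul hb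

/-- Families of operators on the exterior algebras of the cotangent spaces which, on `U`, map
local forms to local forms. -/
def localOps (U : Set M) : Subalgebra ℝ (Π x : M, End ℝ (CotangentExt E M x)) where
  carrier := {T | ∀ a ∈ localForms E U, ∃ b ∈ localForms E U, ∀ x ∈ U, T x (a x) = b x}
  mul_mem' := fun hS hT a ha => by
    obtain ⟨b, hb, hab⟩ := hT a ha
    obtain ⟨c, hc, hbc⟩ := hS b hb
    refine ⟨c, hc, fun x hx => ?_⟩
    rw [Pi.mul_apply, Module.End.mul_apply, hab x hx, hbc x hx]
  add_mem' := fun hS hT a ha => by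
    obtain ⟨b, hb, hab⟩ := hT a ha
    obtain ⟨c, hc, hac⟩ := hS a ha
    refine ⟨c + b, add_mem hc hb, fun x hx => ?_⟩
    rw [Pi.add_apply, LinearMap.add_apply, hab x hx, hac x hx, Pi.add_apply]
  algebraMap_mem' := fun r a ha =>
    ⟨r • a, Subalgebra.smul_mem _ ha r, fun _ _ => rfl⟩

theorem smul_mem_localOps {U : Set M} {f : M → ℝ} (hf : ContMDiffOn 𝓘(ℝ, E) 𝓘(ℝ, ℝ) ∞ f U)
    {T : Π x : M, End ℝ (CotangentExt E M x)} (hT : T ∈ localOps (E := E) U) :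
    (fun x => f x • T x) ∈ localOps (E := E) U := by
  intro a ha
  obtain ⟨b, hb, hab⟩ := hT a ha
  refine ⟨_, mul_mem (function_mem_localForms hf) hb, fun x hx => ?_⟩
  rw [LinearMap.smul_apply, hab x hx, Pi.mul_apply, Algebra.smul_def]

variable (E M) in
/-- Families of operators on the exterior algebras of the cotangent spaces which map
smooth forms to smooth forms. -/
def smoothOps : Subalgebra ℝ (Π x : M, End ℝ (CotangentExt E M x)) where
  carrier := {T | ∀ a ∈ smoothForms E M, (fun x => T x (a x)) ∈ smoothForms E M}
  mul_mem' := fun hS hT _ ha => hS _ (hT _ ha)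
  add_mem' := fun hS hT a ha => add_mem (hS a ha) (hT a ha)
  algebraMap_mem' := fun r _ ha => Subalgebra.smul_mem _ ha r

variable (E M) in
/-- The operator on smooth forms given by a smooth family of operators on the fibres. -/
def liftOp : smoothOps E M →ₐ[ℝ] End ℝ (DiffForm E M) where
  toFun T :=
    { toFun := fun a => ⟨fun x => T.1 x (a.1 x), T.2 _ a.2⟩
      map_add' := fun _ _ => Subtype.ext (funext fun x => map_add (T.1 x) _ _)
      map_smul' := fun _ _ => Subtype.ext (funext fun x => map_smul (T.1 x) _ _) }
  map_one' := rfl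
  map_mul' _ _ := rfl
  map_zero' := rfl
  map_add' _ _ := rfl
  commutes' _ := rfl

theorem liftOp_apply (T : smoothOps E M) (a : DiffForm E M) (x : M) :
    (liftOp E M T a).1 x = T.1 x (a.1 x) := rfl

theorem mem_smoothOps_of_localForms {T : Π x : M, End ℝ (CotangentExt E M x)}
    (hT : ∀ U : Set M, ∀ a ∈ localForms E U, (fun x => T x (a x)) ∈ localForms E U) :
    T ∈ smoothOps E M := by
  intro a ha x
  obtain ⟨U, hU, hx, b, hb, hab⟩ := ha x
  exact ⟨U, hU, hx, _, hT U b hb, fun y hy => congrArg _ (hab y hy)⟩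

/-- All smaller open sets are required because the neighbourhood on which a form has a local
expression must be intersected with the one adapted to the operator. -/
theorem mem_smoothOps_of_localOps {T : Π x : M, End ℝ (CotangentExt E M x)}
    (hT : ∀ x : M, ∃ U : Set M, IsOpen U ∧ x ∈ U ∧ ∀ V ⊆ U, IsOpen V → T ∈ localOps (E := E) V) :
    T ∈ smoothOps E M := by
  intro a ha x
  obtain ⟨U, hU, hx, b, hb, hab⟩ := ha x
  obtain ⟨V, hV, hxV, hVT⟩ := hT x
  obtain ⟨c, hc, hbc⟩ := hVT (V ∩ U) Set.inter_subset_left (hV.inter hU) b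
    (localForms_mono E Set.inter_subset_right hb)
  exact ⟨V ∩ U, hV.inter hU, ⟨hxV, hx⟩, c, hc, fun y hy =>
    (congrArg _ (hab y hy.2)).trans (hbc y hy)⟩

theorem mulLeft_mem_smoothOps (a : DiffForm E M) :
    (fun x => LinearMap.mulLeft ℝ (a.1 x)) ∈ smoothOps E M := fun _ hb => mul_mem a.2 hb

theorem revEnd_mem_smoothOps : (fun x => revEnd (Dual ℝ (TangentSpace 𝓘(ℝ, E) x))) ∈ smoothOps E M :=
  mem_smoothOps_of_localForms fun _ _ ha => reverse_mem_localForms ha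

theorem extProj_mem_smoothOps (k : ℕ) :
    (fun x => (extProj k : End ℝ (CotangentExt E M x))) ∈ smoothOps E M :=
  mem_smoothOps_of_localForms fun _ _ ha => extProj_mem_localForms ha k

/-- A smooth family of fibre operators homogeneous of degree `p` defines an operator
homogeneous of degree `p`. -/
theorem isOfDegree_liftOp {T : smoothOps E M} {p : ℤ}
    (h : ∀ x, IsOfDegree (extDeg (Dual ℝ (TangentSpace 𝓘(ℝ, E) x))) p (T.1 x)) :
    IsOfDegree (formsOfDegree E M) p (liftOp E M T) :=
  fun k _ ha x => h x k _ (ha x)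

end LocalOperators

/-! ### The grading of the algebra of forms -/

section Grading

variable {E : Type*} [NormedAddCommGroup E] [NormedSpace ℝ E]
  {M : Type*} [TopologicalSpace M] [ChartedSpace E M]

theorem one_mem_formsOfDegree : (1 : DiffForm E M) ∈ formsOfDegree E M 0 :=
  fun _ => one_mem_extDeg

theorem mul_mem_formsOfDegree {p q : ℤ} {a b : DiffForm E M} (ha : a ∈ formsOfDegree E M p)
    (hb : b ∈ formsOfDegree E M q) : a * b ∈ formsOfDegree E M (p + q) :=
  fun x => mul_mem_extDeg (ha x) (hb x)

theorem formsOfDegree_graded_comm {p q : ℤ} {a b : DiffForm E M} (ha : a ∈ formsOfDegree E M p)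
    (hb : b ∈ formsOfDegree E M q) : a * b = sgn ℝ (p * q) • (b * a) :=
  Subtype.ext (funext fun x => extDeg_graded_comm (ha x) (hb x))

variable (E M) in
/-- The projection of a form to its component of degree `k`. -/
def formProj (k : ℕ) : End ℝ (DiffForm E M) := liftOp E M ⟨_, extProj_mem_smoothOps k⟩

theorem formProj_mem (k : ℕ) (a : DiffForm E M) : formProj E M k a ∈ formsOfDegree E M k :=
  fun x => extProj_mem k (a.1 x)

theorem formProj_of_mem {k l : ℕ} {a : DiffForm E M} (ha : a ∈ formsOfDegree E M k) :
    formProj E M l a = if k = l then a else 0 := by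
  refine Subtype.ext (funext fun x => ?_)
  refine (extProj_of_mem (ha x)).trans ?_
  split_ifs <;> rfl

theorem formsOfDegree_neg {k : ℤ} (hk : k < 0) : formsOfDegree E M k = ⊥ := by
  obtain ⟨m, rfl⟩ := Int.eq_negSucc_of_lt_zero hk
  exact (Submodule.eq_bot_iff _).2 fun a ha =>
    Subtype.ext (funext fun x => (Submodule.mem_bot ℝ).1 (ha x))

variable [FiniteDimensional ℝ E]

theorem sum_formProj (a : DiffForm E M) :
    ∑ k ∈ Finset.range (finrank ℝ E + 1), formProj E M k a = a := by
  refine Subtype.ext (funext fun x => ?_)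
  rw [AddSubmonoidClass.coe_finsetSum, Finset.sum_apply]
  refine sum_extProj ?_ (a.1 x)
  rw [Subspace.dual_finrank_eq]
  exact Nat.lt_succ_self _

/-- The projections `formProj` kill all degrees but one, which gives independence; finiteness of the
dimension bounds the number of components. -/
theorem isInternal_formsOfDegree : DirectSum.IsInternal (formsOfDegree E M) := by
  rw [DirectSum.isInternal_submodule_iff_iSupIndep_and_iSup_eq_top]
  constructor
  · classical
    have hproj : ∀ (k : ℕ) (j : ℤ), j ≠ k → ∀ a ∈ formsOfDegree E M j, formProj E M k a = 0 := by
      intro k j hjk a ha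
      rcases lt_or_ge j 0 with hj | hj
      · rw [formsOfDegree_neg hj] at ha
        rw [(Submodule.mem_bot ℝ).1 ha, map_zero]
      · obtain ⟨l, rfl⟩ := Int.eq_ofNat_of_zero_le hj
        rw [formProj_of_mem ha, if_neg (by exact_mod_cast hjk)]
    intro i
    rcases lt_or_ge i 0 with hi | hi
    · rw [formsOfDegree_neg hi]
      exact disjoint_bot_left
    · obtain ⟨k, rfl⟩ := Int.eq_ofNat_of_zero_le hi
      refine Submodule.disjoint_def.2 fun a ha hb => ?_
      have h1 : ⨆ j, ⨆ (_ : j ≠ (k : ℤ)), formsOfDegree E M j ≤ LinearMap.ker (formProj E M k) :=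
        iSup₂_le fun j hj a ha => hproj k j hj a ha
      have h2 := formProj_of_mem (l := k) ha
      rw [if_pos rfl] at h2
      rw [← h2]
      exact h1 hb
  · refine (Submodule.eq_top_iff').2 fun a => ?_
    rw [← sum_formProj a]
    exact sum_mem fun k _ => Submodule.mem_iSup_of_mem (k : ℤ) (formProj_mem k a)

end Grading

/-! ### Values of smooth forms at a point -/

section Values

variable {E : Type*} [NormedAddCommGroup E] [NormedSpace ℝ E] [FiniteDimensional ℝ E]
  {M : Type*} [TopologicalSpace M] [T2Space M] [ChartedSpace E M] [IsManifold 𝓘(ℝ, E) ∞ M]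

/-- A linear functional of the chart, cut off by a bump function equal to 1 near `x`. Hausdorffness
makes the extension by zero smooth. -/
theorem exists_differentialAt_eq (x : M) (θ : Dual ℝ (TangentSpace 𝓘(ℝ, E) x)) :
    ∃ g : M → ℝ, ContMDiff 𝓘(ℝ, E) 𝓘(ℝ, ℝ) ∞ g ∧ differentialAt E g x = θ := by
  have h1 : IsManifold 𝓘(ℝ, E) 1 M := IsManifold.of_le (n := ∞) (by norm_cast)
  have hx := mem_chart_source E x
  have hchart := mdifferentiable_chart (I := 𝓘(ℝ, E)) x
  let D : TangentSpace 𝓘(ℝ, E) x ≃L[ℝ] E := hchart.mfderiv hx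
  let T : E →L[ℝ] ℝ := LinearMap.toContinuousLinearMap (θ ∘ₗ D.symm.toLinearEquiv.toLinearMap)
  let f : SmoothBumpFunction 𝓘(ℝ, E) x := Classical.arbitrary _
  have hs : ContMDiffOn 𝓘(ℝ, E) 𝓘(ℝ, ℝ) ∞ (fun y => T (chartAt E x y)) (chartAt E x).source :=
    T.contMDiff.comp_contMDiffOn (contMDiffOn_chart (I := 𝓘(ℝ, E)) (n := ∞))
  refine ⟨fun y => f y • T (chartAt E x y), f.contMDiff_smul hs, ?_⟩
  have h2 : (fun y => f y • T (chartAt E x y)) =ᶠ[nhds x] (T ∘ chartAt E x) := by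
    filter_upwards [f.eventuallyEq_one] with y hy
    simp [hy]
  refine LinearMap.ext fun v => ?_
  rw [differentialAt, h2.mfderiv_eq, mfderiv_comp x
    (T.mdifferentiableAt (x := chartAt E x x)) (hchart.mdifferentiableAt hx)]
  have h3 : mfderiv 𝓘(ℝ, E) 𝓘(ℝ, ℝ) T (chartAt E x x) = T := T.mfderiv_eq
  rw [h3]
  change θ (D.symm (D v)) = θ v
  rw [D.symm_apply_apply]

theorem exists_form_apply_eq (x : M) (u : CotangentExt E M x) : ∃ a : DiffForm E M, a.1 x = u := by
  induction u using ExteriorAlgebra.induction with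
  | algebraMap r => exact ⟨algebraMap ℝ _ r, rfl⟩
  | ι θ =>
    obtain ⟨g, hg, rfl⟩ := exists_differentialAt_eq x θ
    exact ⟨⟨_, fun y => ⟨Set.univ, isOpen_univ, trivial, _,
      differential_mem_localForms hg.contMDiffOn, fun _ _ => rfl⟩⟩, rfl⟩
  | mul u v hu hv =>
    obtain ⟨a, rfl⟩ := hu
    obtain ⟨b, rfl⟩ := hv
    exact ⟨a * b, rfl⟩
  | add u v hu hv =>
    obtain ⟨a, rfl⟩ := hu
    obtain ⟨b, rfl⟩ := hv
    exact ⟨a + b, rfl⟩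

theorem exists_form_apply_eq_of_mem {k : ℤ} (x : M) {u : CotangentExt E M x}
    (hu : u ∈ extDeg (Dual ℝ (TangentSpace 𝓘(ℝ, E) x)) k) :
    ∃ a ∈ formsOfDegree E M k, a.1 x = u := by
  cases k with
  | negSucc k => exact ⟨0, zero_mem _, ((Submodule.mem_bot ℝ).1 hu).symm⟩
  | ofNat k =>
    obtain ⟨a, rfl⟩ := exists_form_apply_eq x u
    exact ⟨formProj E M k a, formProj_mem k a, (extProj_of_mem hu).trans (if_pos rfl)⟩

end Values

/-! ### Smoothness of contractions -/

section SmoothContraction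

variable {E : Type*} [NormedAddCommGroup E] [NormedSpace ℝ E]
  {M : Type*} [TopologicalSpace M] [ChartedSpace E M]

variable (E) in
/-- The algebra of functions smooth on `U`. -/
def smoothFunctions (U : Set M) : Subalgebra ℝ (M → ℝ) where
  carrier := {f | ContMDiffOn 𝓘(ℝ, E) 𝓘(ℝ, ℝ) ∞ f U}
  mul_mem' := fun hf hg => hf.mul hg
  add_mem' := fun hf hg => hf.add hg
  algebraMap_mem' := fun _ => contMDiffOn_const

/-- Cramer's rule over the ring of functions smooth on U: determinant and adjugate are polynomial in
the entries, and only the inverse of the determinant uses that it has no zeros on U. -/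
theorem contMDiffOn_matrix_inv {U : Set M} {n : Type*} [Fintype n] [DecidableEq n]
    (W : M → Matrix n n ℝ)
    (hW : ∀ i j, ContMDiffOn 𝓘(ℝ, E) 𝓘(ℝ, ℝ) ∞ (fun y => W y i j) U)
    (hdet : ∀ y ∈ U, (W y).det ≠ 0) (i j : n) :
    ContMDiffOn 𝓘(ℝ, E) 𝓘(ℝ, ℝ) ∞ (fun y => (W y)⁻¹ i j) U := by
  let W' : Matrix n n (smoothFunctions E U) := Matrix.of fun i j => ⟨fun y => W y i j, hW i j⟩
  let ev : M → smoothFunctions E U →+* ℝ := fun y =>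
    (Pi.evalRingHom (fun _ : M => ℝ) y).comp (smoothFunctions E U).val.toRingHom
  have hmap : ∀ y, (ev y).mapMatrix W' = W y := fun y => rfl
  have h1 : ∀ y, (W y).det = W'.det.1 y := fun y => by
    rw [← hmap y, ← RingHom.map_det]; rfl
  have h2 : ∀ y, (W y).adjugate i j = (W'.adjugate i j).1 y := fun y => by
    rw [← hmap y, ← RingHom.map_adjugate]; rfl
  have h3 : ∀ y, (W y)⁻¹ i j = (W'.det.1 y)⁻¹ * (W'.adjugate i j).1 y := fun y => by
    rw [Matrix.inv_def, Ring.inverse_eq_inv', Matrix.smul_apply, h2, h1, smul_eq_mul]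
  simp only [h3]
  refine ContMDiffOn.mul (ContMDiffOn.inv₀ W'.det.2 fun y hy => ?_) (W'.adjugate i j).2
  rw [← h1]
  exact hdet y hy

variable [FiniteDimensional ℝ E]

section

variable [IsManifold 𝓘(ℝ, E) ∞ M]

/-- The coordinate vector fields of the chart at `x₀`, as a basis of the tangent space at a point
of the domain of the chart. -/
def coordBasis {x₀ y : M} (hy : y ∈ (chartAt E x₀).source) :
    Basis (Fin (finrank ℝ E)) ℝ (TangentSpace 𝓘(ℝ, E) y) :=
  haveI : IsManifold 𝓘(ℝ, E) 1 M := IsManifold.of_le (n := ∞) (by norm_cast)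
  (finBasis ℝ E).map
    (((mdifferentiable_chart (I := 𝓘(ℝ, E)) x₀).mfderiv hy).toLinearEquiv.symm :
      E ≃ₗ[ℝ] TangentSpace 𝓘(ℝ, E) y)

end

open Classical in
/-- The coordinate vector fields of the chart at `x₀` (zero outside of its domain). -/
def coordField [IsManifold 𝓘(ℝ, E) ∞ M] (x₀ : M) (i : Fin (finrank ℝ E)) (y : M) :
    TangentSpace 𝓘(ℝ, E) y :=
  if hy : y ∈ (chartAt E x₀).source then coordBasis hy i else 0

variable [IsManifold 𝓘(ℝ, E) ∞ M]

theorem coordField_of_mem {x₀ y : M} (hy : y ∈ (chartAt E x₀).source) (i : Fin (finrank ℝ E)) :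
    coordField x₀ i y = coordBasis hy i := dif_pos hy

theorem differentialAt_coordField {x₀ y : M} (hy : y ∈ (chartAt E x₀).source)
    {g : M → ℝ} (hg : MDifferentiableAt 𝓘(ℝ, E) 𝓘(ℝ, ℝ) g y) (i : Fin (finrank ℝ E)) :
    differentialAt E g y (coordField x₀ i y) =
      fderiv ℝ (g ∘ (chartAt E x₀).symm) (chartAt E x₀ y) (finBasis ℝ E i) := by
  have h1 : IsManifold 𝓘(ℝ, E) 1 M := IsManifold.of_le (n := ∞) (by norm_cast)
  have hchart := mdifferentiable_chart (I := 𝓘(ℝ, E)) x₀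
  have hleft := (chartAt E x₀).left_inv hy
  have h2 : MDifferentiableAt 𝓘(ℝ, E) 𝓘(ℝ, ℝ) g ((chartAt E x₀).symm (chartAt E x₀ y)) := by
    rwa [hleft]
  have h3 := mfderiv_comp (chartAt E x₀ y) h2
    (hchart.mdifferentiableAt_symm ((chartAt E x₀).map_source hy))
  rw [mfderiv_eq_fderiv] at h3
  rw [h3, coordField_of_mem hy]
  -- The two base points are equal only propositionally. Both tangent spaces are `E`, so the
  -- differentials can be compared as functions on `E`.
  have key : ∀ z, z = y → ∀ v : E, (mfderiv 𝓘(ℝ, E) 𝓘(ℝ, ℝ) g y : E → ℝ) v =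
      (mfderiv 𝓘(ℝ, E) 𝓘(ℝ, ℝ) g z : E → ℝ) v := by rintro z rfl v; rfl
  exact key _ hleft _

theorem contMDiffOn_differentialAt_coordField {x₀ : M} {U : Set M} (hU : IsOpen U)
    (hU' : U ⊆ (chartAt E x₀).source) {g : M → ℝ} (hg : ContMDiffOn 𝓘(ℝ, E) 𝓘(ℝ, ℝ) ∞ g U)
    (i : Fin (finrank ℝ E)) :
    ContMDiffOn 𝓘(ℝ, E) 𝓘(ℝ, ℝ) ∞ (fun y => differentialAt E g y (coordField x₀ i y)) U := by
  intro y hy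
  refine ContMDiffAt.contMDiffWithinAt ?_
  have hgy : ∀ z ∈ U, ContMDiffAt 𝓘(ℝ, E) 𝓘(ℝ, ℝ) ∞ g z := fun z hz => hg.contMDiffAt (hU.mem_nhds hz)
  have hsymm : ContMDiffAt 𝓘(ℝ, E) 𝓘(ℝ, E) ∞ (chartAt E x₀).symm (chartAt E x₀ y) :=
    (contMDiffOn_chart_symm (I := 𝓘(ℝ, E)) (n := ∞) (x := x₀)).contMDiffAt
      ((chartAt E x₀).open_target.mem_nhds ((chartAt E x₀).map_source (hU' hy)))
  have h1 : ContDiffAt ℝ ∞ (g ∘ (chartAt E x₀).symm) (chartAt E x₀ y) := by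
    refine contMDiffAt_iff_contDiffAt.1 (ContMDiffAt.comp _ ?_ hsymm)
    rw [(chartAt E x₀).left_inv (hU' hy)]
    exact hgy y hy
  have h2 : ContDiffAt ℝ ∞ (fun z => fderiv ℝ (g ∘ (chartAt E x₀).symm) z (finBasis ℝ E i))
      (chartAt E x₀ y) :=
    (h1.fderiv_right (m := ∞) (by simp)).clm_apply contDiffAt_const
  have hchart : ContMDiffAt 𝓘(ℝ, E) 𝓘(ℝ, E) ∞ (chartAt E x₀) y :=
    (contMDiffOn_chart (I := 𝓘(ℝ, E)) (n := ∞) (x := x₀)).contMDiffAt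
      ((chartAt E x₀).open_source.mem_nhds (hU' hy))
  refine (h2.contMDiffAt.comp y hchart).congr_of_eventuallyEq ?_
  filter_upwards [hU.mem_nhds hy] with z hz
  exact differentialAt_coordField (hU' hz) ((hgy z hz).mdifferentiableAt (by simp)) i

/-- Contraction by a vector field `X` preserves local forms if `X` maps smooth functions to
smooth functions. -/
theorem contract_mem_localOps {U : Set M} (X : Π y : M, TangentSpace 𝓘(ℝ, E) y)
    (hX : ∀ g : M → ℝ, ContMDiffOn 𝓘(ℝ, E) 𝓘(ℝ, ℝ) ∞ g U →
      ContMDiffOn 𝓘(ℝ, E) 𝓘(ℝ, ℝ) ∞ (fun y => differentialAt E g y (X y)) U) :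
    (fun y => contract (X y)) ∈ localOps (E := E) U := by
  intro a ha
  suffices h : (fun y => (contract (X y) (a y) : CotangentExt E M y)) ∈ localForms E U from
    ⟨_, h, fun _ _ => rfl⟩
  refine localForms_induction (P := fun a =>
    (fun y => (contract (X y) (a y) : CotangentExt E M y)) ∈ localForms E U)
    (fun f hf => ?_) (fun g hg => ?_) (fun a _ b _ ha hb => ?_) (fun a ha' b hb' ha hb => ?_) ha
  · simp only [contract_algebraMap]
    exact zero_mem _
  · simp only [contract_ι]
    exact function_mem_localForms (hX g hg)
  · simp only [Pi.add_apply, map_add]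
    exact add_mem ha hb
  · simp only [Pi.mul_apply, contract_mul]
    exact add_mem (mul_mem ha hb') (mul_mem (involute_mem_localForms E ha') hb)

theorem contract_coordField_mem_localOps {x₀ : M} {U : Set M} (hU : IsOpen U)
    (hU' : U ⊆ (chartAt E x₀).source) (i : Fin (finrank ℝ E)) :
    (fun y => contract (coordField x₀ i y)) ∈ localOps (E := E) U :=
  contract_mem_localOps _ fun _ hg => contMDiffOn_differentialAt_coordField hU hU' hg i

/-- The gradient coordinates of a covector with respect to a bilinear form and a basis. -/
theorem sharp_eq_sum {V : Type*} [AddCommGroup V] [Module ℝ V] [FiniteDimensional ℝ V]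
    (B : LinearMap.BilinForm ℝ V) (hB : B.Nondegenerate) {n : Type*} [Fintype n] [DecidableEq n]
    (b : Basis n ℝ V) (θ : Dual ℝ V) :
    (Matrix.of fun i j => B (b i) (b j)).det ≠ 0 ∧ sharp B hB θ =
      ∑ j, (∑ i, θ (b i) * (Matrix.of fun i j => B (b i) (b j))⁻¹ i j) • b j := by
  set W : Matrix n n ℝ := Matrix.of fun i j => B (b i) (b j) with hW
  have hdet : W.det ≠ 0 := by
    have h := (LinearMap.BilinForm.nondegenerate_iff_det_ne_zero b).1 hB
    rwa [show LinearMap.BilinForm.toMatrix b B = W from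
      Matrix.ext fun i j => LinearMap.BilinForm.toMatrix_apply b B i j] at h
  refine ⟨hdet, ?_⟩
  -- The defining equation of ♯θ, read in the basis, is a linear system with a row vector as
  -- unknown, solved by the inverse matrix on the right.
  have h1 : ∀ i, θ (b i) = ∑ j, b.repr (sharp B hB θ) j * W j i := by
    intro i
    conv_lhs => rw [← apply_sharp B hB θ, ← b.sum_repr (sharp B hB θ), map_sum,
      LinearMap.sum_apply]
    refine Finset.sum_congr rfl fun j _ => ?_
    rw [map_smul]
    rfl
  have h2 : ∀ j, ∑ i, θ (b i) * W⁻¹ i j = b.repr (sharp B hB θ) j := by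
    intro j
    have h3 : (fun i => θ (b i)) = Matrix.vecMul (b.repr (sharp B hB θ)) W := funext h1
    change Matrix.vecMul (fun i => θ (b i)) W⁻¹ j = _
    rw [h3, Matrix.vecMul_vecMul, Matrix.mul_nonsing_inv _ (isUnit_iff_ne_zero.2 hdet),
      Matrix.vecMul_one]
  simp only [h2]
  exact (b.sum_repr _).symm

/-- In the coordinate frame, ♯dh has as coordinates the derivatives of `h` multiplied by the inverse
Gram matrix of ω. These are smooth, so the contraction is a smooth combination of coordinate
contractions. -/
theorem sharp_differential_mem_localOps {x₀ : M} {U : Set M} (hU : IsOpen U)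
    (hU' : U ⊆ (chartAt E x₀).source) {w : Π x : M, CotangentExt E M x}
    (hw : ∀ x, (formBilin (w x)).Nondegenerate) {w' : Π x : M, CotangentExt E M x}
    (hw' : w' ∈ localForms E U) (hww' : ∀ y ∈ U, w y = w' y) {h : M → ℝ}
    (hh : ContMDiffOn 𝓘(ℝ, E) 𝓘(ℝ, ℝ) ∞ h U) :
    (fun y => contract (sharp (formBilin (w y)) (hw y) (differentialAt E h y))) ∈
      localOps (E := E) U := by
  let W : M → Matrix (Fin (finrank ℝ E)) (Fin (finrank ℝ E)) ℝ := fun y =>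
    Matrix.of fun i j => formBilin (w y) (coordField x₀ i y) (coordField x₀ j y)
  have hW : ∀ i j, ContMDiffOn 𝓘(ℝ, E) 𝓘(ℝ, ℝ) ∞ (fun y => W y i j) U := by
    intro i j
    obtain ⟨b, hb, hab⟩ := mul_mem (contract_coordField_mem_localOps hU hU' j)
      (contract_coordField_mem_localOps hU hU' i) w' hw'
    refine (contMDiffOn_algebraMapInv hb).congr fun y hy => ?_
    rw [← hab y hy, ← hww' y hy]
    rfl
  have hsharp : ∀ y ∈ U, (W y).det ≠ 0 ∧
      sharp (formBilin (w y)) (hw y) (differentialAt E h y) =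
        ∑ j, (∑ i, differentialAt E h y (coordField x₀ i y) * (W y)⁻¹ i j) •
          coordField x₀ j y := by
    intro y hy
    have := sharp_eq_sum (formBilin (w y)) (hw y) (coordBasis (hU' hy)) (differentialAt E h y)
    simpa only [← coordField_of_mem (hU' hy)] using this
  have hcoef : ∀ j, ContMDiffOn 𝓘(ℝ, E) 𝓘(ℝ, ℝ) ∞
      (fun y => ∑ i, differentialAt E h y (coordField x₀ i y) * (W y)⁻¹ i j) U := fun j =>
    contMDiffOn_finsetSum fun i _ => (contMDiffOn_differentialAt_coordField hU hU' hh i).mul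
      (contMDiffOn_matrix_inv W hW (fun y hy => (hsharp y hy).1) i j)
  have hsum := sum_mem (S := localOps (E := E) U) (t := Finset.univ) fun j _ =>
    smul_mem_localOps (hcoef j) (contract_coordField_mem_localOps hU hU' j)
  intro a ha
  obtain ⟨b, hb, hab⟩ := hsum a ha
  refine ⟨b, hb, fun y hy => ?_⟩
  rw [← hab y hy, Finset.sum_apply]
  beta_reduce
  rw [(hsharp y hy).2]
  simp only [map_sum, map_smul]

theorem contractForm_mem_localOps {x₀ : M} {U : Set M} (hU : IsOpen U)
    (hU' : U ⊆ (chartAt E x₀).source) {w : Π x : M, CotangentExt E M x}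
    (hw : ∀ x, (formBilin (w x)).Nondegenerate) {w' : Π x : M, CotangentExt E M x}
    (hw' : w' ∈ localForms E U) (hww' : ∀ y ∈ U, w y = w' y) {u : Π x : M, CotangentExt E M x}
    (hu : u ∈ localForms E U) :
    (fun y => contractForm (formBilin (w y)) (hw y) (u y)) ∈ localOps (E := E) U := by
  refine localForms_induction (P := fun u =>
    (fun y => contractForm (formBilin (w y)) (hw y) (u y)) ∈ localOps (E := E) U)
    (fun f hf => ?_) (fun g hg => ?_) (fun a _ b _ ha hb => ?_) (fun a _ b _ ha hb => ?_) hu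
  · convert smul_mem_localOps hf (one_mem (localOps (E := E) U)) using 2
    rw [AlgHom.commutes, Algebra.algebraMap_eq_smul_one]
    rfl
  · simp only [contractForm_ι]
    exact sharp_differential_mem_localOps hU hU' hw hw' hww' hg
  · simp only [Pi.add_apply, map_add]
    exact add_mem ha hb
  · simp only [Pi.mul_apply, map_mul]
    exact mul_mem ha hb

/-- Contraction by smooth forms preserves smooth forms. -/
theorem contractForm_mem_smoothOps (w : DiffForm E M)
    (hw : ∀ x, (formBilin (w.1 x)).Nondegenerate) (u : DiffForm E M) :
    (fun y => contractForm (formBilin (w.1 y)) (hw y) (u.1 y)) ∈ smoothOps E M := by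
  refine mem_smoothOps_of_localOps fun x => ?_
  obtain ⟨U, hU, hxU, w', hw', hww'⟩ := w.2 x
  obtain ⟨U₁, hU₁, hxU₁, u', hu', huu'⟩ := u.2 x
  refine ⟨U ∩ U₁ ∩ (chartAt E x).source, (hU.inter hU₁).inter (chartAt E x).open_source,
    ⟨⟨hxU, hxU₁⟩, mem_chart_source E x⟩, fun V hVU hV => ?_⟩
  have h1 := contractForm_mem_localOps hV (fun y hy => (hVU hy).2) hw
    (localForms_mono E (fun y hy => (hVU hy).1.1) hw') (fun y hy => hww' y (hVU hy).1.1)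
    (localForms_mono E (fun y hy => (hVU hy).1.2) hu')
  intro a ha
  obtain ⟨b, hb, hab⟩ := h1 a ha
  exact ⟨b, hb, fun y hy => by
    rw [← hab y hy]
    beta_reduce
    rw [huu' y (hVU hy).1.2]⟩

end SmoothContraction

/-! ### Conjugation by the exponential of a homogeneous operator -/

section Conjugation

variable {A : Type*} [Ring A] [Algebra ℝ A] {𝒜 : ℤ → Submodule ℝ A}

theorem isOfDegree_conjCoeff {N : ℕ} {a x : End ℝ A} {p q : ℤ} (h : a ^ N = 0)
    (ha : IsOfDegree 𝒜 p a) (hx : IsOfDegree 𝒜 q x) (j : ℕ) :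
    IsOfDegree 𝒜 (q + j * p) (conjCoeff N a x j) := by
  rw [conjCoeff_eq_sum h]
  refine IsOfDegree.sum fun ij hij => ?_
  obtain rfl := Finset.HasAntidiagonal.mem_antidiagonal.1 hij
  have := (((ha.pow ij.1).smul ((ij.1.factorial : ℝ)⁻¹)).mul hx).mul
    ((ha.neg.pow ij.2).smul ((ij.2.factorial : ℝ)⁻¹))
  convert this using 1
  push_cast
  ring

/-- The components of degree `r` of two sums of homogeneous operators which coincide. -/
theorem sum_component_eq (h : DirectSum.IsInternal 𝒜) {s t : Finset ℕ} {f g : ℕ → End ℝ A}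
    {p q : ℕ → ℤ} (hf : ∀ j, IsOfDegree 𝒜 (p j) (f j)) (hg : ∀ j, IsOfDegree 𝒜 (q j) (g j))
    (hfg : ∑ j ∈ s, f j = ∑ j ∈ t, g j) (r : ℤ) :
    ∑ j ∈ s with p j = r, f j = ∑ j ∈ t with q j = r, g j := by
  obtain ⟨π, hπ⟩ := exists_projection h
  have key : ∀ (s : Finset ℕ) (f : ℕ → End ℝ A) (p : ℕ → ℤ) (_ : ∀ j, IsOfDegree 𝒜 (p j) (f j))
      (k : ℤ) (a : A) (_ : a ∈ 𝒜 k),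
      (∑ j ∈ s with p j = r, f j) a = π (k + r) ((∑ j ∈ s, f j) a) := by
    intro s f p hf k a ha
    rw [LinearMap.sum_apply, LinearMap.sum_apply, map_sum, Finset.sum_filter]
    refine Finset.sum_congr rfl fun j _ => ?_
    rw [hπ _ _ _ (hf j k a ha)]
    simp only [add_right_inj]
  refine eq_of_homogeneous h fun k a ha => ?_
  rw [key s f p hf k a ha, key t g q hg k a ha, hfg]

/-- If `e^Λ x e^{-Λ} = e^L y e^{-L}` with `L` of degree `2`, `Λ` of degree `-2`, then the components
of both sides agree degree by degree. -/
theorem conjCoeff_component (h : DirectSum.IsInternal 𝒜) {N : ℕ} {L Λ x z y : End ℝ A} {p q : ℤ}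
    (hL : L ^ N = 0) (hΛ : Λ ^ N = 0) (hL2 : IsOfDegree 𝒜 2 L) (hΛ2 : IsOfDegree 𝒜 (-2) Λ)
    (hx : IsOfDegree 𝒜 p x) (hz : IsOfDegree 𝒜 (p + 2) z) (hy : IsOfDegree 𝒜 q y)
    (hxy : nilExp N Λ * (x + z) * nilExp N (-Λ) = nilExp N L * y * nilExp N (-L)) (j : ℕ) :
    (∀ i : ℕ, q + 2 * i = p - 2 * j →
      conjCoeff N Λ x j + conjCoeff N Λ z (j + 1) = conjCoeff N L y i) ∧
    (p - 2 * j < q → conjCoeff N Λ x j + conjCoeff N Λ z (j + 1) = 0) := by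
  obtain ⟨K₁, hK₁⟩ := nilExp_conj N Λ x
  obtain ⟨K₂, hK₂⟩ := nilExp_conj N Λ z
  obtain ⟨K₃, hK₃⟩ := nilExp_conj N L y
  -- As `z` has degree two more than `x`, its coefficient j + 1 has the degree of the coefficient j
  -- of `x`. The two are grouped at index j + 1, and coefficient 0 of `z` stands alone at index 0.
  have hsum : ∀ K ≥ max K₁ K₂, ∀ K' ≥ K₃, ∑ j ∈ Finset.range (K + 1),
      (Nat.casesOn j (conjCoeff N Λ z 0)
        (fun j => conjCoeff N Λ x j + conjCoeff N Λ z (j + 1)) : End ℝ A) =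
      ∑ i ∈ Finset.range K', conjCoeff N L y i := by
    intro K hK K' hK'
    rw [← hK₃ K' hK', ← hxy, mul_add, add_mul, hK₁ K (le_trans (le_max_left _ _) hK),
      hK₂ (K + 1) (le_trans (le_trans (le_max_right _ _) hK) (Nat.le_succ _)),
      Finset.sum_range_succ', Finset.sum_range_succ' (fun j => conjCoeff N Λ z j),
      Finset.sum_add_distrib]
    exact add_assoc _ _ _
  have hf : ∀ j : ℕ, IsOfDegree 𝒜 (p + 2 - 2 * j) (Nat.casesOn j (conjCoeff N Λ z 0)
      (fun j => conjCoeff N Λ x j + conjCoeff N Λ z (j + 1)) : End ℝ A) := by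
    intro j
    cases j with
    | zero =>
      have := isOfDegree_conjCoeff hΛ hΛ2 hz 0
      simpa using this
    | succ j =>
      have h1 := isOfDegree_conjCoeff hΛ hΛ2 hz (j + 1)
      have h2 := isOfDegree_conjCoeff hΛ hΛ2 hx j
      rw [show p + 2 + ((j + 1 : ℕ) : ℤ) * -2 = p + 2 - 2 * ((j + 1 : ℕ) : ℤ) by ring] at h1
      rw [show p + (j : ℤ) * -2 = p + 2 - 2 * ((j + 1 : ℕ) : ℤ) by push_cast; ring] at h2
      exact h2.add h1
  have hg : ∀ i : ℕ, IsOfDegree 𝒜 (q + 2 * i) (conjCoeff N L y i) := fun i => by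
    have := isOfDegree_conjCoeff hL hL2 hy i
    rwa [mul_comm] at this
  -- Both truncations are enlarged so that the indices j + 1 and i₀ really occur.
  have hmain := fun i₀ : ℕ => sum_component_eq h hf hg
    (hsum (max (max K₁ K₂) (j + 1)) (le_max_left _ _) (max K₃ (i₀ + 1)) (le_max_left _ _))
    (p - 2 * j)
  have hleft : (Finset.range (max (max K₁ K₂) (j + 1) + 1)).filter
      (fun i : ℕ => p + 2 - 2 * (i : ℤ) = p - 2 * j) = {j + 1} := by
    ext i
    simp only [Finset.mem_filter, Finset.mem_range, Finset.mem_singleton]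
    omega
  rw [hleft] at hmain
  simp only [Finset.sum_singleton] at hmain
  refine ⟨fun i hi => ?_, fun hlt => ?_⟩
  · rw [hmain i]
    have hright : (Finset.range (max K₃ (i + 1))).filter
        (fun l : ℕ => q + 2 * (l : ℤ) = p - 2 * j) = {i} := by
      ext l
      simp only [Finset.mem_filter, Finset.mem_range, Finset.mem_singleton]
      omega
    rw [hright, Finset.sum_singleton]
  -- On the right-hand side all degrees are at least `q`, so nothing contributes.
  · rw [hmain 0, Finset.filter_eq_empty_iff.2, Finset.sum_empty]
    intro l _
    omega

/-- Cancelling the outer factors e^{-L} of the Weyl element puts the lowering operator on one side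
and the raising one on the other, ready for a comparison of degrees. -/
theorem conj_of_weyl {R : Type*} [Ring R] [Algebra ℝ R] {N : ℕ} {L Λ x x' y : R} (hL : L ^ N = 0)
    (hΛ : Λ ^ N = 0) (hx : nilExp N (-L) * x = x' * nilExp N (-L))
    (hw : nilExp N (-L) * nilExp N Λ * nilExp N (-L) * x =
      y * (nilExp N (-L) * nilExp N Λ * nilExp N (-L))) :
    nilExp N Λ * x' * nilExp N (-Λ) = nilExp N L * y * nilExp N (-L) := by
  have h1 := nilExp_mul_neg hL
  have h2 := nilExp_neg_mul hL
  have h3 := nilExp_mul_neg hΛ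
  calc nilExp N Λ * x' * nilExp N (-Λ)
      = nilExp N L * (nilExp N (-L) * nilExp N Λ * (x' * nilExp N (-L))) *
          nilExp N L * nilExp N (-Λ) := by
        simp only [← mul_assoc]
        rw [h1, one_mul, mul_assoc (_ * x') (nilExp N (-L)), h2, mul_one]
    _ = nilExp N L * (y * (nilExp N (-L) * nilExp N Λ * nilExp N (-L))) * nilExp N L *
          nilExp N (-Λ) := by rw [← hx, ← mul_assoc (_ * nilExp N Λ), hw]
    _ = nilExp N L * y * nilExp N (-L) * (nilExp N Λ * (nilExp N (-L) * nilExp N L) *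
          nilExp N (-Λ)) := by simp only [mul_assoc]
    _ = nilExp N L * y * nilExp N (-L) := by rw [h2, mul_one, h3, mul_one]

/-- Let `M = [d, L]` commute with `L`, and let conjugation by `e^{-L} e^Λ e^{-L}` map `d` to `δ` and
`M` to `M'`. Then `e^{Λξ} d e^{-Λξ} = d + (δ - [L, M']) ξ - M' ξ²`. -/
theorem conjCoeff_of_weyl (h : DirectSum.IsInternal 𝒜) {N : ℕ} {L Λ d δ m m' : End ℝ A}
    (hL : L ^ N = 0) (hΛ : Λ ^ N = 0) (hL2 : IsOfDegree 𝒜 2 L) (hΛ2 : IsOfDegree 𝒜 (-2) Λ)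
    (hd : IsOfDegree 𝒜 1 d) (hm : IsOfDegree 𝒜 3 m) (hδ : IsOfDegree 𝒜 (-1) δ)
    (hm' : IsOfDegree 𝒜 (-3) m') (hdL : d * L = L * d + m) (hmL : L * m = m * L)
    (hwd : nilExp N (-L) * nilExp N Λ * nilExp N (-L) * d =
      δ * (nilExp N (-L) * nilExp N Λ * nilExp N (-L)))
    (hwm : nilExp N (-L) * nilExp N Λ * nilExp N (-L) * m =
      m' * (nilExp N (-L) * nilExp N Λ * nilExp N (-L))) :
    conjCoeff N Λ d 1 = δ - (L * m' - m' * L) ∧ conjCoeff N Λ d 2 = -m' ∧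
      ∀ j ≥ 3, conjCoeff N Λ d j = 0 := by
  have h1 := conj_of_weyl hL hΛ (nilExp_neg_mul_of_commutator hL hdL hmL) hwd
  have h2 : nilExp N (-L) * m = m * nilExp N (-L) :=
    nilExp_commute (Commute.neg_left hmL : Commute (-L) m)
  have h3 := conj_of_weyl hL hΛ h2 hwm
  have hzero : ∀ j, conjCoeff N Λ (0 : End ℝ A) j = 0 := fun j => by simp [conjCoeff]
  -- The degrees 3 - 2j and -3 + 2i agree exactly when i + j = 3.
  have hm0 : ∀ j, (∀ i : ℕ, i + j = 3 → conjCoeff N Λ m j = conjCoeff N L m' i) ∧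
      (3 < j → conjCoeff N Λ m j = 0) := by
    intro j
    have h4 := conjCoeff_component (z := 0) h hL hΛ hL2 hΛ2 hm (IsOfDegree.zero _) hm'
      (by rw [add_zero]; exact h3) j
    rw [hzero, add_zero] at h4
    exact ⟨fun i hi => h4.1 i (by omega), fun hj => h4.2 (by omega)⟩
  have hd0 := fun j => conjCoeff_component h hL hΛ hL2 hΛ2 hd hm hδ h1 j
  -- Degree -1 is the lowest one on the side of δ. It determines the coefficient of ξ; all lower
  -- degrees vanish there, which determines the remaining coefficients.
  have e1 := (hd0 1).1 0 (by norm_num)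
  have e2 := (hd0 2).2 (by norm_num)
  rw [(hm0 2).1 1 (by norm_num), conjCoeff_zero hL, conjCoeff_one hL] at e1
  rw [(hm0 3).1 0 (by norm_num), conjCoeff_zero hL] at e2
  refine ⟨eq_sub_of_add_eq e1, eq_neg_of_add_eq_zero_left e2, fun j hj => ?_⟩
  have e3 := (hd0 j).2 (by omega)
  rwa [(hm0 (j + 1)).2 (by omega), add_zero] at e3

/-- If `⋆ = c w R` is an involution and `y = ε ⋆ x ⋆ P`, then `w x = y w`, under the
commutation relation `R x = ε x P R`. -/
theorem weyl_mul_of_star {R : Type*} [Ring R] [Algebra ℝ R] {w r s P x y : R} {c ε : ℝ}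
    (hc : c * c = 1) (hε : ε * ε = 1) (hs : s = c • (w * r)) (hss : s * s = 1) (hP : P * P = 1)
    (hr : r * r = 1) (hPr : P * r = r * P) (hPw : P * w = w * P) (hrx : r * x = ε • (x * P * r))
    (hy : y = ε • (s * x * s * P)) : w * x = y * w := by
  have hPs : P * s = s * P := by
    rw [hs, mul_smul_comm, smul_mul_assoc, ← mul_assoc, hPw, mul_assoc, hPr, mul_assoc]
  have h1 : y * (s * P) = ε • (s * x) := by
    rw [hy, smul_mul_assoc, mul_assoc (s * x * s), ← mul_assoc P, hPs, mul_assoc s P P, hP,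
      mul_one, mul_assoc (s * x), hss, mul_one]
  -- Since c² = 1 and r² = 1, the Weyl element is recovered from the star. The identity is proved
  -- after multiplying by the involution P, which is removed at the end.
  have hw : w = c • (s * r) := by
    rw [hs, smul_mul_assoc, smul_smul, hc, one_smul, mul_assoc, hr, mul_one]
  have h2 : y * w * P = ε • (c • (s * x * r)) := by
    rw [hw, mul_smul_comm, smul_mul_assoc, mul_assoc y, mul_assoc s, ← hPr, ← mul_assoc s,
      ← mul_assoc y, h1, smul_mul_assoc, smul_comm]
  have h3 : s * x = c • (ε • (w * (x * P * r))) := by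
    rw [hs, smul_mul_assoc, mul_assoc, hrx, mul_smul_comm]
  have h4 : y * w * P = w * x * P := by
    rw [h2, h3, smul_mul_assoc, smul_mul_assoc, smul_smul c c, hc, one_smul,
      smul_smul, hε, one_smul, mul_assoc w, mul_assoc (x * P), hr, mul_one, mul_assoc]
  calc w * x = w * x * P * P := by rw [mul_assoc, hP, mul_one]
    _ = y * w := by rw [← h4, mul_assoc, hP, mul_one]

theorem coeff_expSeries_mul {N : ℕ} {a : End ℝ A} (h : a ^ N = 0) (x : End ℝ A) (n : ℕ) :
    PowerSeries.coeff n (expSeries a * PowerSeries.C x * expSeries (-a)) = conjCoeff N a x n := by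
  rw [conjCoeff_eq_sum h, PowerSeries.coeff_mul]
  refine Finset.sum_congr rfl fun ij _ => ?_
  rw [PowerSeries.coeff_mul_C, expSeries, expSeries, PowerSeries.coeff_mk, PowerSeries.coeff_mk]

/-- The coefficients of `e^{Λξ} d e^{-Λξ}`, in the situation of `conjCoeff_of_weyl`. -/
theorem opSeq_eq_conjCoeff (h : DirectSum.IsInternal 𝒜) {N : ℕ} {L Λ d δ m m' : End ℝ A}
    (hL : L ^ N = 0) (hΛ : Λ ^ N = 0) (hL2 : IsOfDegree 𝒜 2 L) (hΛ2 : IsOfDegree 𝒜 (-2) Λ)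
    (hd : IsOfDegree 𝒜 1 d) (hm : IsOfDegree 𝒜 3 m) (hδ : IsOfDegree 𝒜 (-1) δ)
    (hm' : IsOfDegree 𝒜 (-3) m') (hdL : gradedBracket 1 2 d L = m) (hmL : L * m = m * L)
    (hwd : nilExp N (-L) * nilExp N Λ * nilExp N (-L) * d =
      δ * (nilExp N (-L) * nilExp N Λ * nilExp N (-L)))
    (hwm : nilExp N (-L) * nilExp N Λ * nilExp N (-L) * m =
      m' * (nilExp N (-L) * nilExp N Λ * nilExp N (-L))) (n : ℕ) :
    opSeq d (δ + (m' * L - L * m')) (-m') n = conjCoeff N Λ d n := by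
  have hs : sgn ℝ (1 * 2) = 1 := sgn_of_even (by decide)
  rw [gradedBracket, hs, one_smul] at hdL
  obtain ⟨h1, h2, h3⟩ := conjCoeff_of_weyl h hL hΛ hL2 hΛ2 hd hm hδ hm'
    (by rw [← hdL]; exact (add_sub_cancel _ _).symm) hmL hwd hwm
  match n with
  | 0 => exact (conjCoeff_zero hΛ _).symm
  | 1 =>
    rw [h1]
    change δ + (m' * L - L * m') = _
    abel
  | 2 => rw [h2]; rfl
  | n + 3 => rw [h3 _ (by omega)]; rfl

/-- The first-order term of a conjugation is a commutator; its sign is trivial since Λ is even. -/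
theorem gradedBracket_eq_of_conjCoeff {N : ℕ} {Λ d Δ₁ Δ₂ : End ℝ A} (hN : Λ ^ N = 0)
    (h : ∀ n, opSeq d Δ₁ Δ₂ n = conjCoeff N Λ d n) : gradedBracket (-2) 1 Λ d = Δ₁ := by
  have hs : sgn ℝ (-2 * 1) = 1 := sgn_of_even (by decide)
  rw [gradedBracket, hs, one_smul, ← conjCoeff_one hN]
  exact (h 1).symm

/-- The quadratic relations are the coefficients of the conjugate of d² = 0. For the orders, Δ₁ =
[Λ, d] and Δ₂ = ½[Λ, Δ₁], and a bracket with an operator of order ≤ 2 raises the order by at most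
one. -/
theorem isCommBVInfinityAlgebra_of_conjCoeff {N : ℕ} {Λ d Δ₁ Δ₂ : End ℝ A}
    (hdg : IsCommDGAlgebra 𝒜 d) (hN : Λ ^ N = 0) (hΛ : HasOrderLE 𝒜 2 (-2) Λ)
    (hd : HasOrderLE 𝒜 1 1 d) (h : ∀ n, opSeq d Δ₁ Δ₂ n = conjCoeff N Λ d n) :
    IsCommBVInfinityAlgebra 𝒜 (opSeq d Δ₁ Δ₂) where
  commDGAlgebra := hdg
  multicomplex :=
    { degree := fun i => by
        rw [h]
        have := isOfDegree_conjCoeff hN hΛ.1 hdg.degree i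
        rwa [show (1 : ℤ) + i * -2 = 1 - 2 * i by ring] at this
      sum_eq_zero := fun n => by
        simp only [h]
        rw [← Finset.Nat.sum_antidiagonal_eq_sum_range_succ
            (fun i j => conjCoeff N Λ d i * conjCoeff N Λ d j),
          conjCoeff_mul hN, hdg.sq_zero]
        simp [conjCoeff] }
  order n := by
    have e2 : Δ₂ = (2 : ℝ)⁻¹ • gradedBracket (-2) (-1) Λ Δ₁ := by
      have hs : sgn ℝ (-2 * -1) = 1 := sgn_of_even (by decide)
      have h1 : Δ₁ = _ := h 1
      have h2 : Δ₂ = _ := h 2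
      rw [gradedBracket, hs, one_smul, eq_inv_smul_iff₀ two_ne_zero, h1, h2]
      exact conjCoeff_two hN _
    have h1 : HasOrderLE 𝒜 (1 + 1) (-1) Δ₁ := by
      rw [← gradedBracket_eq_of_conjCoeff hN h]
      exact hΛ.gradedBracket (s := 0) hd
    match n with
    | 0 => exact hd
    | 1 => exact h1
    | 2 =>
      change HasOrderLE _ _ _ Δ₂
      rw [e2]
      exact (hΛ.gradedBracket h1).smul _
    | n + 3 => exact HasOrderLE.zero _ _

theorem total_differential_eq {N : ℕ} {Λ d Δ₁ Δ₂ : End ℝ A} (hN : Λ ^ N = 0)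
    (h : ∀ n, opSeq d Δ₁ Δ₂ n = conjCoeff N Λ d n) :
    PowerSeries.C d + PowerSeries.C Δ₁ * PowerSeries.X + PowerSeries.C Δ₂ * PowerSeries.X ^ 2 =
      expSeries Λ * PowerSeries.C d * expSeries (-Λ) := by
  ext1 n
  rw [coeff_expSeries_mul hN, ← h, map_add, map_add, PowerSeries.coeff_C_mul,
    PowerSeries.coeff_C_mul, PowerSeries.coeff_X, PowerSeries.coeff_X_pow, PowerSeries.coeff_C]
  match n with
  | 0 => simp [opSeq]
  | 1 => simp [opSeq]
  | 2 => simp [opSeq]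
  | n + 3 => simp [opSeq]

end Conjugation

/-! ### Orders of operators on forms -/

section Order

variable {E : Type*} [NormedAddCommGroup E] [NormedSpace ℝ E]
  {M : Type*} [TopologicalSpace M] [ChartedSpace E M]

/-- Left multiplication by a form, as a smooth family of operators on the fibres. -/
def mulLeftOp (a : DiffForm E M) : smoothOps E M := ⟨_, mulLeft_mem_smoothOps a⟩

/-- Multiplication by a form acts fibre by fibre, so the brackets do too; at order 0 the multiplier
is the smooth form T(1). -/
theorem hasOrderLE_liftOp {r : ℕ} {k : ℤ} {T : smoothOps E M}
    (h : ∀ x, HasOrderLE (extDeg (Dual ℝ (TangentSpace 𝓘(ℝ, E) x))) r k (T.1 x)) :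
    HasOrderLE (formsOfDegree E M) r k (liftOp E M T) := by
  induction r generalizing k T with
  | zero =>
    have h1 : ∀ x u, T.1 x u = T.1 x 1 * u := by
      intro x u
      obtain ⟨a, _, ha⟩ := h x
      rw [ha, LinearMap.mulLeft_apply, LinearMap.mulLeft_apply, mul_one]
    refine ⟨liftOp E M T 1, fun x => ?_, LinearMap.ext fun u => Subtype.ext (funext fun x => ?_)⟩
    · obtain ⟨a, ha, haT⟩ := h x
      change T.1 x 1 ∈ _
      rwa [haT, LinearMap.mulLeft_apply, mul_one]
    · exact h1 x (u.1 x)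
  | succ r ih =>
    refine ⟨isOfDegree_liftOp fun x => (h x).1, fun j a ha => ?_⟩
    have h1 : gradedBracket j k (LinearMap.mulLeft ℝ a) (liftOp E M T) =
        liftOp E M (mulLeftOp a * T - sgn ℝ (j * k) • (T * mulLeftOp a)) := rfl
    rw [h1]
    exact ih fun x => (h x).2 j (a.1 x) (ha x)

variable [FiniteDimensional ℝ E] [IsManifold 𝓘(ℝ, E) ∞ M]

theorem extD_mul_of_mem {p : ℤ} {a : DiffForm E M} (ha : a ∈ formsOfDegree E M p)
    (b : DiffForm E M) : extD E M (a * b) = extD E M a * b + sgn ℝ p • (a * extD E M b) := by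
  rw [extD_mul, parity_apply_of_mem E ha, smul_mul_assoc]

theorem isCommDGAlgebra_forms : IsCommDGAlgebra (formsOfDegree E M) (extD E M) where
  isInternal := isInternal_formsOfDegree
  one_mem := one_mem_formsOfDegree
  mul_mem _ _ _ ha _ hb := mul_mem_formsOfDegree ha hb
  graded_comm _ _ _ ha _ hb := formsOfDegree_graded_comm ha hb
  degree _ _ ha := extD_mem ha
  leibniz _ _ ha b := extD_mul_of_mem ha b
  sq_zero := LinearMap.ext fun a => extD_extD a

/-- By the Leibniz rule [a, d] is, up to sign, multiplication by da. -/
theorem hasOrderLE_extD : HasOrderLE (formsOfDegree E M) 1 1 (extD E M) := by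
  refine ⟨fun _ _ ha => extD_mem ha, fun j a ha => ?_⟩
  refine ⟨-sgn ℝ j • extD E M a, Submodule.smul_mem _ _ (extD_mem ha), LinearMap.ext fun b => ?_⟩
  rw [gradedBracket, mul_one, LinearMap.sub_apply, LinearMap.smul_apply, Module.End.mul_apply,
    Module.End.mul_apply, LinearMap.mulLeft_apply, LinearMap.mulLeft_apply,
    LinearMap.mulLeft_apply, extD_mul_of_mem ha, smul_add, smul_smul, sgn_mul_self, one_smul,
    smul_mul_assoc, neg_smul]
  abel

/-- Reversal and the exterior derivative. -/
theorem reverse_extD (r : End ℝ (DiffForm E M))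
    (hr : ∀ (k : ℕ), ∀ a ∈ formsOfDegree E M k, r a = (-1 : ℝ) ^ k.choose 2 • a) :
    r * extD E M = extD E M * parity E * r := by
  refine eq_of_homogeneous (𝕜 := ℝ) (A := DiffForm E M) isInternal_formsOfDegree fun k a ha => ?_
  rcases lt_or_ge k 0 with hk | hk
  · rw [formsOfDegree_neg hk] at ha
    rw [(Submodule.mem_bot ℝ).1 ha, map_zero, map_zero]
  · obtain ⟨k, rfl⟩ := Int.eq_ofNat_of_zero_le hk
    have h1 : extD E M a ∈ formsOfDegree E M ((k + 1 : ℕ) : ℤ) := by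
      push_cast
      exact extD_mem ha
    rw [Module.End.mul_apply, Module.End.mul_apply, Module.End.mul_apply, hr _ _ ha, hr _ _ h1,
      map_smul, map_smul, parity_apply_of_mem E ha, map_smul, smul_smul]
    congr 1
    have h2 : sgn ℝ (k : ℤ) = (-1 : ℝ) ^ k := by simp [sgn]
    -- The reversal signs in degrees k + 1 and k differ by (-1)^k, which is the parity.
    rw [h2, Nat.choose_succ_succ' k 1, Nat.choose_one_right, pow_add, mul_comm]

end Order

/-! ### Operators of an almost symplectic manifold -/

namespace AlmostSymplecticForm

variable {E : Type*} [NormedAddCommGroup E] [NormedSpace ℝ E] [FiniteDimensional ℝ E]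
  {M : Type*} [TopologicalSpace M] [ChartedSpace E M] [IsManifold 𝓘(ℝ, E) ∞ M]
  (Ω : AlmostSymplecticForm E M)

variable (E M) in
/-- Reversal of forms, as a smooth family of operators on the fibres. -/
def revOp : smoothOps E M := ⟨_, revEnd_mem_smoothOps⟩

/-- The adjoint of left multiplication by a form, as a smooth family of operators on the fibres. -/
def contractOp (u : DiffForm E M) : smoothOps E M :=
  ⟨_, contractForm_mem_smoothOps Ω.form Ω.nondegenerate (liftOp E M (revOp E M) u)⟩

/-- The operator `e^{-L} e^Λ e^{-L}`, as a smooth family of operators on the fibres. -/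
def weylOp : smoothOps E M :=
  nilExp (finrank ℝ E + 1) (-mulLeftOp Ω.form) *
    nilExp (finrank ℝ E + 1) (Ω.contractOp Ω.form) *
    nilExp (finrank ℝ E + 1) (-mulLeftOp Ω.form)

/-- The symplectic star, as a smooth family of operators on the fibres. -/
def starOp : smoothOps E M := ((-1 : ℝ) ^ (finrank ℝ E / 2)) • (Ω.weylOp * revOp E M)

/-- Evaluation at a point is an algebra homomorphism, so it commutes with the truncated
exponentials. -/
theorem weylOp_apply (x : M) : Ω.weylOp.1 x =
    fibreWeyl (finrank ℝ E + 1) (Ω.form.1 x) (Ω.nondegenerate x) := by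
  let ev : smoothOps E M →ₐ[ℝ] End ℝ (CotangentExt E M x) :=
    (Pi.evalAlgHom ℝ (fun x : M => End ℝ (CotangentExt E M x)) x).comp (smoothOps E M).val
  change ev Ω.weylOp = _
  have h1 := map_nilExp ev (finrank ℝ E + 1) (-mulLeftOp Ω.form)
  have h2 := map_nilExp ev (finrank ℝ E + 1) (Ω.contractOp Ω.form)
  rw [weylOp, map_mul, map_mul, h1, h2]
  rfl

theorem starOp_apply (x : M) : Ω.starOp.1 x =
    fibreStar (finrank ℝ E + 1) (Ω.form.1 x) (Ω.nondegenerate x) := by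
  rw [fibreStar, ← weylOp_apply]
  rfl

theorem finrank_tangentSpace_lt (x : M) :
    finrank ℝ (TangentSpace 𝓘(ℝ, E) x) < finrank ℝ E + 1 := Nat.lt_succ_self _

theorem mulLeftOp_pow : mulLeftOp Ω.form ^ (finrank ℝ E + 1) = 0 :=
  Subtype.ext (funext fun x => mulLeft_form_pow (finrank_tangentSpace_lt x) (Ω.degree_two x))

theorem contractOp_pow : Ω.contractOp Ω.form ^ (finrank ℝ E + 1) = 0 :=
  Subtype.ext (funext fun x =>
    fibreLambda_pow (finrank_tangentSpace_lt x) (Ω.degree_two x) (Ω.nondegenerate x))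

theorem starOp_starOp : Ω.starOp * Ω.starOp = 1 := by
  refine Subtype.ext (funext fun x => LinearMap.ext fun u => ?_)
  change Ω.starOp.1 x (Ω.starOp.1 x u) = u
  rw [starOp_apply]
  exact fibreStar_fibreStar (finrank_tangentSpace_lt x) (Ω.degree_two x) (Ω.nondegenerate x) u

theorem isSymplecticStar_starOp : Ω.IsSymplecticStar (liftOp E M Ω.starOp) where
  degree k β hβ x := by
    rw [liftOp_apply, starOp_apply]
    exact fibreStar_mem_extDeg (finrank_tangentSpace_lt x) (Ω.degree_two x) (Ω.nondegenerate x)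
      (hβ x)
  wedge_star k α hα β hβ x := by
    change α.1 x * (liftOp E M Ω.starOp β).1 x = _
    rw [liftOp_apply, starOp_apply]
    exact mul_fibreStar (finrank_tangentSpace_lt x) (Ω.degree_two x) (Ω.nondegenerate x)
      (hα x) (hβ x)

theorem isSymplecticAdjoint_contractOp (u : DiffForm E M) :
    Ω.IsSymplecticAdjoint (LinearMap.mulLeft ℝ u) (liftOp E M (Ω.contractOp u)) :=
  fun α β x => extPairing_mul (formBilin (Ω.form.1 x)) (Ω.nondegenerate x) (u.1 x) (α.1 x) (β.1 x)

theorem isSymplecticAdjoint_lefschetz :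
    Ω.IsSymplecticAdjoint (liftOp E M (Ω.contractOp Ω.form)) Ω.lefschetz :=
  fun α β x => extPairing_contractForm_reverse (Ω.degree_two x) (Ω.nondegenerate x)
    (α.1 x) (β.1 x)

/-- By the Leibniz rule only dω survives. Hence [d, L] is linear over functions, has a fibrewise
adjoint and commutes with L. -/
theorem bracketDL_eq : Ω.bracketDL = LinearMap.mulLeft ℝ (extD E M Ω.form) := by
  refine LinearMap.ext fun a => ?_
  have h : sgn ℝ (1 * 2) = 1 := sgn_of_even (by decide)
  rw [bracketDL, gradedBracket, h, one_smul, LinearMap.sub_apply, Module.End.mul_apply,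
    Module.End.mul_apply, lefschetz, LinearMap.mulLeft_apply, LinearMap.mulLeft_apply,
    LinearMap.mulLeft_apply, extD_mul_of_mem Ω.degree_two, sgn_of_even even_two, one_smul,
    add_sub_cancel_right]

section Uniqueness

variable [T2Space M]

/-- Values of global forms fill each fibre, and the pairing there is nondegenerate. -/
theorem isSymplecticAdjoint_unique {φ ψ ψ' : End ℝ (DiffForm E M)}
    (h : Ω.IsSymplecticAdjoint φ ψ) (h' : Ω.IsSymplecticAdjoint φ ψ') : ψ = ψ' := by
  refine LinearMap.ext fun β => Subtype.ext (funext fun x => ?_)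
  refine sub_eq_zero.1 (eq_zero_of_extPairing (formBilin (Ω.form.1 x)) (Ω.nondegenerate x)
    fun u => ?_)
  obtain ⟨α, rfl⟩ := exists_form_apply_eq x u
  rw [map_sub, sub_eq_zero]
  exact (h α β x).symm.trans (h' α β x)

theorem adjoint_eq {φ ψ : End ℝ (DiffForm E M)} (h : Ω.IsSymplecticAdjoint φ ψ) :
    Ω.adjoint φ = ψ :=
  Ω.isSymplecticAdjoint_unique (Classical.epsilon_spec (p := Ω.IsSymplecticAdjoint φ) ⟨ψ, h⟩) h

theorem existsUnique_isSymplecticAdjoint {φ ψ : End ℝ (DiffForm E M)}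
    (h : Ω.IsSymplecticAdjoint φ ψ) : ∃! ψ, Ω.IsSymplecticAdjoint φ ψ :=
  ⟨ψ, h, fun _ h' => Ω.isSymplecticAdjoint_unique h' h⟩

/-- The difference `y` of two candidates at a point has zero product with all forms of degree k.
With y = ⋆z this says that z is orthogonal to all of them, so z and y vanish. -/
theorem isSymplecticStar_unique {σ : End ℝ (DiffForm E M)} (h : Ω.IsSymplecticStar σ) :
    σ = liftOp E M Ω.starOp := by
  refine eq_of_homogeneous (𝕜 := ℝ) (A := DiffForm E M) isInternal_formsOfDegree fun k β hβ =>
    Subtype.ext (funext fun x => sub_eq_zero.1 ?_)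
  have hN := finrank_tangentSpace_lt (E := E) x
  have hη := Ω.degree_two x
  have hB := Ω.nondegenerate x
  have h0 := Ω.isSymplecticStar_starOp
  set y := (σ β).1 x - (liftOp E M Ω.starOp β).1 x with hy
  have hymem : y ∈ extDeg (Dual ℝ (TangentSpace 𝓘(ℝ, E) x)) (2 * ((finrank ℝ E / 2 : ℕ) : ℤ) - k) :=
    sub_mem (h.degree k β hβ x) (h0.degree k β hβ x)
  have hz : fibreStar (finrank ℝ E + 1) (Ω.form.1 x) hB y ∈
      extDeg (Dual ℝ (TangentSpace 𝓘(ℝ, E) x)) k := by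
    have := fibreStar_mem_extDeg hN hη hB hymem
    rwa [show 2 * ((finrank ℝ (TangentSpace 𝓘(ℝ, E) x) / 2 : ℕ) : ℤ) -
      (2 * ((finrank ℝ E / 2 : ℕ) : ℤ) - k) = k from sub_sub_cancel _ _] at this
  -- The volume form is nonzero because its star is 1.
  have hvol : divPow (Ω.form.1 x) (finrank ℝ (TangentSpace 𝓘(ℝ, E) x) / 2) ≠ 0 := fun h0 => by
    have := fibreStar_divPow hN hη hB
    rw [h0, map_zero] at this
    exact zero_ne_one this
  have hz0 : fibreStar (finrank ℝ E + 1) (Ω.form.1 x) hB y = 0 := by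
    refine eq_zero_of_extPairing_homogeneous _ hB hz fun u hu => ?_
    obtain ⟨α, hα, rfl⟩ := exists_form_apply_eq_of_mem x hu
    have h1 := mul_fibreStar hN hη hB hu hz
    rw [fibreStar_fibreStar hN hη, hy, mul_sub] at h1
    have h2 := (h.wedge_star k α hα β hβ x).trans (h0.wedge_star k α hα β hβ x).symm
    have h3 : α.1 x * (σ β).1 x = α.1 x * (liftOp E M Ω.starOp β).1 x := h2
    rw [h3, sub_self] at h1
    exact (smul_eq_zero.1 h1.symm).resolve_right hvol
  rw [← fibreStar_fibreStar hN hη hB y, hz0, map_zero]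

theorem hodgeStar_eq : Ω.hodgeStar = liftOp E M Ω.starOp :=
  Ω.isSymplecticStar_unique
    (Classical.epsilon_spec (p := Ω.IsSymplecticStar) ⟨_, Ω.isSymplecticStar_starOp⟩)

theorem dualLefschetz_eq : Ω.dualLefschetz = liftOp E M (Ω.contractOp Ω.form) :=
  Ω.adjoint_eq (Ω.isSymplecticAdjoint_contractOp Ω.form)

theorem adjoint_bracketDL_eq :
    Ω.adjoint Ω.bracketDL = liftOp E M (Ω.contractOp (extD E M Ω.form)) := by
  rw [bracketDL_eq]
  exact Ω.adjoint_eq (Ω.isSymplecticAdjoint_contractOp _)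

/-- Adjunction reverses products and sends Λ to L, so it turns Λm - mΛ into m'L - Lm'. -/
theorem isSymplecticAdjoint_bracketLambdaDL :
    Ω.IsSymplecticAdjoint Ω.bracketLambdaDL
      (Ω.adjoint Ω.bracketDL * Ω.lefschetz - Ω.lefschetz * Ω.adjoint Ω.bracketDL) := by
  have h : sgn ℝ (-2 * 3) = 1 := sgn_of_even (by decide)
  have h1 := Ω.isSymplecticAdjoint_lefschetz
  have h2 := Ω.isSymplecticAdjoint_contractOp (extD E M Ω.form)
  intro α β x
  rw [bracketLambdaDL, gradedBracket, h, one_smul, adjoint_bracketDL_eq, dualLefschetz_eq,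
    bracketDL_eq]
  change Ω.fibrePairing x (_ - _) _ = Ω.fibrePairing x _ (_ - _)
  rw [map_sub, map_sub, LinearMap.sub_apply]
  congr 1
  · exact (h1 _ _ _).trans (h2 _ _ _)
  · exact (h2 _ _ _).trans (h1 _ _ _)

theorem dualLefschetz_eq_star : Ω.dualLefschetz = Ω.hodgeStar * Ω.lefschetz * Ω.hodgeStar := by
  rw [dualLefschetz_eq, hodgeStar_eq]
  refine LinearMap.ext fun α => Subtype.ext (funext fun x => ?_)
  change _ = Ω.starOp.1 x (Ω.form.1 x * Ω.starOp.1 x (α.1 x))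
  rw [starOp_apply]
  exact (fibreStar_mul_fibreStar_deg_two (finrank_tangentSpace_lt x) (Ω.degree_two x)
    (Ω.nondegenerate x) (Ω.degree_two x) (α.1 x)).symm

theorem adjoint_bracketDL_eq_star :
    Ω.adjoint Ω.bracketDL = -(Ω.hodgeStar * Ω.bracketDL * Ω.hodgeStar * parity E) := by
  rw [adjoint_bracketDL_eq, hodgeStar_eq, bracketDL_eq]
  refine LinearMap.ext fun α => Subtype.ext (funext fun x => ?_)
  change _ = -(Ω.starOp.1 x ((extD E M Ω.form).1 x * Ω.starOp.1 x
    (CliffordAlgebra.involute (α.1 x))))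
  rw [starOp_apply]
  exact (fibreStar_mul_fibreStar_deg_three (finrank_tangentSpace_lt x) (Ω.degree_two x)
    (Ω.nondegenerate x) (extD_mem Ω.degree_two x) (α.1 x)).symm

end Uniqueness

end AlmostSymplecticForm

/-! ### The commutative BV-infinity algebra of an almost symplectic manifold -/

namespace AlmostSymplecticForm

variable {E : Type*} [NormedAddCommGroup E] [NormedSpace ℝ E] [FiniteDimensional ℝ E]
  {M : Type*} [TopologicalSpace M] [ChartedSpace E M] [IsManifold 𝓘(ℝ, E) ∞ M]
  (Ω : AlmostSymplecticForm E M)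

theorem isOfDegree_mulLeft_form {k : ℤ} {u : DiffForm E M} (hu : u ∈ formsOfDegree E M k) :
    IsOfDegree (formsOfDegree E M) k (LinearMap.mulLeft ℝ u) := fun p a ha x => by
  rw [add_comm]
  exact mul_mem_extDeg (hu x) (ha x)

theorem isOfDegree_contractOp {p : ℤ} {u : DiffForm E M} (hu : u ∈ formsOfDegree E M p) :
    IsOfDegree (formsOfDegree E M) (-p) (liftOp E M (Ω.contractOp u)) :=
  isOfDegree_liftOp fun x _ _ ha =>
    contractForm_mem_extDeg (formBilin (Ω.form.1 x)) (Ω.nondegenerate x)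
      (reverse_mem_extDeg (hu x)) ha

theorem lefschetz_pow : Ω.lefschetz ^ (finrank ℝ E + 1) = 0 := by
  have h := congrArg (liftOp E M) Ω.mulLeftOp_pow
  rwa [map_pow, map_zero] at h

theorem contractOp_form_pow : liftOp E M (Ω.contractOp Ω.form) ^ (finrank ℝ E + 1) = 0 := by
  rw [← map_pow, contractOp_pow, map_zero]

theorem hasOrderLE_contractOp :
    HasOrderLE (formsOfDegree E M) 2 (-2) (liftOp E M (Ω.contractOp Ω.form)) :=
  hasOrderLE_liftOp fun x => hasOrderLE_contractForm (formBilin (Ω.form.1 x)) (Ω.nondegenerate x)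
    (reverse_mem_extDeg (Ω.degree_two x))

theorem liftOp_weylOp : liftOp E M Ω.weylOp =
    nilExp (finrank ℝ E + 1) (-Ω.lefschetz) *
      nilExp (finrank ℝ E + 1) (liftOp E M (Ω.contractOp Ω.form)) *
      nilExp (finrank ℝ E + 1) (-Ω.lefschetz) := by
  have h : ∀ T : smoothOps E M, liftOp E M (nilExp (finrank ℝ E + 1) T) =
      nilExp (finrank ℝ E + 1) (liftOp E M T) := fun T => by
    simp only [nilExp, map_sum, map_smul, map_pow]
  have h3 : liftOp E M (-mulLeftOp Ω.form) = -Ω.lefschetz := rfl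
  rw [weylOp, map_mul, map_mul, h, h, h3]

theorem parity_mul_parity : parity E * parity E = (1 : End ℝ (DiffForm E M)) :=
  LinearMap.ext fun a => Subtype.ext (funext fun x => involute_involute (a.1 x))

theorem revOp_mul_revOp : liftOp E M (revOp E M) * liftOp E M (revOp E M) = 1 :=
  LinearMap.ext fun a => Subtype.ext (funext fun x => CliffordAlgebra.reverse_reverse (a.1 x))

theorem parity_mul_revOp : parity E * liftOp E M (revOp E M) = liftOp E M (revOp E M) * parity E :=
  LinearMap.ext fun a => Subtype.ext (funext fun x => (reverse_involute (a.1 x)).symm)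

theorem fibreWeyl_involute {V : Type*} [AddCommGroup V] [Module ℝ V] [FiniteDimensional ℝ V] {N : ℕ}
    {η : ExteriorAlgebra ℝ (Dual ℝ V)} (hη : η ∈ extDeg (Dual ℝ V) 2)
    (hB : (formBilin η).Nondegenerate) (u : ExteriorAlgebra ℝ (Dual ℝ V)) :
    CliffordAlgebra.involute (fibreWeyl N η hB u) =
      fibreWeyl N η hB (CliffordAlgebra.involute u) :=
  (DFunLike.congr_fun (fibreWeyl_mul_par hη hB) u).symm

theorem parity_mul_weylOp : parity E * liftOp E M Ω.weylOp = liftOp E M Ω.weylOp * parity E := by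
  refine LinearMap.ext fun a => Subtype.ext (funext fun x => ?_)
  change CliffordAlgebra.involute (Ω.weylOp.1 x (a.1 x)) =
    Ω.weylOp.1 x (CliffordAlgebra.involute (a.1 x))
  rw [weylOp_apply]
  exact fibreWeyl_involute (Ω.degree_two x) (Ω.nondegenerate x) (a.1 x)

theorem revOp_mul_extD : liftOp E M (revOp E M) * extD E M =
    extD E M * parity E * liftOp E M (revOp E M) :=
  reverse_extD _ fun _ _ ha => Subtype.ext (funext fun x => reverse_of_mem_extDeg (ha x))

theorem revOp_mul_mulLeft {u : DiffForm E M} (hu : u ∈ formsOfDegree E M 3) :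
    liftOp E M (revOp E M) * LinearMap.mulLeft ℝ u =
      (-1 : ℝ) • (LinearMap.mulLeft ℝ u * parity E * liftOp E M (revOp E M)) := by
  refine eq_of_homogeneous (𝕜 := ℝ) (A := DiffForm E M) isInternal_formsOfDegree fun k a ha =>
    Subtype.ext (funext fun x => ?_)
  have hu3 : CliffordAlgebra.reverse (u.1 x) = (-1 : ℝ) • u.1 x := by
    rw [reverse_of_mem_extDeg (k := 3) (hu x)]
    norm_num [Nat.choose]
  have h1 : sgn ℝ (k * 3) = sgn ℝ k := by
    rcases Int.even_or_odd k with hk | hk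
    · rw [sgn_of_even hk, sgn_of_even (hk.mul_right 3)]
    · rw [sgn_of_odd hk, sgn_of_odd (hk.mul (by decide))]
  have hrev := reverse_mem_extDeg (ha x)
  change CliffordAlgebra.reverse (u.1 x * a.1 x) =
    (-1 : ℝ) • (u.1 x * CliffordAlgebra.involute (CliffordAlgebra.reverse (a.1 x)))
  rw [CliffordAlgebra.reverse.map_mul, hu3, involute_of_mem_extDeg hrev, mul_smul_comm,
    mul_smul_comm, extDeg_graded_comm hrev (hu x), h1]

/-! ### The Weyl element conjugates d to d^ω, and the resulting BV-infinity structure -/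

section

variable [T2Space M]

theorem hodgeStar_eq_weyl : Ω.hodgeStar =
    ((-1 : ℝ) ^ (finrank ℝ E / 2)) • (liftOp E M Ω.weylOp * liftOp E M (revOp E M)) := by
  rw [hodgeStar_eq, starOp, map_smul, map_mul]

theorem hodgeStar_mul_hodgeStar : Ω.hodgeStar * Ω.hodgeStar = 1 := by
  rw [hodgeStar_eq, ← map_mul, starOp_starOp, map_one]

/-- The star is the Weyl element times reversal, and reversal commutes with d up to the very parity
that enters the definition of d^ω. -/
theorem weyl_mul_extD : liftOp E M Ω.weylOp * extD E M = Ω.codiff * liftOp E M Ω.weylOp := by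
  refine weyl_mul_of_star (R := End ℝ (DiffForm E M)) (c := (-1 : ℝ) ^ (finrank ℝ E / 2))
    (ε := 1) ?_ (mul_one 1)
    Ω.hodgeStar_eq_weyl Ω.hodgeStar_mul_hodgeStar (parity_mul_parity (E := E) (M := M))
    (revOp_mul_revOp (E := E) (M := M)) (parity_mul_revOp (E := E) (M := M))
    Ω.parity_mul_weylOp ?_ ?_
  · rw [← mul_pow, neg_one_mul, neg_neg, one_pow]
  · rw [one_smul, revOp_mul_extD]
  · rw [one_smul, codiff]

/-- As for d, except that reversing a 3-form costs one more sign, in accordance with the (-1)^{k+1}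
in the formula for the adjoint. -/
theorem weyl_mul_bracketDL : liftOp E M Ω.weylOp * Ω.bracketDL =
    Ω.adjoint Ω.bracketDL * liftOp E M Ω.weylOp := by
  refine weyl_mul_of_star (R := End ℝ (DiffForm E M)) (c := (-1 : ℝ) ^ (finrank ℝ E / 2))
    (ε := -1) ?_ (by norm_num)
    Ω.hodgeStar_eq_weyl Ω.hodgeStar_mul_hodgeStar (parity_mul_parity (E := E) (M := M))
    (revOp_mul_revOp (E := E) (M := M)) (parity_mul_revOp (E := E) (M := M))
    Ω.parity_mul_weylOp ?_ ?_
  · rw [← mul_pow, neg_one_mul, neg_neg, one_pow]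
  · rw [bracketDL_eq]
    exact revOp_mul_mulLeft (extD_mem Ω.degree_two)
  · rw [adjoint_bracketDL_eq_star]
    exact (neg_one_smul ℝ (M := End ℝ (DiffForm E M)) _).symm

theorem isOfDegree_codiff : IsOfDegree (formsOfDegree E M) (-1) Ω.codiff := by
  intro k a ha
  have hstar := (hodgeStar_eq Ω ▸ Ω.isSymplecticStar_starOp).degree
  have h1 : parity E a ∈ formsOfDegree E M k := by
    rw [parity_apply_of_mem E ha]
    exact Submodule.smul_mem _ _ ha
  have h2 := hstar _ _ (extD_mem (hstar _ _ h1))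
  rw [show ∀ n : ℤ, n - (n - k + 1) = k + -1 from fun n => by ring] at h2
  exact h2

theorem dualLefschetz_pow : Ω.dualLefschetz ^ (finrank ℝ E + 1) = 0 := by
  rw [dualLefschetz_eq, contractOp_form_pow]

theorem isOfDegree_dualLefschetz : IsOfDegree (formsOfDegree E M) (-2) Ω.dualLefschetz := by
  rw [dualLefschetz_eq]
  exact Ω.isOfDegree_contractOp Ω.degree_two

theorem hasOrderLE_dualLefschetz : HasOrderLE (formsOfDegree E M) 2 (-2) Ω.dualLefschetz := by
  rw [dualLefschetz_eq]
  exact Ω.hasOrderLE_contractOp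

theorem isOfDegree_bracketDL : IsOfDegree (formsOfDegree E M) 3 Ω.bracketDL := by
  rw [bracketDL_eq]
  exact isOfDegree_mulLeft_form (extD_mem Ω.degree_two)

theorem isOfDegree_adjoint_bracketDL :
    IsOfDegree (formsOfDegree E M) (-3) (Ω.adjoint Ω.bracketDL) := by
  rw [adjoint_bracketDL_eq]
  exact Ω.isOfDegree_contractOp (extD_mem Ω.degree_two)

theorem lefschetz_mul_bracketDL : Ω.lefschetz * Ω.bracketDL = Ω.bracketDL * Ω.lefschetz := by
  rw [bracketDL_eq]
  refine LinearMap.ext fun a => ?_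
  have h : sgn ℝ (2 * 3) = 1 := sgn_of_even (by decide)
  have h1 : Ω.form * extD E M Ω.form = extD E M Ω.form * Ω.form := by
    rw [formsOfDegree_graded_comm Ω.degree_two (extD_mem Ω.degree_two)]
    exact (congrArg (· • _) h).trans (one_smul ℝ _)
  change Ω.form * (extD E M Ω.form * a) = extD E M Ω.form * (Ω.form * a)
  rw [← mul_assoc, h1, mul_assoc]

theorem delta₁_eq : Ω.delta₁ =
    Ω.codiff + (Ω.adjoint Ω.bracketDL * Ω.lefschetz - Ω.lefschetz * Ω.adjoint Ω.bracketDL) := by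
  rw [delta₁, Ω.adjoint_eq Ω.isSymplecticAdjoint_bracketLambdaDL]

/-- The coefficients of `e^{Λξ} d e^{-Λξ}`. -/
theorem opSeq_eq_conjCoeff (n : ℕ) : opSeq (extD E M) Ω.delta₁ Ω.delta₂ n =
    conjCoeff (finrank ℝ E + 1) Ω.dualLefschetz (extD E M) n := by
  have hw := Ω.liftOp_weylOp
  rw [← dualLefschetz_eq] at hw
  have h1 := Ω.weyl_mul_extD
  have h2 := Ω.weyl_mul_bracketDL
  rw [hw] at h1 h2
  rw [delta₁_eq]
  exact SymplForms.opSeq_eq_conjCoeff (A := DiffForm E M) isInternal_formsOfDegree Ω.lefschetz_pow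
    Ω.dualLefschetz_pow (isOfDegree_mulLeft_form Ω.degree_two) Ω.isOfDegree_dualLefschetz
    (fun _ _ ha => extD_mem ha) Ω.isOfDegree_bracketDL Ω.isOfDegree_codiff
    Ω.isOfDegree_adjoint_bracketDL rfl Ω.lefschetz_mul_bracketDL h1 h2 n

theorem delta₁_eq_bracket : gradedBracket (-2) 1 Ω.dualLefschetz (extD E M) = Ω.delta₁ :=
  gradedBracket_eq_of_conjCoeff (A := DiffForm E M) Ω.dualLefschetz_pow Ω.opSeq_eq_conjCoeff

theorem isCommBVInfinityAlgebra : IsCommBVInfinityAlgebra (formsOfDegree E M)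
    (opSeq (extD E M) Ω.delta₁ Ω.delta₂) :=
  isCommBVInfinityAlgebra_of_conjCoeff (A := DiffForm E M) isCommDGAlgebra_forms
    Ω.dualLefschetz_pow Ω.hasOrderLE_dualLefschetz hasOrderLE_extD Ω.opSeq_eq_conjCoeff

theorem total_differential :
    PowerSeries.C (extD E M) + PowerSeries.C Ω.delta₁ * PowerSeries.X +
        PowerSeries.C Ω.delta₂ * PowerSeries.X ^ 2 =
      expSeries Ω.dualLefschetz * PowerSeries.C (extD E M) * expSeries (-Ω.dualLefschetz) :=
  total_differential_eq (A := DiffForm E M) Ω.dualLefschetz_pow Ω.opSeq_eq_conjCoeff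

theorem isPoissonContraction_dualLefschetz : Ω.IsPoissonContraction Ω.dualLefschetz := by
  intro α x
  rw [dualLefschetz_eq]
  exact (DFunLike.congr_fun (contractPoisson_eq (Ω.degree_two x) (Ω.nondegenerate x))
    (α.1 x)).symm

theorem adjoint_bracketDL_of_closed (h : extD E M Ω.form = 0) : Ω.adjoint Ω.bracketDL = 0 := by
  refine Ω.adjoint_eq fun α β x => ?_
  rw [bracketDL_eq, h]
  change Ω.fibrePairing x (0 * α.1 x) (β.1 x) = Ω.fibrePairing x (α.1 x) 0
  rw [zero_mul, map_zero, map_zero, LinearMap.zero_apply]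

theorem delta₁_of_closed (h : extD E M Ω.form = 0) : Ω.delta₁ = Ω.codiff := by
  have h0 := Ω.adjoint_bracketDL_of_closed h
  rw [delta₁_eq, h0]
  refine LinearMap.ext fun a => Subtype.ext (funext fun x => ?_)
  change (Ω.codiff a).1 x + (0 - (Ω.form.1 x) * 0) = (Ω.codiff a).1 x
  rw [mul_zero, sub_zero, add_zero]

theorem delta₂_of_closed (h : extD E M Ω.form = 0) : Ω.delta₂ = 0 := by
  rw [delta₂, adjoint_bracketDL_of_closed Ω h]
  exact LinearMap.ext fun a => Subtype.ext (funext fun x => neg_zero)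

end

end AlmostSymplecticForm

end SymplForms

end

/-! ### The theorem -/

theorem mainTheorem5
    {E : Type*} [NormedAddCommGroup E] [NormedSpace ℝ E] [FiniteDimensional ℝ E]
    {M : Type*} [TopologicalSpace M] [T2Space M] [SecondCountableTopology M]
    [ChartedSpace E M] [IsManifold 𝓘(ℝ, E) ∞ M]
    (Ω : AlmostSymplecticForm E M) :
    -- the symplectic star and the symplectic adjoints are well defined
    (∃! σ, Ω.IsSymplecticStar σ) ∧
    (∃! ψ, Ω.IsSymplecticAdjoint Ω.lefschetz ψ) ∧
    (∃! ψ, Ω.IsSymplecticAdjoint Ω.bracketDL ψ) ∧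
    (∃! ψ, Ω.IsSymplecticAdjoint Ω.bracketLambdaDL ψ) ∧
    -- the adjoints of `L` and `[d, L]` in terms of the symplectic star
    Ω.IsSymplecticAdjoint Ω.dualLefschetz Ω.lefschetz ∧
    Ω.dualLefschetz = Ω.hodgeStar * Ω.lefschetz * Ω.hodgeStar ∧
    Ω.adjoint Ω.bracketDL = -(Ω.hodgeStar * Ω.bracketDL * Ω.hodgeStar * parity E) ∧
    -- the commutative BV-infinity algebra
    IsCommBVInfinityAlgebra (formsOfDegree E M) (opSeq (extD E M) Ω.delta₁ Ω.delta₂) ∧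
    -- the total differential
    PowerSeries.C (extD E M) + PowerSeries.C Ω.delta₁ * PowerSeries.X +
        PowerSeries.C Ω.delta₂ * PowerSeries.X ^ 2 =
      expSeries Ω.dualLefschetz * PowerSeries.C (extD E M) * expSeries (-Ω.dualLefschetz) ∧
    -- the symplectic case
    (extD E M Ω.form = 0 →
      Ω.delta₁ = Ω.codiff ∧ Ω.delta₂ = 0 ∧
      IsBVAlgebra (formsOfDegree E M) (extD E M) Ω.codiff ∧
      ∃ ι, Ω.IsPoissonContraction ι ∧ gradedBracket (-2) 1 ι (extD E M) = Ω.codiff) := by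
  refine ⟨⟨_, Ω.isSymplecticStar_starOp, fun _ h => Ω.isSymplecticStar_unique h⟩,
    Ω.existsUnique_isSymplecticAdjoint (Ω.isSymplecticAdjoint_contractOp Ω.form), ?_,
    Ω.existsUnique_isSymplecticAdjoint Ω.isSymplecticAdjoint_bracketLambdaDL, ?_,
    Ω.dualLefschetz_eq_star, Ω.adjoint_bracketDL_eq_star, Ω.isCommBVInfinityAlgebra,
    Ω.total_differential, fun h => ⟨Ω.delta₁_of_closed h, Ω.delta₂_of_closed h, ?_,
      -- Contraction by the Poisson bivector is Λ itself, so Koszul's formula is the first-order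
      -- term of the conjugation.
      Ω.dualLefschetz, Ω.isPoissonContraction_dualLefschetz, ?_⟩⟩
  · rw [Ω.bracketDL_eq]
    exact Ω.existsUnique_isSymplecticAdjoint (Ω.isSymplecticAdjoint_contractOp _)
  · rw [Ω.dualLefschetz_eq]
    exact Ω.isSymplecticAdjoint_lefschetz
  · have hBV := Ω.isCommBVInfinityAlgebra
    rw [Ω.delta₁_of_closed h, Ω.delta₂_of_closed h] at hBV
    exact hBV
  · rw [← Ω.delta₁_of_closed h]
    exact Ω.delta₁_eq_bracket
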